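/- For $k\ge 1$ let $X^k(\mathbb R)=\{\phi\in L^\infty(\mathbb R;\mathbb C):\partial\phi\in H^{k-1}(\mathbb R)\}$ be the Zhidkov space, where $\partial=\partial_x$ is the weak derivative. Consider the Cauchy problem \[ i\partial_t u+\partial^2 u=-iu^2\,\partial\overline{u},\qquad u(0)=u_0, \tag{$*$} \] for $u:\mathbb R_t\times\mathbb R_x\to\mathbb C$. Let $\phi\in X^4(\mathbb R)$ and $u_0\in\phi+H^2(\mathbb R)$. A solution of $(*)$ on an open interval $I\ni 0$ is a function $u\in C(I,\phi+H^2(\mathbb R))$ which is differentiable as a function with values in $\phi+L^2(\mathbb R)$, with $u_t\in C(I,L^2(\mathbb R))$, which satisfies $u(0)=u_0$ and, for every $t\in I$, the equation in $(*)$ in $L^2(\mathbb R)$; it is maximal if it is not the restriction of a solution on a strictly larger open interval. Then there are $T_{min},T^{max}\in(0,\infty]$ such that $(*)$ has a unique maximal solution $u$, defined on $(-T_{min},T^{max})$, and every solution of $(*)$ on an open interval containing $0$ is a restriction of $u$. Moreover: (1) (Blow-up alternative.) If $T^{max}<\infty$, then $\lim_{t\uparrow T^{max}}\|u(t)-\phi\|_{H^2(\mathbb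 R)}=\infty$; if $T_{min}<\infty$, then $\lim_{t\downarrow -T_{min}}\|u(t)-\phi\|_{H^2(\mathbb R)}=\infty$. (2) (Continuous dependence.) If $(u_0^n)\subset\phi+H^2(\mathbb R)$ satisfies $\|u_0^n-u_0\|_{H^2(\mathbb R)}\to0$ as $n\to\infty$, then for every $[T_1,T_2]\subset(-T_{min},T^{max})$ the maximal solutions $u^n$ of the equation with $u^n(0)=u_0^n$ are defined on $[T_1,T_2]$ for all sufficiently large $n$, and \[ \lim_{n\to\infty}\|u^n-u\|_{L^\infty([T_1,T_2],H^2(\mathbb R))}=0 . \] -/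

import Mathlib

open MeasureTheory Filter Topology Set
open scoped ENNReal ContDiff ComplexConjugate

noncomputable section

namespace DNLS

/-- The locally integrable function `g` is the weak (distributional) derivative of the locally
integrable function `f` on `ℝ`. -/
structure HasWeakDeriv (f g : ℝ → ℂ) : Prop where
  locallyIntegrable : LocallyIntegrable f
  locallyIntegrable_deriv : LocallyIntegrable g
  integral_eq : ∀ ψ : ℝ → ℝ, ContDiff ℝ ∞ ψ → HasCompactSupport ψ →
    ∫ x, deriv ψ x • f x = -∫ x, ψ x • g x

theorem integrable_smul_test {ψ : ℝ → ℝ} (hψ : Continuous ψ) (hc : HasCompactSupport ψ)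
    {f : ℝ → ℂ} (hf : LocallyIntegrable f) : Integrable (fun x => ψ x • f x) :=
  hf.integrable_smul_left_of_hasCompactSupport hψ hc

theorem HasWeakDeriv.congr {f g f' g' : ℝ → ℂ} (h : HasWeakDeriv f g)
    (hf : f =ᵐ[volume] f') (hg : g =ᵐ[volume] g') : HasWeakDeriv f' g' := by
  refine ⟨h.locallyIntegrable.congr hf, h.locallyIntegrable_deriv.congr hg, ?_⟩
  intro ψ h1 h2
  have e1 : ∫ x, deriv ψ x • f' x = ∫ x, deriv ψ x • f x := by
    refine integral_congr_ae ?_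
    filter_upwards [hf] with x hx
    rw [hx]
  have e2 : ∫ x, ψ x • g' x = ∫ x, ψ x • g x := by
    refine integral_congr_ae ?_
    filter_upwards [hg] with x hx
    rw [hx]
  rw [e1, e2, h.integral_eq ψ h1 h2]

theorem HasWeakDeriv.add {f g f' g' : ℝ → ℂ} (h : HasWeakDeriv f g) (h' : HasWeakDeriv f' g') :
    HasWeakDeriv (f + f') (g + g') := by
  refine ⟨h.locallyIntegrable.add h'.locallyIntegrable,
    h.locallyIntegrable_deriv.add h'.locallyIntegrable_deriv, ?_⟩
  intro ψ h1 h2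
  have hd : Continuous (deriv ψ) := h1.continuous_deriv (by simp)
  simp only [Pi.add_apply, smul_add]
  rw [integral_add (integrable_smul_test hd h2.deriv h.locallyIntegrable)
      (integrable_smul_test hd h2.deriv h'.locallyIntegrable),
    integral_add (integrable_smul_test h1.continuous h2 h.locallyIntegrable_deriv)
      (integrable_smul_test h1.continuous h2 h'.locallyIntegrable_deriv),
    h.integral_eq ψ h1 h2, h'.integral_eq ψ h1 h2]
  ring

theorem HasWeakDeriv.const_smul {f g : ℝ → ℂ} (c : ℂ) (h : HasWeakDeriv f g) :
    HasWeakDeriv (c • f) (c • g) := by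
  refine ⟨h.locallyIntegrable.smul c, h.locallyIntegrable_deriv.smul c, ?_⟩
  intro ψ h1 h2
  simp only [Pi.smul_apply, smul_comm _ c]
  rw [integral_smul, integral_smul, h.integral_eq ψ h1 h2, smul_neg]

theorem HasWeakDeriv.zero : HasWeakDeriv 0 0 := by
  refine ⟨locallyIntegrable_zero, locallyIntegrable_zero, ?_⟩
  intro ψ _ _
  simp

/-- Weak derivatives are unique up to null sets. -/
theorem HasWeakDeriv.unique {f g g' : ℝ → ℂ} (h : HasWeakDeriv f g) (h' : HasWeakDeriv f g') :
    g =ᵐ[volume] g' := by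
  refine ae_eq_of_integral_contDiff_smul_eq h.locallyIntegrable_deriv
    h'.locallyIntegrable_deriv ?_
  intro ψ h1 h2
  have e := h.integral_eq ψ h1 h2
  rw [h'.integral_eq ψ h1 h2] at e
  exact (neg_injective e).symm

/-- The Lebesgue space `L²(ℝ)` of complex valued functions. -/
abbrev L2 : Type := Lp ℂ 2 (volume : Measure ℝ)

/-- The Sobolev space `H^k(ℝ)`: the functions `f ∈ L²(ℝ)` with weak derivatives
`∂f, …, ∂^k f ∈ L²(ℝ)`. The element `f` is stored together with its (unique) weak derivatives, as
the tuple `(f, ∂f, …, ∂^k f)` in the Hilbert space `(L²)^(k+1)`, so that the norm inherited from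
that space is the usual one, `‖f‖_{H^k} = (∑_{j ≤ k} ‖∂^j f‖²_{L²})^(1/2)`. -/
def Sobolev (k : ℕ) : Submodule ℂ (PiLp 2 fun _ : Fin (k + 1) => L2) where
  carrier := {F | ∀ j : Fin k, HasWeakDeriv (F j.castSucc : L2) (F j.succ : L2)}
  add_mem' hF hG j :=
    ((hF j).add (hG j)).congr (Lp.coeFn_add _ _).symm (Lp.coeFn_add _ _).symm
  zero_mem' _ := HasWeakDeriv.zero.congr (Lp.coeFn_zero _ _ _).symm (Lp.coeFn_zero _ _ _).symm
  smul_mem' c _ hF j :=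
    ((hF j).const_smul c).congr (Lp.coeFn_smul _ _).symm (Lp.coeFn_smul _ _).symm

/-- The function underlying an element of `H^k(ℝ)`. -/
def Sobolev.toL2 {k : ℕ} (w : Sobolev k) : L2 := w.1 0

/-- An element of `H^k(ℝ)` is determined by its underlying function. -/
theorem Sobolev.toL2_injective {k : ℕ} :
    Function.Injective (Sobolev.toL2 : Sobolev k → L2) := by
  intro v w h
  apply Subtype.ext
  ext1 j
  induction j using Fin.induction with
  | zero => exact h
  | succ j ih =>
    apply Lp.ext
    have hv := v.2 j
    rw [ih] at hv
    exact hv.unique (w.2 j)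

/-- Membership in the Zhidkov space `X^k(ℝ) = {φ ∈ L^∞(ℝ) : ∂φ ∈ H^(k-1)(ℝ)}`, for `k ≥ 1`. -/
def MemZhidkov (k : ℕ) (φ : ℝ → ℂ) : Prop :=
  MemLp φ ∞ ∧ ∃ g : Sobolev (k - 1), HasWeakDeriv φ (Sobolev.toL2 g)

/-- The element `φ + w` of the affine space `φ + H²(ℝ)`. -/
def shift (φ : ℝ → ℂ) (w : Sobolev 2) : ℝ → ℂ := fun x => φ x + Sobolev.toL2 w x

/-- The equation `i ∂ₜu + ∂²u = -i u² ∂ū` at a fixed time, where `u` is the profile at that time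
and `ut` is its time derivative. -/
def SolvesAt (u ut : ℝ → ℂ) : Prop :=
  ∃ ux uxx : ℝ → ℂ, HasWeakDeriv u ux ∧ HasWeakDeriv ux uxx ∧
    ∀ᵐ x, Complex.I * ut x + uxx x = -Complex.I * u x ^ 2 * conj (ux x)

/-- The time interval `(-Tmin, Tmax)`; both ends may be infinite. -/
def timeInterval (Tmin Tmax : EReal) : Set ℝ := {t : ℝ | -Tmin < (t : EReal) ∧ (t : EReal) < Tmax}

/-- `u(t) = φ + w(t)` is a solution of the Cauchy problem `i ∂ₜu + ∂²u = -i u² ∂ū`,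
`u(0) = φ + w₀`, on `(-Tmin, Tmax)`, of class `C((-Tmin, Tmax), φ + H²)`, differentiable with values
in `φ + L²` and with `∂ₜu ∈ C((-Tmin, Tmax), L²)`. The values of `w` outside the interval are
irrelevant. -/
structure IsSolution (φ : ℝ → ℂ) (w₀ : Sobolev 2) (Tmin Tmax : EReal) (w : ℝ → Sobolev 2) :
    Prop where
  Tmin_pos : 0 < Tmin
  Tmax_pos : 0 < Tmax
  initial : w 0 = w₀
  continuousOn : ContinuousOn w (timeInterval Tmin Tmax)
  equation : ∃ ut : ℝ → L2, ContinuousOn ut (timeInterval Tmin Tmax) ∧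
    ∀ t ∈ timeInterval Tmin Tmax,
      HasDerivAt (fun s => Sobolev.toL2 (w s)) (ut t) t ∧ SolvesAt (shift φ (w t)) (ut t)

/-- A maximal solution: one that is not the restriction of a solution on a strictly larger
interval. -/
structure IsMaximalSolution (φ : ℝ → ℂ) (w₀ : Sobolev 2) (Tmin Tmax : EReal)
    (w : ℝ → Sobolev 2) : Prop where
  isSolution : IsSolution φ w₀ Tmin Tmax w
  maximal : ∀ (Smin Smax : EReal) (v : ℝ → Sobolev 2), IsSolution φ w₀ Smin Smax v →
    Tmin ≤ Smin → Tmax ≤ Smax → EqOn v w (timeInterval Tmin Tmax) → Smin = Tmin ∧ Smax = Tmax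

end DNLS

end

/-! Write `u = φ + w`. The term `u² ∂ū` costs one derivative, so a fixed point for Duhamel's formula
in `H²` does not close directly. The loss is removed by a normal form. For a solution, `(i∂ₜ +
∂²)(|u|²u) = 2∂(u²∂ū) + r`, where `r` involves only `u` and `∂u`: the terms `|u|²∂²u` cancel and the
two terms `u²∂²ū` add up (`cubicLin_vectorField`). With `κ = 1 + ν²`, `R = (κ - ∂²)⁻¹` and `T = -∂R`
one has `T∂ = 1 - κR`. Hence in the equation of `z = w + (i/2) T(|u|²u - |φ|²φ)` the new term `(i/2)
T(2∂(u²∂ū))` cancels `-i u²∂ū` up to `R(u²∂ū)`.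

The result is `i∂ₜz + ∂²z = F(w)` with `F` Lipschitz on bounded sets from `H²` to `H²`
(`normalRHS_identity`, `lipBdd_normalRHS`): `T` gains one derivative on a function in `H¹`, `R`
gains two on `u²∂ū`, and `∂²φ` lies in `H²` because `φ` is in `X⁴`. Moreover `T` has norm at most
`1/(2ν)`. For `ν` large, depending on a ball of `H²`, the map `w ↦ z` is there the identity plus a
map with Lipschitz constant `1/4`, and its linearization is invertible on `L²`. So the two problems
are equivalent on the ball (`exists_normalForm`).

The rest is abstract. A contraction argument for `z` gives existence on a time depending only on the
size of the data (`exists_solOn`), and Gronwall's inequality gives Lipschitz stability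
(`exists_norm_sub_le`). Solutions are differentiable only in `L²`, so time derivatives are taken
there, while estimates are made in `H²`. These two facts, collected in `LocallyWellPosed`, suffice
for gluing local solutions into a maximal flow, for the blow-up alternative and for continuous
dependence (`exists_extension`, `tendsto_norm_flow`, `exists_flow_sub_le`). -/

namespace DNLS

/-! ### Weak derivatives and absolutely continuous representatives. -/

section WeakDerivative

/-- `F` is a primitive of the locally integrable function `f`. -/
structure IsPrimitive (F f : ℝ → ℂ) : Prop where
  locallyIntegrable : LocallyIntegrable f
  integral_eq : ∀ a b, ∫ x in a..b, f x = F b - F a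

theorem intervalIntegrable_of_locallyIntegrable {E : Type*} [NormedAddCommGroup E] {f : ℝ → E}
    (hf : LocallyIntegrable f) (a b : ℝ) : IntervalIntegrable f volume a b :=
  intervalIntegrable_iff.mpr <|
    (hf.integrableOn_isCompact isCompact_uIcc).mono_set uIoc_subset_uIcc

namespace IsPrimitive

variable {F f G g : ℝ → ℂ}

theorem eq_add (h : IsPrimitive F f) (a x : ℝ) : F x = F a + ∫ t in a..x, f t := by
  rw [h.integral_eq]; ring

theorem continuous (h : IsPrimitive F f) : Continuous F := by
  have e : F = fun x => F 0 + ∫ t in (0 : ℝ)..x, f t := funext fun x => h.eq_add 0 x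
  rw [e]
  exact continuous_const.add
    (intervalIntegral.continuous_primitive
      (intervalIntegrable_of_locallyIntegrable h.locallyIntegrable) 0)

theorem ae_hasDerivAt (h : IsPrimitive F f) : ∀ᵐ x, HasDerivAt F (f x) x := by
  have e : F = fun x => F 0 + ∫ t in (0 : ℝ)..x, f t := funext fun x => h.eq_add 0 x
  filter_upwards [_root_.LocallyIntegrable.ae_hasDerivAt_integral h.locallyIntegrable] with x hx
  rw [e]
  exact (hx 0).const_add _

theorem absolutelyContinuous (h : IsPrimitive F f) (a b : ℝ) :
    AbsolutelyContinuousOnInterval F a b := by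
  have hi := intervalIntegrable_of_locallyIntegrable h.locallyIntegrable a b
  have hr : IntervalIntegrable (fun x => (f x).re) volume a b := ⟨hi.1.re, hi.2.re⟩
  have hm : IntervalIntegrable (fun x => (f x).im) volume a b := ⟨hi.1.im, hi.2.im⟩
  have cst (c : ℂ) : AbsolutelyContinuousOnInterval (fun _ : ℝ => c) a b :=
    (LipschitzWith.const c).lipschitzOnWith.absolutelyContinuousOnInterval
  have h1 := (hr.absolutelyContinuousOnInterval_intervalIntegral left_mem_uIcc).fun_smul
    (cst 1)
  have h2 := (hm.absolutelyContinuousOnInterval_intervalIntegral left_mem_uIcc).fun_smul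
    (cst Complex.I)
  have h3 := (cst (F a)).add (h1.add h2)
  -- Absolute continuity is a limit along families of subintervals of `uIcc a b`, so agreement of
  -- the two functions on `uIcc a b` is enough.
  refine Tendsto.congr' ?_ h3
  filter_upwards [mem_inf_of_right (mem_principal_self _)] with E hE
  refine Finset.sum_congr rfl fun i hi => ?_
  have key : ∀ x ∈ uIcc a b, F a + ((∫ v in a..x, (f v).re) • (1 : ℂ) +
      (∫ v in a..x, (f v).im) • Complex.I) = F x := by
    intro x hx
    have hix := intervalIntegrable_of_locallyIntegrable h.locallyIntegrable a x
    rw [h.eq_add a x]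
    congr 1
    apply Complex.ext
    · simpa using (intervalIntegral.intervalIntegral_eq_integral_uIoc (f := f) a x volume ▸
        Complex.reCLM.intervalIntegral_comp_comm hix)
    · simpa using (intervalIntegral.intervalIntegral_eq_integral_uIoc (f := f) a x volume ▸
        Complex.imCLM.intervalIntegral_comp_comm hix)
  simp only [Pi.add_apply]
  rw [key _ (hE.1 i hi).1, key _ (hE.1 i hi).2]

end IsPrimitive

/-- The difference of `F` and the integral of `f` is absolutely continuous with derivative zero
almost everywhere, hence constant. -/
theorem isPrimitive_of_absolutelyContinuous {F f : ℝ → ℂ}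
    (hF : ∀ a b, AbsolutelyContinuousOnInterval F a b) (hf : LocallyIntegrable f)
    (h : ∀ᵐ x, HasDerivAt F (f x) x) : IsPrimitive F f := by
  refine ⟨hf, fun a b => ?_⟩
  have hp : IsPrimitive (fun x => ∫ t in a..x, f t) f :=
    ⟨hf, fun c d => by
      rw [intervalIntegral.integral_interval_sub_left] <;>
        exact intervalIntegrable_of_locallyIntegrable hf _ _⟩
  obtain ⟨C, hC⟩ := ((hF a b).fun_sub (hp.absolutelyContinuous a b)).const_of_ae_hasDerivAt_zero
    (by
      filter_upwards [h, hp.ae_hasDerivAt] with x h1 h2 _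
      simpa using h1.fun_sub h2)
  have h1 := hC a left_mem_uIcc
  have h2 := hC b right_mem_uIcc
  simp only [intervalIntegral.integral_same, sub_zero] at h1
  rw [h1, ← h2]; ring

theorem locallyIntegrable_mul_continuous {f g : ℝ → ℂ} (hf : LocallyIntegrable f)
    (hg : Continuous g) : LocallyIntegrable fun x => f x * g x := by
  rw [locallyIntegrable_iff] at hf ⊢
  intro K hK
  exact (hf K hK).mul_continuousOn hg.continuousOn hK

namespace IsPrimitive

variable {F f G g : ℝ → ℂ}

theorem mul (hF : IsPrimitive F f) (hG : IsPrimitive G g) :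
    IsPrimitive (fun x => F x * G x) (fun x => f x * G x + F x * g x) := by
  refine isPrimitive_of_absolutelyContinuous
    (fun a b => (hF.absolutelyContinuous a b).fun_smul (hG.absolutelyContinuous a b)) ?_ ?_
  · refine (locallyIntegrable_mul_continuous hF.locallyIntegrable hG.continuous).add ?_
    simpa only [mul_comm] using
      locallyIntegrable_mul_continuous hG.locallyIntegrable hF.continuous
  · filter_upwards [hF.ae_hasDerivAt, hG.ae_hasDerivAt] with x h1 h2
    exact h1.mul h2

theorem of_contDiff {ψ : ℝ → ℝ} (hψ : ContDiff ℝ 1 ψ) :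
    IsPrimitive (fun x => (ψ x : ℂ)) (fun x => ((deriv ψ x : ℝ) : ℂ)) := by
  have hc : Continuous (deriv ψ) := hψ.continuous_deriv le_rfl
  refine ⟨(Complex.continuous_ofReal.comp hc).locallyIntegrable, fun a b => ?_⟩
  have := intervalIntegral.integral_deriv_eq_sub' (a := a) (b := b) ψ rfl
    (fun x _ => hψ.differentiable one_ne_zero x) hc.continuousOn
  rw [← Complex.ofReal_sub, ← this, intervalIntegral.integral_ofReal]

/-- The product `ψ F` is a primitive of `ψ' F + ψ f` and vanishes at both ends of an interval
containing the support of `ψ`. -/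
theorem hasWeakDeriv (h : IsPrimitive F f) : HasWeakDeriv F f := by
  refine ⟨h.continuous.locallyIntegrable, h.locallyIntegrable, fun ψ h1 h2 => ?_⟩
  have hp := (of_contDiff (h1.of_le (by simp))).mul h
  have hd : Continuous (deriv ψ) := h1.continuous_deriv (by simp)
  have i1 := integrable_smul_test hd h2.deriv h.continuous.locallyIntegrable
  have i2 := integrable_smul_test h1.continuous h2 h.locallyIntegrable
  have hz : ∫ x, (((deriv ψ x : ℝ) : ℂ) * F x + (ψ x : ℂ) * f x) = 0 := by
    obtain ⟨R, hR⟩ := h2.isBounded.subset_closedBall 0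
    have hs : ∀ x, R < |x| → x ∉ tsupport ψ := fun x hx hm => by
      have := hR hm
      simp only [Metric.mem_closedBall, dist_zero_right, Real.norm_eq_abs] at this
      linarith
    have h0 : ∀ x, R < |x| → ψ x = 0 := fun x hx => image_eq_zero_of_notMem_tsupport (hs x hx)
    have h0' : ∀ x, R < |x| → deriv ψ x = 0 := fun x hx => by
      have := fun hm => hs x hx (support_deriv_subset hm)
      simpa using this
    set a := |R| + 1
    have ha : R < a := lt_of_le_of_lt (le_abs_self R) (lt_add_one _)
    have ha0 : 0 < a := by positivity
    rw [← intervalIntegral.integral_eq_integral_of_support_subset (a := -a) (b := a),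
      hp.integral_eq, h0 a (by rwa [abs_of_pos ha0]), h0 (-a) (by rwa [abs_neg, abs_of_pos ha0])]
    · simp
    · intro x hx
      by_contra hxa
      have hR' : R < |x| := by
        rw [mem_Ioc, not_and_or, not_lt, not_le] at hxa
        rcases hxa with hxa | hxa
        · exact lt_of_lt_of_le ha (by linarith [neg_le_abs x])
        · exact ha.trans (hxa.trans_le (le_abs_self x))
      exact hx (by simp [h0 x hR', h0' x hR'])
  have e := integral_add i1 i2
  simp only [Complex.real_smul] at e ⊢
  rw [hz] at e
  exact eq_neg_of_add_eq_zero_left e.symm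

end IsPrimitive

theorem isPrimitive_intervalIntegral {f : ℝ → ℂ} (hf : LocallyIntegrable f) (c : ℝ) :
    IsPrimitive (fun x => ∫ t in c..x, f t) f :=
  ⟨hf, fun a b => by
    rw [intervalIntegral.integral_interval_sub_left] <;>
      exact intervalIntegrable_of_locallyIntegrable hf _ _⟩

/-- The primitive that starts to the left of the support is again zero to the right of it, because
the total integral is zero. -/
theorem exists_test_primitive {η : ℝ → ℝ} (h1 : ContDiff ℝ ∞ η) (h2 : HasCompactSupport η)
    (h3 : ∫ x, η x = 0) :
    ∃ ψ : ℝ → ℝ, ContDiff ℝ ∞ ψ ∧ HasCompactSupport ψ ∧ deriv ψ = η := by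
  obtain ⟨R, hR⟩ := h2.isBounded.subset_closedBall 0
  have h0 : ∀ x, R < |x| → η x = 0 := fun x hx => by
    refine image_eq_zero_of_notMem_tsupport fun hm => ?_
    have := hR hm
    simp only [Metric.mem_closedBall, dist_zero_right, Real.norm_eq_abs] at this
    linarith
  set a := |R| + 1
  have ha : R < a := lt_of_le_of_lt (le_abs_self R) (lt_add_one _)
  have ha0 : 0 < a := by positivity
  have hd : ∀ x, HasDerivAt (fun x => ∫ t in (-a)..x, η t) (η x) x := fun x =>
    intervalIntegral.integral_hasDerivAt_right (h1.continuous.intervalIntegrable _ _)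
      (h1.continuous.stronglyMeasurableAtFilter _ _) h1.continuous.continuousAt
  have hd' : deriv (fun x => ∫ t in (-a)..x, η t) = η := funext fun x => (hd x).deriv
  refine ⟨fun x => ∫ t in (-a)..x, η t, ?_, ?_, hd'⟩
  · rw [contDiff_infty_iff_deriv]
    exact ⟨fun x => (hd x).differentiableAt, by rwa [hd']⟩
  · refine HasCompactSupport.intro (isCompact_Icc (a := -a) (b := a)) fun x hx => ?_
    rw [mem_Icc, not_and_or, not_le, not_le] at hx
    rcases hx with hx | hx
    · rw [intervalIntegral.integral_symm, neg_eq_zero]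
      refine intervalIntegral.integral_zero_ae (Eventually.of_forall fun t ht => h0 t ?_)
      rw [uIoc_of_le hx.le] at ht
      exact lt_of_lt_of_le ha (by linarith [neg_le_abs t, ht.2])
    · rw [intervalIntegral.integral_eq_integral_of_support_subset, h3]
      intro t ht
      by_contra hta
      refine ht (h0 t ?_)
      rw [mem_Ioc, not_and_or, not_lt, not_le] at hta
      rcases hta with hta | hta
      · exact lt_of_lt_of_le ha (by linarith [neg_le_abs t])
      · exact ha.trans ((hx.trans hta).trans_le (le_abs_self t))

/-- The lemma of du Bois-Reymond. -/
theorem HasWeakDeriv.ae_const {f : ℝ → ℂ} (h : HasWeakDeriv f 0) :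
    ∃ c : ℂ, f =ᵐ[volume] fun _ => c := by
  let B : ContDiffBump (0 : ℝ) := ⟨1, 2, one_pos, one_lt_two⟩
  let χ : ℝ → ℝ := B.normed volume
  have χ1 : ContDiff ℝ ∞ χ := B.contDiff_normed
  have χ2 : HasCompactSupport χ := B.hasCompactSupport_normed
  have χ3 : ∫ x, χ x = 1 := B.integral_normed
  refine ⟨∫ x, χ x • f x, ?_⟩
  refine ae_eq_of_integral_contDiff_smul_eq h.locallyIntegrable
    continuous_const.locallyIntegrable fun η h1 h2 => ?_
  have iη : Integrable η := h1.continuous.integrable_of_hasCompactSupport h2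
  have iχ : Integrable χ := χ1.continuous.integrable_of_hasCompactSupport χ2
  -- Subtracting the multiple of `χ` makes the mean zero, so the difference is the derivative of a
  -- test function and `f` integrates to zero against it.
  obtain ⟨ψ, p1, p2, p3⟩ := exists_test_primitive (η := fun x => η x - (∫ t, η t) * χ x)
    (h1.sub (contDiff_const.mul χ1)) (h2.sub (χ2.mul_left))
    (by rw [integral_sub iη (iχ.const_mul _), integral_const_mul, χ3]; ring)
  have e := h.integral_eq ψ p1 p2
  rw [p3] at e
  simp only [Pi.zero_apply, smul_zero, integral_zero, neg_zero, sub_smul, mul_smul] at e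
  rw [integral_sub (integrable_smul_test h1.continuous h2 h.locallyIntegrable)
    ((integrable_smul_test χ1.continuous χ2 h.locallyIntegrable).fun_smul _), integral_smul,
    sub_eq_zero] at e
  rw [e, integral_smul_const]

theorem HasWeakDeriv.sub {f g f' g' : ℝ → ℂ} (h : HasWeakDeriv f g) (h' : HasWeakDeriv f' g') :
    HasWeakDeriv (f - f') (g - g') := by
  simpa [sub_eq_add_neg] using h.add (h'.const_smul (-1))

theorem HasWeakDeriv.exists_isPrimitive {f g : ℝ → ℂ} (h : HasWeakDeriv f g) :
    ∃ F, f =ᵐ[volume] F ∧ IsPrimitive F g := by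
  have hp := isPrimitive_intervalIntegral h.locallyIntegrable_deriv 0
  have hd := h.sub hp.hasWeakDeriv
  rw [sub_self] at hd
  obtain ⟨c, hc⟩ := hd.ae_const
  refine ⟨fun x => (∫ t in (0 : ℝ)..x, g t) + c, ?_, h.locallyIntegrable_deriv, fun a b => ?_⟩
  · filter_upwards [hc] with x hx
    rw [← hx]; simp
  · rw [hp.integral_eq]; ring

/-- In one dimension the Leibniz rule needs no integrability beyond the hypotheses: both factors
have continuous representatives. -/
theorem HasWeakDeriv.mul {f g f' g' : ℝ → ℂ} (h : HasWeakDeriv f f') (h' : HasWeakDeriv g g') :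
    HasWeakDeriv (f * g) (f' * g + f * g') := by
  obtain ⟨F, hF, pF⟩ := h.exists_isPrimitive
  obtain ⟨G, hG, pG⟩ := h'.exists_isPrimitive
  refine (pF.mul pG).hasWeakDeriv.congr ?_ ?_
  · filter_upwards [hF, hG] with x h1 h2
    simp [h1, h2]
  · filter_upwards [hF, hG] with x h1 h2
    simp [h1, h2]

theorem HasWeakDeriv.star {f f' : ℝ → ℂ} (h : HasWeakDeriv f f') :
    HasWeakDeriv (fun x => conj (f x)) (fun x => conj (f' x)) := by
  obtain ⟨F, hF, pF⟩ := h.exists_isPrimitive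
  have hl : LocallyIntegrable fun x => conj (f' x) := by
    have := pF.locallyIntegrable
    rw [locallyIntegrable_iff] at this ⊢
    intro K hK
    exact Complex.conjCLE.toContinuousLinearMap.integrable_comp (this K hK)
  have : IsPrimitive (fun x => conj (F x)) (fun x => conj (f' x)) := by
    refine ⟨hl, fun a b => ?_⟩
    rw [← map_sub, ← pF.integral_eq]
    exact Complex.conjCLE.toContinuousLinearMap.intervalIntegral_comp_comm
      (intervalIntegrable_of_locallyIntegrable pF.locallyIntegrable a b)
  refine this.hasWeakDeriv.congr ?_ EventuallyEq.rfl
  filter_upwards [hF] with x h1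
  simp [h1]

/-- The integral of the weak derivative of an integrable function vanishes. -/
theorem HasWeakDeriv.integral_eq_zero {f f' : ℝ → ℂ} (h : HasWeakDeriv f f')
    (hf : Integrable f) (hf' : Integrable f') : ∫ x, f' x = 0 := by
  obtain ⟨F, hF, pF⟩ := h.exists_isPrimitive
  have iF : Integrable F := hf.congr hF
  have hR : Tendsto F atTop (𝓝 (F 0 + ∫ x in Ioi 0, f' x)) := by
    have := (intervalIntegral_tendsto_integral_Ioi 0 hf'.integrableOn tendsto_id).const_add (F 0)
    exact this.congr fun x => (pF.eq_add 0 x).symm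
  have hL : Tendsto F atBot (𝓝 (F 0 - ∫ x in Iic 0, f' x)) := by
    have := (intervalIntegral_tendsto_integral_Iic 0 hf'.integrableOn tendsto_id).const_sub (F 0)
    refine this.congr fun x => ?_
    simp only [id]
    rw [pF.integral_eq]; ring
  -- An integrable function cannot stay above `‖c‖ / 2` on a set of infinite measure, so both limits
  -- at infinity vanish.
  have zero_of {l : Filter ℝ} {c : ℂ} (hc : Tendsto F l (𝓝 c))
      (hl : ∀ s ∈ l, volume s = ⊤) : c = 0 := by
    by_contra hne
    have hpos : 0 < ‖c‖ := norm_pos_iff.mpr hne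
    have hev : {x | ‖c‖ / 2 ≤ ‖F x‖} ∈ l := by
      filter_upwards [hc.norm.eventually_const_lt (half_lt_self hpos)] with x hx using hx.le
    have := iF.measure_norm_ge_lt_top (half_pos hpos)
    exact this.ne (hl _ hev)
  have e1 := zero_of hR fun s hs => by
    obtain ⟨a, ha⟩ := mem_atTop_sets.mp hs
    exact measure_mono_top (show Ici a ⊆ s from ha) Real.volume_Ici
  have e2 := zero_of hL fun s hs => by
    obtain ⟨a, ha⟩ := mem_atBot_sets.mp hs
    exact measure_mono_top (show Iic a ⊆ s from ha) Real.volume_Iic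
  have := intervalIntegral.integral_Iic_add_Ioi (b := 0) hf'.integrableOn hf'.integrableOn
  rw [← this]
  linear_combination e1 - e2

end WeakDerivative

end DNLS

namespace DNLS

open BoundedContinuousFunction

/-- Bounded continuous complex valued functions on the line. -/
abbrev BCF : Type := ℝ →ᵇ ℂ

/-! ### Multiplication by bounded continuous functions and conjugation on `L²`. -/

section Multiplication

theorem memLp_bcf_mul (a : BCF) (f : L2) : MemLp (fun x => a x * f x) 2 :=
  (Lp.memLp f).mul' (p := ∞) a.memLp_top

/-- Multiplication of square integrable functions by bounded continuous functions. -/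
noncomputable def bmul : BCF →L[ℂ] L2 →L[ℂ] L2 :=
  LinearMap.mkContinuous₂
    (LinearMap.mk₂ ℂ (fun a f => (memLp_bcf_mul a f).toLp)
      (fun a b f => by
        rw [← MemLp.toLp_add]
        exact MemLp.toLp_congr _ _ (Eventually.of_forall fun x => by simp [add_mul]))
      (fun c a f => by
        rw [← MemLp.toLp_const_smul]
        exact MemLp.toLp_congr _ _ (Eventually.of_forall fun x => by simp [mul_assoc]))
      (fun a f g => by
        rw [← MemLp.toLp_add]
        refine MemLp.toLp_congr _ _ ?_
        filter_upwards [Lp.coeFn_add f g] with x hx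
        rw [hx, Pi.add_apply, mul_add, Pi.add_apply])
      (fun c a f => by
        rw [← MemLp.toLp_const_smul]
        refine MemLp.toLp_congr _ _ ?_
        filter_upwards [Lp.coeFn_smul c f] with x hx
        simp only [hx, Pi.smul_apply, smul_eq_mul]; ring))
    1 fun a f => by
      rw [one_mul]
      refine Lp.norm_le_mul_norm_of_ae_le_mul ?_
      filter_upwards [(memLp_bcf_mul a f).coeFn_toLp] with x hx
      simp only [LinearMap.mk₂_apply]
      rw [hx, norm_mul]
      gcongr
      exact a.norm_coe_le_norm x

theorem coeFn_bmul (a : BCF) (f : L2) : (bmul a f : L2) =ᵐ[volume] fun x => a x * f x :=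
  (memLp_bcf_mul a f).coeFn_toLp

theorem norm_bmul_le (a : BCF) (f : L2) : ‖bmul a f‖ ≤ ‖a‖ * ‖f‖ := by
  refine Lp.norm_le_mul_norm_of_ae_le_mul ?_
  filter_upwards [coeFn_bmul a f] with x hx
  rw [hx, norm_mul]
  gcongr
  exact a.norm_coe_le_norm x

theorem bmul_mul (a b : BCF) (f : L2) : bmul (a * b) f = bmul a (bmul b f) := by
  apply Lp.ext
  filter_upwards [coeFn_bmul (a * b) f, coeFn_bmul a (bmul b f), coeFn_bmul b f] with x h1 h2 h3
  rw [h1, h2, h3]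
  simp [mul_assoc]

theorem bmul_one (f : L2) : bmul 1 f = f := by
  apply Lp.ext
  filter_upwards [coeFn_bmul 1 f] with x h1
  rw [h1]; simp

/-- Complex conjugation on `L²`. -/
noncomputable def conjL2 : L2 →L[ℝ] L2 := Complex.conjCLE.toContinuousLinearMap.compLpL 2 volume

theorem coeFn_conjL2 (f : L2) : (conjL2 f : L2) =ᵐ[volume] fun x => conj (f x) :=
  Complex.conjCLE.toContinuousLinearMap.coeFn_compLpL f

theorem norm_conjL2 (f : L2) : ‖conjL2 f‖ = ‖f‖ := by
  refine le_antisymm (Lp.norm_le_norm_of_ae_le ?_) (Lp.norm_le_norm_of_ae_le ?_) <;>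
  · filter_upwards [coeFn_conjL2 f] with x hx
    rw [hx, RCLike.norm_conj]

end Multiplication

/-! ### Bounded continuous representatives. -/

section Embedding

theorem integral_norm_le_of_L2 (f : L2) (x : ℝ) : ∫ t in Icc x (x + 1), ‖f t‖ ≤ ‖f‖ := by
  have : IsProbabilityMeasure (volume.restrict (Icc x (x + 1))) := ⟨by simp⟩
  have hm : AEStronglyMeasurable f (volume.restrict (Icc x (x + 1))) :=
    (Lp.aestronglyMeasurable f).restrict
  have h := (eLpNorm_le_eLpNorm_of_exponent_le one_le_two hm).trans
    (eLpNorm_mono_measure f Measure.restrict_le_self)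
  rw [eLpNorm_one_eq_lintegral_enorm] at h
  rw [integral_norm_eq_lintegral_enorm hm, Lp.norm_def]
  exact ENNReal.toReal_mono (Lp.eLpNorm_ne_top f) h

theorem bcf_eq_of_ae_eq {a b : BCF} (h : (a : ℝ → ℂ) =ᵐ[volume] b) : a = b :=
  DFunLike.coe_injective ((Continuous.ae_eq_iff_eq volume a.continuous b.continuous).mp h)

theorem exists_bcf_of_bound {f F : ℝ → ℂ} (hF : Continuous F) (h : f =ᵐ[volume] F) {C : ℝ}
    (hC : ∀ x, ‖F x‖ ≤ C) : ∃ a : BCF, f =ᵐ[volume] a ∧ ∀ x, ‖a x‖ ≤ C :=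
  ⟨BoundedContinuousFunction.ofNormedAddCommGroup F hF C hC, h, hC⟩

/-- The one dimensional Sobolev embedding `H¹ ⊂ L^∞`. -/
theorem exists_bcf_of_hasWeakDeriv {f g : L2} (h : HasWeakDeriv f g) :
    ∃ a : BCF, f =ᵐ[volume] a ∧ ∀ x, ‖a x‖ ≤ ‖f‖ + ‖g‖ := by
  obtain ⟨F, hF, pF⟩ := h.exists_isPrimitive
  refine exists_bcf_of_bound pF.continuous hF fun x => ?_
  have hg : IntegrableOn g (Icc x (x + 1)) :=
    pF.locallyIntegrable.integrableOn_isCompact isCompact_Icc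
  have hFi : IntegrableOn F (Icc x (x + 1)) :=
    pF.continuous.locallyIntegrable.integrableOn_isCompact isCompact_Icc
  -- On a unit interval the `L¹` norm is at most the `L²` norm, so this bound can be averaged over
  -- `y`.
  have key : ∀ y ∈ Icc x (x + 1), ‖F x‖ ≤ ‖F y‖ + ‖g‖ := by
    intro y hy
    have e : F x = F y - ∫ t in x..y, g t := by rw [pF.integral_eq]; ring
    rw [e]
    refine (norm_sub_le _ _).trans (add_le_add_right ?_ _)
    refine (intervalIntegral.norm_integral_le_integral_norm hy.1).trans ?_
    rw [intervalIntegral.integral_of_le hy.1]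
    refine le_trans ?_ (integral_norm_le_of_L2 g x)
    exact setIntegral_mono_set hg.norm (Eventually.of_forall fun _ => norm_nonneg _)
      (Ioc_subset_Icc_self.trans (Icc_subset_Icc_right hy.2)).eventuallyLE
  have h1 : ∫ _ in Icc x (x + 1), ‖F x‖ ≤ ∫ y in Icc x (x + 1), (‖F y‖ + ‖g‖) :=
    setIntegral_mono_on (by simp) (hFi.norm.add (by simp)) measurableSet_Icc key
  rw [integral_add hFi.norm (by simp)] at h1
  have h2 : ∫ y in Icc x (x + 1), ‖F y‖ = ∫ y in Icc x (x + 1), ‖f y‖ :=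
    setIntegral_congr_ae measurableSet_Icc (by filter_upwards [hF] with y hy _; rw [hy])
  simp only [integral_const, MeasurableSet.univ, measureReal_restrict_apply, univ_inter,
    Real.volume_real_Icc, add_sub_cancel_left, zero_le_one, sup_of_le_left, one_smul, h2] at h1
  linarith [integral_norm_le_of_L2 f x]

/-- The essential bound holds for the continuous representative on a closed set of full measure;
such a set is dense, hence everything. -/
theorem exists_bcf_of_memLp_top {f g : ℝ → ℂ} (h : HasWeakDeriv f g) (hf : MemLp f ∞) :
    ∃ a : BCF, f =ᵐ[volume] a := by
  obtain ⟨F, hF, pF⟩ := h.exists_isPrimitive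
  have hF' := hf.ae_eq hF
  have hb := ae_le_eLpNormEssSup (f := F) (μ := volume)
  have hfin : eLpNormEssSup F volume ≠ ⊤ := by
    have := hF'.2.ne
    rwa [eLpNorm_exponent_top] at this
  have hcl : IsClosed {x | ‖F x‖ ≤ (eLpNormEssSup F volume).toReal} :=
    isClosed_le pF.continuous.norm continuous_const
  have hae : ∀ᵐ x, x ∈ {x | ‖F x‖ ≤ (eLpNormEssSup F volume).toReal} := by
    filter_upwards [hb] with x hx
    have := ENNReal.toReal_mono hfin hx
    simpa using this
  have huniv : {x | ‖F x‖ ≤ (eLpNormEssSup F volume).toReal} = univ := by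
    rw [← hcl.closure_eq]
    exact (Measure.dense_of_ae hae).closure_eq
  obtain ⟨a, ha, -⟩ := exists_bcf_of_bound pF.continuous hF fun x =>
    (huniv ▸ mem_univ x : x ∈ {x | ‖F x‖ ≤ (eLpNormEssSup F volume).toReal})
  exact ⟨a, ha⟩

/-- The `j`-th weak derivative, as a square integrable function. -/
noncomputable def Sobolev.der {k : ℕ} (j : Fin (k + 1)) : Sobolev k →L[ℂ] L2 :=
  (PiLp.proj 2 (fun _ : Fin (k + 1) => L2) j).comp (Sobolev k).subtypeL

theorem Sobolev.norm_der_le {k : ℕ} (j : Fin (k + 1)) (w : Sobolev k) : ‖der j w‖ ≤ ‖w‖ :=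
  PiLp.norm_apply_le w.1 j

theorem Sobolev.hasWeakDeriv {k : ℕ} (w : Sobolev k) (j : Fin k) :
    HasWeakDeriv (der j.castSucc w : L2) (der j.succ w : L2) := w.2 j

theorem Sobolev.exists_rep {k : ℕ} (j : Fin k) (w : Sobolev k) :
    ∃ a : BCF, (der j.castSucc w : L2) =ᵐ[volume] a ∧ ∀ x, ‖a x‖ ≤ 2 * ‖w‖ := by
  obtain ⟨a, h1, h2⟩ := exists_bcf_of_hasWeakDeriv (hasWeakDeriv w j)
  exact ⟨a, h1, fun x => by
    linarith [h2 x, norm_der_le j.castSucc w, norm_der_le j.succ w]⟩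

/-- The bounded continuous representative of the `j`-th weak derivative, for `j < k`. -/
noncomputable def Sobolev.rep {k : ℕ} (j : Fin k) : Sobolev k →L[ℂ] BCF :=
  LinearMap.mkContinuous
    { toFun := fun w => (exists_rep j w).choose
      map_add' := fun v w => by
        apply bcf_eq_of_ae_eq
        filter_upwards [(exists_rep j v).choose_spec.1, (exists_rep j w).choose_spec.1,
          (exists_rep j (v + w)).choose_spec.1,
          Lp.coeFn_add (der j.castSucc v) (der j.castSucc w)] with x h1 h2 h3 h4
        rw [← h3, map_add, h4]
        simp [h1, h2]
      map_smul' := fun c w => by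
        apply bcf_eq_of_ae_eq
        filter_upwards [(exists_rep j w).choose_spec.1,
          (exists_rep j (c • w)).choose_spec.1,
          Lp.coeFn_smul c (der j.castSucc w)] with x h1 h3 h4
        rw [← h3, map_smul, h4]
        simp [h1] }
    2 fun w => (BoundedContinuousFunction.norm_le (by positivity)).mpr
      (exists_rep j w).choose_spec.2

theorem Sobolev.coeFn_rep {k : ℕ} (j : Fin k) (w : Sobolev k) :
    (der j.castSucc w : L2) =ᵐ[volume] rep j w := (exists_rep j w).choose_spec.1

end Embedding

end DNLS

namespace DNLS

open BoundedContinuousFunction FourierTransform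

/-! ### Fourier multipliers, the resolvent and the smoothing operator. -/

section FourierMultiplier

/-- The Fourier transform on `L²(ℝ)`. -/
noncomputable abbrev fourierL2 : L2 ≃ₗᵢ[ℂ] L2 := Lp.fourierTransformₗᵢ ℝ ℂ

/-- The frequency variable dual to `-i ∂`. -/
noncomputable def freq (ξ : ℝ) : ℝ := 2 * Real.pi * ξ

@[fun_prop]
theorem continuous_freq : Continuous freq := by unfold freq; fun_prop

theorem inner_toLp_eq (Ψ : SchwartzMap ℝ ℂ) (f : L2) :
    inner ℂ (Ψ.toLp 2 volume) f = ∫ x, conj (Ψ x) * f x := by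
  rw [L2.inner_def]
  refine integral_congr_ae ?_
  filter_upwards [Ψ.coeFn_toLp 2 volume] with x hx
  rw [hx, RCLike.inner_apply, mul_comm]

/-- Parseval's identity against a Schwartz function. -/
theorem integral_conj_schwartz_mul (Ψ : SchwartzMap ℝ ℂ) (f : L2) :
    ∫ x, conj (Ψ x) * f x = ∫ ξ, conj ((𝓕 Ψ) ξ) * (fourierL2 f : L2) ξ := by
  have h1 : inner ℂ (fourierL2 (Ψ.toLp 2 volume)) (fourierL2 f) =
      inner ℂ (Ψ.toLp 2 volume) f := fourierL2.inner_map_map _ _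
  have h2 : fourierL2 (Ψ.toLp 2 volume) = (𝓕 Ψ).toLp 2 volume := SchwartzMap.toLp_fourier_eq Ψ
  rw [← inner_toLp_eq, ← inner_toLp_eq, ← h1, h2]

/-- Test functions are Schwartz functions, so Parseval's identity turns the derivative on the test
function into multiplication by the frequency. -/
theorem hasWeakDeriv_of_fourier {f g : L2}
    (h : ∀ᵐ ξ, (fourierL2 g : L2) ξ = Complex.I * freq ξ * (fourierL2 f : L2) ξ) :
    HasWeakDeriv f g := by
  refine ⟨(Lp.memLp f).locallyIntegrable one_le_two, (Lp.memLp g).locallyIntegrable one_le_two,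
    fun ψ h1 h2 => ?_⟩
  have c1 : ContDiff ℝ ∞ fun x => (ψ x : ℂ) := Complex.ofRealCLM.contDiff.comp h1
  have c2 : HasCompactSupport fun x => (ψ x : ℂ) := h2.comp_left Complex.ofReal_zero
  let Ψ : SchwartzMap ℝ ℂ := c2.toSchwartzMap c1
  let Ψ' : SchwartzMap ℝ ℂ := SchwartzMap.derivCLM ℂ ℂ Ψ
  have hΨ : ∀ x, Ψ x = ψ x := fun x => rfl
  have hd : ∀ x, Ψ' x = ((deriv ψ x : ℝ) : ℂ) := fun x => by
    rw [SchwartzMap.derivCLM_apply]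
    exact (((h1.differentiable (by simp)) x).hasDerivAt.ofReal_comp).deriv
  have hF : ∀ ξ, (𝓕 Ψ') ξ = Complex.I * freq ξ * (𝓕 Ψ) ξ := fun ξ => by
    have e : (Ψ' : ℝ → ℂ) = deriv Ψ := funext fun x => SchwartzMap.derivCLM_apply ..
    rw [SchwartzMap.fourier_coe, SchwartzMap.fourier_coe, e,
      Real.fourier_deriv Ψ.integrable Ψ.differentiable (e ▸ Ψ'.integrable)]
    simp only [freq, smul_eq_mul]
    push_cast; ring
  have e1 : ∫ x, deriv ψ x • f x = ∫ x, conj (Ψ' x) * f x := by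
    simp only [hd, Complex.conj_ofReal, Complex.real_smul]
  have e2 : ∫ x, ψ x • g x = ∫ x, conj (Ψ x) * g x := by
    simp only [hΨ, Complex.conj_ofReal, Complex.real_smul]
  rw [e1, e2, integral_conj_schwartz_mul Ψ' f, integral_conj_schwartz_mul Ψ g, ← integral_neg]
  refine integral_congr_ae ?_
  filter_upwards [h] with ξ k1
  rw [k1, hF]
  simp only [map_mul, Complex.conj_I, Complex.conj_ofReal]
  ring

/-- The Fourier multiplier with symbol `m`. -/
noncomputable def mult (m : BCF) : L2 →L[ℂ] L2 :=
  (fourierL2.symm.toContinuousLinearEquiv.toContinuousLinearMap.comp (bmul m)).comp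
    fourierL2.toContinuousLinearEquiv.toContinuousLinearMap

theorem fourier_mult (m : BCF) (f : L2) : fourierL2 (mult m f) = bmul m (fourierL2 f) :=
  fourierL2.apply_symm_apply _

theorem coeFn_fourier_mult (m : BCF) (f : L2) :
    (fourierL2 (mult m f) : L2) =ᵐ[volume] fun ξ => m ξ * (fourierL2 f : L2) ξ := by
  rw [fourier_mult]; exact coeFn_bmul _ _

theorem norm_mult_le (m : BCF) (f : L2) : ‖mult m f‖ ≤ ‖m‖ * ‖f‖ := by
  rw [← fourierL2.norm_map (mult m f), fourier_mult, ← fourierL2.norm_map f]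
  exact norm_bmul_le _ _

theorem mult_mult (m m' : BCF) (f : L2) : mult m (mult m' f) = mult (m * m') f := by
  apply fourierL2.injective
  rw [fourier_mult, fourier_mult, fourier_mult, bmul_mul]

theorem mult_one (f : L2) : mult 1 f = f := by
  apply fourierL2.injective
  rw [fourier_mult, bmul_one]

/-- This is `2ν|ξ| ≤ ν² + ξ²`. The decay in `ν` is the source of all smallness in the normal form.
-/
theorem abs_freq_div_le (ν ξ : ℝ) (hν : 0 < ν) :
    |freq ξ| / (1 + ν ^ 2 + freq ξ ^ 2) ≤ 1 / (2 * ν) := by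
  rw [div_le_div_iff₀ (by positivity) (by positivity)]
  nlinarith [sq_nonneg (ν - |freq ξ|), sq_abs (freq ξ)]

theorem norm_resolvent_symbol_le (ν ξ : ℝ) :
    ‖(((1 + ν ^ 2 + freq ξ ^ 2)⁻¹ : ℝ) : ℂ)‖ ≤ 1 := by
  rw [Complex.norm_real, Real.norm_of_nonneg (by positivity)]
  exact inv_le_one_of_one_le₀ (by nlinarith [sq_nonneg ν, sq_nonneg (freq ξ)])

theorem norm_smoothing_symbol_le {ν : ℝ} (hν : 0 < ν) (ξ : ℝ) :
    ‖-(Complex.I * ((freq ξ / (1 + ν ^ 2 + freq ξ ^ 2) : ℝ) : ℂ))‖ ≤ 1 / (2 * ν) := by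
  rw [norm_neg, norm_mul, Complex.norm_I, one_mul, Complex.norm_real, Real.norm_eq_abs, abs_div,
    abs_of_pos (show 0 < 1 + ν ^ 2 + freq ξ ^ 2 by positivity)]
  exact abs_freq_div_le ν ξ hν

/-- The symbol of the resolvent `(1 + ν² - ∂²)⁻¹`. -/
noncomputable def resolventSymbol (ν : ℝ) : BCF :=
  BoundedContinuousFunction.ofNormedAddCommGroup
    (fun ξ => (((1 + ν ^ 2 + freq ξ ^ 2)⁻¹ : ℝ) : ℂ))
    (Complex.continuous_ofReal.comp
      (Continuous.inv₀ (by fun_prop) fun ξ => ne_of_gt (by positivity))) 1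
    (norm_resolvent_symbol_le ν)

/-- The symbol of `-∂ (1 + ν² - ∂²)⁻¹`. -/
noncomputable def smoothingSymbol {ν : ℝ} (hν : 0 < ν) : BCF :=
  BoundedContinuousFunction.ofNormedAddCommGroup
    (fun ξ => -(Complex.I * ((freq ξ / (1 + ν ^ 2 + freq ξ ^ 2) : ℝ) : ℂ)))
    (Continuous.neg (continuous_const.mul (Complex.continuous_ofReal.comp
      (Continuous.div (by fun_prop) (by fun_prop) fun ξ => ne_of_gt (by positivity)))))
    (1 / (2 * ν)) (norm_smoothing_symbol_le hν)

/-- The resolvent `(1 + ν² - ∂²)⁻¹` on `L²`. -/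
noncomputable def resolvent (ν : ℝ) : L2 →L[ℂ] L2 := mult (resolventSymbol ν)

/-- The operator `-∂ (1 + ν² - ∂²)⁻¹` on `L²`. -/
noncomputable def smoothing {ν : ℝ} (hν : 0 < ν) : L2 →L[ℂ] L2 := mult (smoothingSymbol hν)

theorem norm_smoothing_le {ν : ℝ} (hν : 0 < ν) (f : L2) :
    ‖smoothing hν f‖ ≤ 1 / (2 * ν) * ‖f‖ :=
  (norm_mult_le _ f).trans (by
    gcongr
    exact norm_ofNormedAddCommGroup_le _ (by positivity) _)

theorem hasWeakDeriv_resolvent {ν : ℝ} (hν : 0 < ν) (f : L2) :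
    HasWeakDeriv (resolvent ν f) (-smoothing hν f : L2) := by
  apply hasWeakDeriv_of_fourier
  rw [map_neg]
  filter_upwards [coeFn_fourier_mult (resolventSymbol ν) f,
    coeFn_fourier_mult (smoothingSymbol hν) f,
    Lp.coeFn_neg (fourierL2 (smoothing hν f))] with ξ h1 h2 h3
  rw [h3, Pi.neg_apply, smoothing, h2, resolvent, h1]
  simp only [smoothingSymbol, resolventSymbol, coe_ofNormedAddCommGroup]
  push_cast
  ring

/-- The symbol identity is `ξ²/(κ + ξ²) = 1 - κ/(κ + ξ²)` with `κ = 1 + ν²`. -/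
theorem hasWeakDeriv_smoothing {ν : ℝ} (hν : 0 < ν) (f : L2) :
    HasWeakDeriv (smoothing hν f) (f - ((1 + ν ^ 2 : ℝ) : ℂ) • resolvent ν f : L2) := by
  apply hasWeakDeriv_of_fourier
  rw [map_sub, map_smul]
  filter_upwards [coeFn_fourier_mult (resolventSymbol ν) f,
    coeFn_fourier_mult (smoothingSymbol hν) f,
    Lp.coeFn_sub (fourierL2 f) (((1 + ν ^ 2 : ℝ) : ℂ) • fourierL2 (resolvent ν f)),
    Lp.coeFn_smul ((1 + ν ^ 2 : ℝ) : ℂ) (fourierL2 (resolvent ν f))] with ξ h1 h2 h3 h4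
  rw [h3, Pi.sub_apply, h4, Pi.smul_apply, smoothing, h2, resolvent, h1]
  simp only [smoothingSymbol, resolventSymbol, coe_ofNormedAddCommGroup, smul_eq_mul]
  have hne : (1 + (ν : ℂ) ^ 2 + (freq ξ : ℂ) ^ 2) ≠ 0 := by
    have : (1 + ν ^ 2 + freq ξ ^ 2 : ℝ) ≠ 0 := by positivity
    exact_mod_cast this
  push_cast
  field_simp
  linear_combination ((fourierL2 f : L2) ξ * freq ξ ^ 2) * Complex.I_sq

/-- Energy argument: the integral of `(ȳ y')' = |y'|² + κ|y|²` over the line is zero. -/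
theorem eq_zero_of_hasWeakDeriv_twice {κ : ℝ} (hκ : 0 < κ) {y y₁ : L2} (h : HasWeakDeriv y y₁)
    (h₁ : HasWeakDeriv y₁ ((κ : ℂ) • y : L2)) : y = 0 := by
  have hw := h.star.mul h₁
  have hi (u v : L2) : Integrable ((fun x => conj (u x)) * (v : ℝ → ℂ)) :=
    (L2.integrable_inner (𝕜 := ℂ) u v).congr (Eventually.of_forall fun x => by
      simp only [RCLike.inner_apply, Pi.mul_apply]; ring)
  have he (u v : L2) : ∫ x, ((fun x => conj (u x)) * (v : ℝ → ℂ)) x = inner ℂ u v := by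
    rw [L2.inner_def]
    exact integral_congr_ae (Eventually.of_forall fun x => by
      simp only [RCLike.inner_apply, Pi.mul_apply]; ring)
  have hs (u : L2) : (inner ℂ u u : ℂ).re = ‖u‖ ^ 2 := inner_self_eq_norm_sq (𝕜 := ℂ) u
  have hz := hw.integral_eq_zero (hi _ _) ((hi _ _).add (hi _ _))
  simp only [Pi.add_apply] at hz
  rw [integral_add (hi _ _) (hi _ _), he, he, inner_smul_right] at hz
  have hr := congrArg Complex.re hz
  rw [Complex.add_re, Complex.re_ofReal_mul, hs, hs, Complex.zero_re] at hr
  have h0 : κ * ‖y‖ ^ 2 = 0 := by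
    nlinarith [sq_nonneg ‖y₁‖, mul_nonneg hκ.le (sq_nonneg ‖y‖)]
  simpa [hκ.ne'] using h0

/-- Formally `R∂f - ∂Rf = 0`. The left side `y` is in `L²` and satisfies `y'' = κ y` weakly, so it
vanishes; this avoids density of test functions in `H¹`. -/
theorem resolvent_add_smoothing {ν : ℝ} (hν : 0 < ν) {f g : L2} (h : HasWeakDeriv f g) :
    resolvent ν g + smoothing hν f = 0 := by
  obtain ⟨c, hc⟩ : ∃ c : ℂ, ((1 + ν ^ 2 : ℝ) : ℂ) = c := ⟨_, rfl⟩
  have w1 := hasWeakDeriv_resolvent hν g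
  have w2 := hasWeakDeriv_smoothing hν f
  have w3 := (hasWeakDeriv_smoothing hν g).const_smul (-1)
  have w4 := (hasWeakDeriv_resolvent hν f).const_smul (-c)
  rw [hc] at w2 w3
  refine eq_zero_of_hasWeakDeriv_twice (κ := 1 + ν ^ 2) (by positivity)
    (y₁ := -smoothing hν g + (f - c • resolvent ν f)) ?_ ?_
  · exact (w1.add w2).congr (Lp.coeFn_add _ _).symm (Lp.coeFn_add _ _).symm
  · rw [hc]
    refine ((w3.add h).add w4).congr ?_ ?_
    · filter_upwards [Lp.coeFn_add (-smoothing hν g) (f - c • resolvent ν f),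
        Lp.coeFn_neg (smoothing hν g), Lp.coeFn_sub f (c • resolvent ν f),
        Lp.coeFn_smul c (resolvent ν f)] with x k1 k2 k3 k4
      simp only [Pi.add_apply, Pi.smul_apply, Pi.neg_apply, Pi.sub_apply, k1, k2, k3, k4,
        smul_eq_mul]
      ring
    · filter_upwards [Lp.coeFn_sub g (c • resolvent ν g), Lp.coeFn_smul c (resolvent ν g),
        Lp.coeFn_neg (smoothing hν f), Lp.coeFn_smul c (resolvent ν g + smoothing hν f),
        Lp.coeFn_add (resolvent ν g) (smoothing hν f)] with x k1 k2 k3 k4 k5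
      simp only [Pi.add_apply, Pi.smul_apply, Pi.neg_apply, Pi.sub_apply, k1, k2, k3, k4, k5,
        smul_eq_mul]
      ring

theorem fourier_of_resolvent_add_smoothing {f g : L2}
    (h : resolvent 1 g + smoothing one_pos f = 0) :
    ∀ᵐ ξ, (fourierL2 g : L2) ξ = Complex.I * freq ξ * (fourierL2 f : L2) ξ := by
  have e := congrArg fourierL2 h
  rw [map_add, map_zero] at e
  filter_upwards [coeFn_fourier_mult (resolventSymbol 1) g,
    coeFn_fourier_mult (smoothingSymbol one_pos) f,
    Lp.coeFn_add (fourierL2 (resolvent 1 g)) (fourierL2 (smoothing one_pos f)),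
    Lp.coeFn_zero ℂ 2 (volume : Measure ℝ)] with ξ h1 h2 h3 h4
  rw [e, h4, Pi.add_apply, resolvent, h1, smoothing, h2] at h3
  simp only [smoothingSymbol, resolventSymbol, coe_ofNormedAddCommGroup, Pi.zero_apply] at h3
  have hne : (1 + (1 : ℂ) ^ 2 + (freq ξ : ℂ) ^ 2) ≠ 0 := by
    have : (1 + (1 : ℝ) ^ 2 + freq ξ ^ 2 : ℝ) ≠ 0 := by positivity
    exact_mod_cast this
  push_cast at h3
  generalize (1 + (1 : ℂ) ^ 2 + (freq ξ : ℂ) ^ 2) = D at h3 hne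
  field_simp at h3
  linear_combination -h3

/-- Converse of `hasWeakDeriv_of_fourier`: the symbols of `resolvent 1` and `smoothing one_pos` have
a common nonzero denominator, which cancels. -/
theorem fourier_of_hasWeakDeriv {f g : L2} (h : HasWeakDeriv f g) :
    ∀ᵐ ξ, (fourierL2 g : L2) ξ = Complex.I * freq ξ * (fourierL2 f : L2) ξ :=
  fourier_of_resolvent_add_smoothing (resolvent_add_smoothing one_pos h)

theorem HasWeakDeriv.mult {f g : L2} (h : HasWeakDeriv f g) (m : BCF) :
    HasWeakDeriv (DNLS.mult m f) (DNLS.mult m g) := by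
  apply hasWeakDeriv_of_fourier
  filter_upwards [coeFn_fourier_mult m f, coeFn_fourier_mult m g, fourier_of_hasWeakDeriv h]
    with ξ h1 h2 h3
  rw [h1, h2, h3]; ring

/-- The identity `T∂ = 1 - κR`, which recovers the derivative term of the equation from its own
derivative. -/
theorem smoothing_of_hasWeakDeriv {ν : ℝ} (hν : 0 < ν) {f g : L2} (h : HasWeakDeriv f g) :
    smoothing hν g = f - ((1 + ν ^ 2 : ℝ) : ℂ) • resolvent ν f :=
  Lp.ext ((h.mult (smoothingSymbol hν)).unique (hasWeakDeriv_smoothing hν f))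

end FourierMultiplier

/-! ### The Schrödinger group on `L²`. -/

section SchrodingerGroup

theorem norm_schrodinger_symbol_le (t ξ : ℝ) :
    ‖Complex.exp (((-(t * freq ξ ^ 2) : ℝ) : ℂ) * Complex.I)‖ ≤ 1 :=
  (Complex.norm_exp_ofReal_mul_I _).le

/-- The symbol of `exp(i t ∂²)`. -/
noncomputable def schrodingerSymbol (t : ℝ) : BCF :=
  BoundedContinuousFunction.ofNormedAddCommGroup
    (fun ξ => Complex.exp (((-(t * freq ξ ^ 2) : ℝ) : ℂ) * Complex.I))
    (by fun_prop) 1 (norm_schrodinger_symbol_le t)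

/-- The Schrödinger group `exp(i t ∂²)` on `L²`. -/
noncomputable def schrodinger (t : ℝ) : L2 →L[ℂ] L2 := mult (schrodingerSymbol t)

theorem norm_schrodinger_le (t : ℝ) (f : L2) : ‖schrodinger t f‖ ≤ ‖f‖ := by
  refine (norm_mult_le _ f).trans ?_
  have : ‖schrodingerSymbol t‖ ≤ 1 := norm_ofNormedAddCommGroup_le _ zero_le_one _
  nlinarith [norm_nonneg f]

theorem schrodinger_add (s t : ℝ) (f : L2) :
    schrodinger (s + t) f = schrodinger s (schrodinger t f) := by
  rw [schrodinger, schrodinger, schrodinger, mult_mult]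
  congr 2
  ext ξ
  simp only [schrodingerSymbol, coe_ofNormedAddCommGroup, BoundedContinuousFunction.coe_mul,
    Pi.mul_apply, ← Complex.exp_add]
  congr 1
  push_cast; ring

theorem schrodinger_zero (f : L2) : schrodinger 0 f = f := by
  have : schrodingerSymbol 0 = 1 := by
    ext ξ; simp [schrodingerSymbol]
  rw [schrodinger, this, mult_one]

theorem tendsto_zero_of_dominated {ι : Type*} {l : Filter ι} [l.IsCountablyGenerated]
    {F : ι → L2} {f : ι → ℝ → ℂ} (hF : ∀ i, (F i : ℝ → ℂ) =ᵐ[volume] f i) {G : L2} {C : ℝ}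
    (hG : ∀ᶠ i in l, ∀ᵐ x, ‖f i x‖ ≤ C * ‖G x‖) (hf : ∀ᵐ x, Tendsto (fun i => f i x) l (𝓝 0)) :
    Tendsto F l (𝓝 0) := by
  rw [tendsto_zero_iff_norm_tendsto_zero]
  have hsq : ∀ i, ‖F i‖ ^ 2 = ∫ x, ‖f i x‖ ^ 2 := fun i => by
    have h := inner_self_eq_norm_sq_to_K (𝕜 := ℂ) (F i)
    rw [L2.inner_def] at h
    have h2 : ((∫ x, ‖f i x‖ ^ 2 : ℝ) : ℂ) = ((‖F i‖ ^ 2 : ℝ) : ℂ) := by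
      rw [← integral_complex_ofReal]
      push_cast
      refine Eq.trans ?_ h
      refine integral_congr_ae ?_
      filter_upwards [hF i] with x hx
      rw [hx, inner_self_eq_norm_sq_to_K]
      simp
    exact_mod_cast h2.symm
  have hlim : Tendsto (fun i => ∫ x, ‖f i x‖ ^ 2) l (𝓝 (∫ _ : ℝ, (0 : ℝ))) := by
    refine tendsto_integral_filter_of_dominated_convergence (fun x => (C * ‖G x‖) ^ 2) ?_ ?_ ?_ ?_
    · exact Eventually.of_forall fun i =>
        (((Lp.aestronglyMeasurable (F i)).congr (hF i)).norm.pow 2)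
    · filter_upwards [hG] with i hi
      filter_upwards [hi] with x hx
      rw [Real.norm_of_nonneg (by positivity)]
      gcongr
    · simp only [mul_pow]
      exact ((Lp.memLp G).norm.integrable_sq).const_mul _
    · filter_upwards [hf] with x hx
      simpa using hx.norm.pow 2
  have h3 : Tendsto (fun i => ‖F i‖ ^ 2) l (𝓝 0) := by
    simpa [hsq] using hlim
  have := (Real.continuous_sqrt.tendsto _).comp h3
  simpa [Function.comp_def, Real.sqrt_sq] using this

theorem continuous_schrodingerSymbol (ξ : ℝ) : Continuous fun t => schrodingerSymbol t ξ := by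
  simp only [schrodingerSymbol, coe_ofNormedAddCommGroup]
  fun_prop

theorem continuous_schrodinger (f : L2) : Continuous fun t => schrodinger t f := by
  rw [continuous_iff_continuousAt]
  intro t
  rw [ContinuousAt, tendsto_iff_norm_sub_tendsto_zero]
  have : Tendsto (fun s => fourierL2 (schrodinger s f - schrodinger t f)) (𝓝 t) (𝓝 0) := by
    refine tendsto_zero_of_dominated (G := fourierL2 f) (C := 2)
      (f := fun s ξ => (schrodingerSymbol s ξ - schrodingerSymbol t ξ) * (fourierL2 f : L2) ξ)
      (fun s => ?_) (Eventually.of_forall fun s => Eventually.of_forall fun ξ => ?_)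
      (Eventually.of_forall fun ξ => ?_)
    · rw [map_sub]
      filter_upwards [Lp.coeFn_sub (fourierL2 (schrodinger s f)) (fourierL2 (schrodinger t f)),
        coeFn_fourier_mult (schrodingerSymbol s) f, coeFn_fourier_mult (schrodingerSymbol t) f]
        with ξ h1 h2 h3
      rw [h1, Pi.sub_apply, schrodinger, h2, schrodinger, h3, sub_mul]
    · rw [norm_mul]
      gcongr
      refine (norm_sub_le _ _).trans ?_
      have h1 := norm_schrodinger_symbol_le s ξ
      have h2 := norm_schrodinger_symbol_le t ξ
      simp only [schrodingerSymbol, coe_ofNormedAddCommGroup]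
      linarith
    · have hc := (((continuous_schrodingerSymbol ξ).sub (continuous_const (y := schrodingerSymbol t ξ))).mul
        (continuous_const (y := (fourierL2 f : L2) ξ))).tendsto t
      simpa only [Pi.mul_def, Pi.sub_def, sub_self, zero_mul] using hc
  simpa only [fourierL2.norm_map, norm_zero] using this.norm

/-- On the Fourier side the error of the difference quotient at time `0` is dominated by `2ξ²|f̂|`,
which is in `L²` as `f` has two derivatives there. The group law moves the result to time `t`. -/
theorem hasDerivAt_schrodinger {f f₁ f₂ : L2} (h : HasWeakDeriv f f₁) (h₁ : HasWeakDeriv f₁ f₂)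
    (t : ℝ) : HasDerivAt (fun t => schrodinger t f) (schrodinger t (Complex.I • f₂)) t := by
  have hF : ∀ᵐ ξ, (fourierL2 f₂ : L2) ξ = -(freq ξ : ℂ) ^ 2 * (fourierL2 f : L2) ξ := by
    filter_upwards [fourier_of_hasWeakDeriv h, fourier_of_hasWeakDeriv h₁] with ξ k1 k2
    rw [k2, k1]
    linear_combination ((freq ξ : ℂ) ^ 2 * (fourierL2 f : L2) ξ) * Complex.I_sq
  have h0 : HasDerivAt (fun t => schrodinger t f) (Complex.I • f₂) 0 := by
    rw [hasDerivAt_iff_tendsto_slope, tendsto_iff_norm_sub_tendsto_zero]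
    have : Tendsto (fun s => fourierL2 (slope (fun t => schrodinger t f) 0 s - Complex.I • f₂))
        (𝓝[≠] 0) (𝓝 0) := by
      refine tendsto_zero_of_dominated (G := fourierL2 f₂) (C := 2)
        (f := fun s ξ => ((s : ℂ)⁻¹ * (schrodingerSymbol s ξ - 1) + Complex.I * freq ξ ^ 2) *
          (fourierL2 f : L2) ξ) (fun s => ?_) ?_ ?_
      · have hsl : slope (fun t => schrodinger t f) 0 s =
            ((s⁻¹ : ℝ) : ℂ) • (schrodinger s f - f) := by
          simp only [slope, sub_zero, vsub_eq_sub, schrodinger_zero]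
          exact RCLike.real_smul_eq_coe_smul (K := ℂ) _ _
        rw [hsl, map_sub, map_smul, map_smul, map_sub]
        filter_upwards [Lp.coeFn_sub (((s⁻¹ : ℝ) : ℂ) • (fourierL2 (schrodinger s f) -
            fourierL2 f)) (Complex.I • fourierL2 f₂),
          Lp.coeFn_smul ((s⁻¹ : ℝ) : ℂ) (fourierL2 (schrodinger s f) - fourierL2 f),
          Lp.coeFn_smul Complex.I (fourierL2 f₂),
          Lp.coeFn_sub (fourierL2 (schrodinger s f)) (fourierL2 f),
          coeFn_fourier_mult (schrodingerSymbol s) f, hF] with ξ k1 k2 k3 k4 k5 k6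
        rw [k1, Pi.sub_apply, k2, k3, Pi.smul_apply, Pi.smul_apply, k4, Pi.sub_apply, schrodinger,
          k5, k6]
        simp only [smul_eq_mul]
        push_cast
        ring
      · filter_upwards [self_mem_nhdsWithin] with s hs
        filter_upwards [hF] with ξ hξ
        have hs' : s ≠ 0 := hs
        have b1 : ‖schrodingerSymbol s ξ - 1‖ ≤ |s| * freq ξ ^ 2 := by
          simp only [schrodingerSymbol, coe_ofNormedAddCommGroup]
          rw [mul_comm]
          refine (Real.norm_exp_I_mul_ofReal_sub_one_le).trans ?_
          rw [norm_neg, norm_mul, Real.norm_eq_abs, Real.norm_of_nonneg (sq_nonneg _)]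
        have b2 : ‖(s : ℂ)⁻¹ * (schrodingerSymbol s ξ - 1)‖ ≤ freq ξ ^ 2 := by
          rw [norm_mul, norm_inv, Complex.norm_real, Real.norm_eq_abs,
            inv_mul_le_iff₀ (abs_pos.mpr hs')]
          exact b1
        have b3 : ‖Complex.I * (freq ξ : ℂ) ^ 2‖ = freq ξ ^ 2 := by
          rw [norm_mul, Complex.norm_I, one_mul, norm_pow, Complex.norm_real, Real.norm_eq_abs,
            sq_abs]
        rw [hξ, norm_mul, norm_mul, norm_neg, norm_pow, Complex.norm_real, Real.norm_eq_abs, sq_abs,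
          ← mul_assoc]
        gcongr
        exact (norm_add_le _ _).trans (by linarith)
      · refine Eventually.of_forall fun ξ => ?_
        have hd : HasDerivAt (fun s : ℝ => schrodingerSymbol s ξ) (-(Complex.I * freq ξ ^ 2)) 0 := by
          simp only [schrodingerSymbol, coe_ofNormedAddCommGroup]
          have e : HasDerivAt (fun s : ℝ => ((-(s * freq ξ ^ 2) : ℝ) : ℂ) * Complex.I)
              (((-(1 * freq ξ ^ 2) : ℝ) : ℂ) * Complex.I) 0 :=
            ((((hasDerivAt_id (0 : ℝ)).mul_const (freq ξ ^ 2)).neg).ofReal_comp).mul_const _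
          convert e.cexp using 1
          simp; ring
        have hs := hasDerivAt_iff_tendsto_slope.mp hd
        have := (hs.add_const (Complex.I * (freq ξ : ℂ) ^ 2)).mul_const ((fourierL2 f : L2) ξ)
        rw [neg_add_cancel, zero_mul] at this
        refine this.congr fun s => ?_
        simp [slope, schrodingerSymbol]
    simpa only [fourierL2.norm_map, norm_zero] using this.norm
  have e : (fun s => schrodinger s f) = fun s => schrodinger t (schrodinger (s - t) f) := by
    funext s
    rw [← schrodinger_add, add_sub_cancel]
  rw [e]
  have h1 : HasDerivAt (fun s => schrodinger (s - t) f) (Complex.I • f₂) t := by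
    have h0' : HasDerivAt (fun t => schrodinger t f) (Complex.I • f₂) (t - t) := by rwa [sub_self]
    exact h0'.comp_sub_const t t
  exact ((schrodinger t).restrictScalars ℝ).hasFDerivAt.comp_hasDerivAt t h1

end SchrodingerGroup

end DNLS

namespace DNLS

open BoundedContinuousFunction

/-! ### Completeness of the Sobolev spaces and multipliers on them. -/

section SobolevOperators

/-- Weak differentiability becomes an equation between bounded operators, so it is a closed
condition; completeness of `Sobolev k` follows. -/
theorem hasWeakDeriv_iff {f g : L2} :
    HasWeakDeriv f g ↔ resolvent 1 g + smoothing one_pos f = 0 :=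
  ⟨resolvent_add_smoothing one_pos,
    fun h => hasWeakDeriv_of_fourier (fourier_of_resolvent_add_smoothing h)⟩

namespace Sobolev

theorem isClosed (k : ℕ) : IsClosed (Sobolev k : Set (PiLp 2 fun _ : Fin (k + 1) => L2)) := by
  have : (Sobolev k : Set (PiLp 2 fun _ : Fin (k + 1) => L2)) =
      ⋂ j : Fin k, {F | resolvent 1 (F j.succ) + smoothing one_pos (F j.castSucc) = 0} := by
    ext F
    simp only [mem_iInter, mem_ofPred_eq, ← hasWeakDeriv_iff]
    rfl
  rw [this]
  refine isClosed_iInter fun j => isClosed_eq ?_ continuous_const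
  have hc (i : Fin (k + 1)) : Continuous fun F : PiLp 2 fun _ : Fin (k + 1) => L2 => F i :=
    PiLp.continuous_apply 2 _ i
  exact ((resolvent 1).continuous.comp (hc _)).add ((smoothing one_pos).continuous.comp (hc _))

instance (k : ℕ) : CompleteSpace (Sobolev k) := (isClosed k).completeSpace_coe

theorem norm_sq_eq {k : ℕ} (w : Sobolev k) : ‖w‖ ^ 2 = ∑ j, ‖der j w‖ ^ 2 := by
  rw [Submodule.coe_norm, PiLp.norm_sq_eq_of_L2]
  rfl

theorem norm_le_sum {k : ℕ} (w : Sobolev k) : ‖w‖ ≤ ∑ j, ‖der j w‖ := by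
  refine abs_le_of_sq_le_sq' ?_ (Finset.sum_nonneg fun _ _ => norm_nonneg _) |>.2
  rw [norm_sq_eq]
  exact Finset.sum_sq_le_sq_sum_of_nonneg fun _ _ => norm_nonneg _

theorem ext_der {k : ℕ} {v w : Sobolev k} (h : der 0 v = der 0 w) : v = w := toL2_injective h

/-- A Fourier multiplier acting on a Sobolev space. -/
noncomputable def mult {k : ℕ} (m : BCF) : Sobolev k →L[ℂ] Sobolev k :=
  LinearMap.mkContinuous
    { toFun := fun w => ⟨WithLp.toLp 2 fun j => DNLS.mult m (der j w), fun j =>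
        (hasWeakDeriv w j).mult m⟩
      map_add' := fun v w => by
        apply Subtype.ext; ext1 j
        exact (congrArg _ (map_add (der j) v w)).trans (map_add _ _ _)
      map_smul' := fun c w => by
        apply Subtype.ext; ext1 j
        exact (congrArg _ (map_smul (der j) c w)).trans (map_smul _ _ _) }
    ‖m‖ fun w => by
      refine abs_le_of_sq_le_sq' ?_ (by positivity) |>.2
      rw [norm_sq_eq, mul_pow, norm_sq_eq, Finset.mul_sum]
      refine Finset.sum_le_sum fun j _ => ?_
      rw [← mul_pow]
      exact pow_le_pow_left₀ (norm_nonneg _) (norm_mult_le m _) 2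

theorem norm_mult_le {k : ℕ} (m : BCF) (w : Sobolev k) : ‖mult m w‖ ≤ ‖m‖ * ‖w‖ :=
  LinearMap.mkContinuous_norm_le _ (norm_nonneg _) _ |> fun h =>
    ((mult m).le_opNorm w).trans (mul_le_mul_of_nonneg_right h (norm_nonneg _))

/-- The element of `H²` with the given function and derivatives. -/
noncomputable def mk₂ (f₀ f₁ f₂ : L2) (h₀ : HasWeakDeriv f₀ f₁) (h₁ : HasWeakDeriv f₁ f₂) :
    Sobolev 2 :=
  ⟨WithLp.toLp 2 ![f₀, f₁, f₂], fun j => by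
    fin_cases j
    · exact h₀
    · exact h₁⟩

end Sobolev

end SobolevOperators

/-! ### Calculus of maps that are Lipschitz on bounded sets. -/

section LipschitzOnBounded

variable {E F G H : Type*} [NormedAddCommGroup E] [NormedAddCommGroup F] [NormedAddCommGroup G]
  [NormedAddCommGroup H]

/-- Maps which are Lipschitz continuous on bounded sets. -/
def LipBdd (f : E → F) : Prop :=
  ∀ R : ℝ, ∃ K : ℝ, 0 ≤ K ∧ ∀ x y, ‖x‖ ≤ R → ‖y‖ ≤ R → ‖f x - f y‖ ≤ K * ‖x - y‖

namespace LipBdd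

theorem const (c : F) : LipBdd fun _ : E => c := fun _ => ⟨0, le_rfl, fun _ _ _ _ => by simp⟩

theorem bounded {f : E → F} (hf : LipBdd f) (R : ℝ) :
    ∃ M : ℝ, 0 ≤ M ∧ ∀ x, ‖x‖ ≤ R → ‖f x‖ ≤ M := by
  obtain ⟨K, hK, h⟩ := hf |R|
  refine ⟨K * |R| + ‖f 0‖, by positivity, fun x hx => ?_⟩
  have hx' := hx.trans (le_abs_self R)
  have h1 := h x 0 hx' (by simp)
  rw [sub_zero] at h1
  have h2 := norm_sub_norm_le (f x) (f 0)
  nlinarith [mul_le_mul_of_nonneg_left hx' hK]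

theorem continuous {f : E → F} (hf : LipBdd f) : Continuous f := by
  rw [continuous_iff_continuousAt]
  intro x
  obtain ⟨K, hK, h⟩ := hf (‖x‖ + 1)
  have hl : LipschitzOnWith ⟨K, hK⟩ f (Metric.closedBall 0 (‖x‖ + 1)) :=
    LipschitzOnWith.of_dist_le_mul fun a ha b hb => by
      rw [dist_eq_norm, dist_eq_norm]
      exact h a b (by simpa using ha) (by simpa using hb)
  refine hl.continuousOn.continuousAt
    (mem_of_superset (Metric.ball_mem_nhds x one_pos) fun y hy => ?_)
  rw [Metric.mem_ball, dist_eq_norm] at hy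
  rw [Metric.mem_closedBall, dist_zero_right]
  linarith [norm_sub_norm_le y x]

theorem add {f g : E → F} (hf : LipBdd f) (hg : LipBdd g) : LipBdd fun x => f x + g x := by
  intro R
  obtain ⟨K, hK, h⟩ := hf R
  obtain ⟨L, hL, h'⟩ := hg R
  refine ⟨K + L, by positivity, fun x y hx hy => ?_⟩
  rw [add_sub_add_comm, add_mul]
  exact (norm_add_le _ _).trans (add_le_add (h x y hx hy) (h' x y hx hy))

theorem neg {f : E → F} (hf : LipBdd f) : LipBdd fun x => -f x := by
  intro R
  obtain ⟨K, hK, h⟩ := hf R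
  refine ⟨K, hK, fun x y hx hy => ?_⟩
  rw [neg_sub_neg, norm_sub_rev]
  exact h x y hx hy

theorem sub {f g : E → F} (hf : LipBdd f) (hg : LipBdd g) : LipBdd fun x => f x - g x := by
  simpa only [sub_eq_add_neg] using hf.add hg.neg

/-- The general product estimate, for a map `B` required only to respect differences in each
argument. It covers products of bounded functions and their action on `L²`. -/
theorem bilin {f : E → F} {g : E → G} (hf : LipBdd f) (hg : LipBdd g) (B : F → G → H)
    (hl : ∀ a b c, B (a - b) c = B a c - B b c) (hr : ∀ a b c, B a (b - c) = B a b - B a c)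
    (hB : ∀ a b, ‖B a b‖ ≤ ‖a‖ * ‖b‖) : LipBdd fun x => B (f x) (g x) := by
  intro R
  obtain ⟨K, hK, h⟩ := hf R
  obtain ⟨L, hL, h'⟩ := hg R
  obtain ⟨M, hM, b⟩ := hf.bounded R
  obtain ⟨N, hN, b'⟩ := hg.bounded R
  refine ⟨K * N + M * L, by positivity, fun x y hx hy => ?_⟩
  have e : B (f x) (g x) - B (f y) (g y) = B (f x - f y) (g x) + B (f y) (g x - g y) := by
    rw [hl, hr]; abel
  rw [e, add_mul]
  refine (norm_add_le _ _).trans (add_le_add ((hB _ _).trans ?_) ((hB _ _).trans ?_))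
  · calc ‖f x - f y‖ * ‖g x‖ ≤ (K * ‖x - y‖) * N :=
        mul_le_mul (h x y hx hy) (b' x hx) (norm_nonneg _) (by positivity)
      _ = K * N * ‖x - y‖ := by ring
  · calc ‖f y‖ * ‖g x - g y‖ ≤ M * (L * ‖x - y‖) :=
        mul_le_mul (b y hy) (h' x y hx hy) (norm_nonneg _) (by positivity)
      _ = M * L * ‖x - y‖ := by ring

theorem mul {R : Type*} [NormedRing R] {f g : E → R} (hf : LipBdd f) (hg : LipBdd g) :
    LipBdd fun x => f x * g x :=
  hf.bilin hg (fun a b => a * b) sub_mul mul_sub norm_mul_le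

theorem clm {𝕜 : Type*} [NontriviallyNormedField 𝕜] [NormedSpace 𝕜 F] [NormedSpace 𝕜 G]
    {f : E → F} (hf : LipBdd f) (L : F →L[𝕜] G) : LipBdd fun x => L (f x) := by
  intro R
  obtain ⟨K, hK, h⟩ := hf R
  refine ⟨‖L‖ * K, by positivity, fun x y hx hy => ?_⟩
  rw [← map_sub, mul_assoc]
  exact (L.le_opNorm _).trans (mul_le_mul_of_nonneg_left (h x y hx hy) (norm_nonneg _))

theorem id : LipBdd fun x : E => x := fun _ => ⟨1, zero_le_one, fun _ _ _ _ => by simp⟩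

theorem const_smul {𝕜 : Type*} [NormedField 𝕜] [NormedSpace 𝕜 F] {f : E → F} (hf : LipBdd f)
    (c : 𝕜) : LipBdd fun x => c • f x := by
  intro R
  obtain ⟨K, hK, h⟩ := hf R
  refine ⟨‖c‖ * K, by positivity, fun x y hx hy => ?_⟩
  rw [← smul_sub, norm_smul, mul_assoc]
  exact mul_le_mul_of_nonneg_left (h x y hx hy) (norm_nonneg _)

theorem star {f : E → BCF} (hf : LipBdd f) : LipBdd fun x => star (f x) := by
  intro R
  obtain ⟨K, hK, h⟩ := hf R
  refine ⟨K, hK, fun x y hx hy => ?_⟩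
  rw [← star_sub, norm_star]
  exact h x y hx hy

theorem bmul {f : E → BCF} {g : E → L2} (hf : LipBdd f) (hg : LipBdd g) :
    LipBdd fun x => bmul (f x) (g x) :=
  hf.bilin hg (fun a b => DNLS.bmul a b) (fun a b c => by simp [map_sub])
    (fun a b c => map_sub _ _ _) norm_bmul_le

theorem sobolev {k : ℕ} {f : E → Sobolev k} (hf : ∀ j, LipBdd fun x => Sobolev.der j (f x)) :
    LipBdd f := by
  intro R
  choose K hK h using fun j => hf j R
  refine ⟨∑ j, K j, Finset.sum_nonneg fun j _ => hK j, fun x y hx hy => ?_⟩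
  refine (Sobolev.norm_le_sum _).trans ?_
  rw [Finset.sum_mul]
  refine Finset.sum_le_sum fun j _ => ?_
  rw [map_sub]
  exact h j x y hx hy

end LipBdd

end LipschitzOnBounded

end DNLS

namespace DNLS

open BoundedContinuousFunction

/-! ### Pointwise formulas for operations on `L²`. -/

section Pointwise

variable {F G : L2} {f g : ℝ → ℂ}

theorem ae_bmul (a : BCF) (hF : F =ᵐ[volume] f) :
    (bmul a F : L2) =ᵐ[volume] fun x => a x * f x := by
  filter_upwards [coeFn_bmul a F, hF] with x h1 h2
  rw [h1, h2]

theorem ae_conj (hF : F =ᵐ[volume] f) : (conjL2 F : L2) =ᵐ[volume] fun x => conj (f x) := by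
  filter_upwards [coeFn_conjL2 F, hF] with x h1 h2
  rw [h1, h2]

theorem ae_add (hF : F =ᵐ[volume] f) (hG : G =ᵐ[volume] g) :
    (F + G : L2) =ᵐ[volume] fun x => f x + g x := by
  filter_upwards [Lp.coeFn_add F G, hF, hG] with x h1 h2 h3
  rw [h1, Pi.add_apply, h2, h3]

theorem ae_sub (hF : F =ᵐ[volume] f) (hG : G =ᵐ[volume] g) :
    (F - G : L2) =ᵐ[volume] fun x => f x - g x := by
  filter_upwards [Lp.coeFn_sub F G, hF, hG] with x h1 h2 h3
  rw [h1, Pi.sub_apply, h2, h3]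

theorem ae_smul (c : ℂ) (hF : F =ᵐ[volume] f) :
    (c • F : L2) =ᵐ[volume] fun x => c * f x := by
  filter_upwards [Lp.coeFn_smul c F, hF] with x h1 h2
  rw [h1, Pi.smul_apply, h2, smul_eq_mul]

theorem HasWeakDeriv.smul_L2 {F G : L2} (h : HasWeakDeriv F G) (c : ℂ) :
    HasWeakDeriv (c • F : L2) (c • G : L2) :=
  (h.const_smul c).congr (Lp.coeFn_smul c F).symm (Lp.coeFn_smul c G).symm

theorem HasWeakDeriv.add_L2 {F G F' G' : L2} (h : HasWeakDeriv F G) (h' : HasWeakDeriv F' G') :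
    HasWeakDeriv (F + F' : L2) (G + G' : L2) :=
  (h.add h').congr (Lp.coeFn_add F F').symm (Lp.coeFn_add G G').symm

theorem HasWeakDeriv.sub_L2 {F G F' G' : L2} (h : HasWeakDeriv F G) (h' : HasWeakDeriv F' G') :
    HasWeakDeriv (F - F' : L2) (G - G' : L2) :=
  (h.sub h').congr (Lp.coeFn_sub F F').symm (Lp.coeFn_sub G G').symm

end Pointwise

/-! ### Leibniz formulas for the nonlinear terms and the algebraic cancellation. -/

section Leibniz

variable {a b : BCF} {p r s : L2}

/-- The weak derivative of `|a|² a`. -/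
noncomputable def cubicDeriv (a : BCF) (p : L2) : L2 :=
  bmul ((2 : ℂ) • (a * star a)) p + bmul (a * a) (conjL2 p)

/-- The second weak derivative of `|a|² a`, where `a' = b` and `a'' = r`. -/
noncomputable def cubicDeriv₂ (a b : BCF) (p r : L2) : L2 :=
  bmul ((2 : ℂ) • (a * star a)) r + bmul (a * a) (conjL2 r) +
    bmul ((2 : ℂ) • (star a * b) + (4 : ℂ) • (a * star b)) p

/-- The third weak derivative of `|a|² a`. -/
noncomputable def cubicDeriv₃ (a b : BCF) (p r s : L2) : L2 :=
  bmul ((2 : ℂ) • (a * star a)) s + bmul (a * a) (conjL2 s) +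
    bmul ((6 : ℂ) • (star a * b + a * star b)) r + bmul ((6 : ℂ) • (a * b)) (conjL2 r) +
    bmul ((6 : ℂ) • (b * star b)) p

theorem coeFn_cubicDeriv (hp : p =ᵐ[volume] b) : (cubicDeriv a p : L2) =ᵐ[volume]
    fun x => 2 * (a x * conj (a x)) * b x + a x * a x * conj (b x) := by
  refine (ae_add (ae_bmul _ hp) (ae_bmul _ (ae_conj hp))).trans (Eventually.of_forall fun x => ?_)
  simp

theorem coeFn_cubicDeriv₂ (hp : p =ᵐ[volume] b) : (cubicDeriv₂ a b p r : L2) =ᵐ[volume]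
    fun x => 2 * (a x * conj (a x)) * r x + a x * a x * conj (r x) +
      (2 * (conj (a x) * b x) + 4 * (a x * conj (b x))) * b x := by
  refine (ae_add (ae_add (ae_bmul _ EventuallyEq.rfl) (ae_bmul _ (ae_conj EventuallyEq.rfl)))
    (ae_bmul _ hp)).trans (Eventually.of_forall fun x => ?_)
  simp

theorem coeFn_cubicDeriv₃ {c : BCF} (hp : p =ᵐ[volume] b) (hr : r =ᵐ[volume] c) :
    (cubicDeriv₃ a b p r s : L2) =ᵐ[volume]
    fun x => 2 * (a x * conj (a x)) * s x + a x * a x * conj (s x) +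
      6 * (conj (a x) * b x + a x * conj (b x)) * c x + 6 * (a x * b x) * conj (c x) +
      6 * (b x * conj (b x)) * b x := by
  refine (ae_add (ae_add (ae_add (ae_add (ae_bmul _ EventuallyEq.rfl)
    (ae_bmul _ (ae_conj EventuallyEq.rfl))) (ae_bmul _ hr)) (ae_bmul _ (ae_conj hr)))
    (ae_bmul _ hp)).trans (Eventually.of_forall fun x => ?_)
  simp [-mul_eq_mul_right_iff]
  ring

/-- Here and below `a` is the function, `p` its derivative in `L²` and `b` the bounded
representative of `p`. Every term keeps exactly one factor in `L²` and bounded coefficients. -/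
theorem hasWeakDeriv_cubic (hp : p =ᵐ[volume] b) (h : HasWeakDeriv a p) :
    HasWeakDeriv (fun x => a x * a x * conj (a x)) (cubicDeriv a p) := by
  refine ((h.mul h).mul h.star).congr EventuallyEq.rfl ?_
  filter_upwards [coeFn_cubicDeriv (a := a) hp, hp] with x h1 h2
  rw [h1]
  simp only [Pi.add_apply, Pi.mul_apply, h2]
  ring

theorem hasWeakDeriv_cubicDeriv (hp : p =ᵐ[volume] b) (h : HasWeakDeriv a p)
    (h' : HasWeakDeriv b r) : HasWeakDeriv (cubicDeriv a p) (cubicDeriv₂ a b p r) := by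
  have e := (((h.mul h.star).mul h').const_smul 2).add ((h.mul h).mul h'.star)
  refine e.congr ?_ ?_
  · filter_upwards [coeFn_cubicDeriv (a := a) hp] with x h1
    rw [h1]
    simp only [Pi.add_apply, Pi.mul_apply, Pi.smul_apply, smul_eq_mul]
    ring
  · filter_upwards [coeFn_cubicDeriv₂ (a := a) (r := r) hp, hp] with x h1 h2
    rw [h1]
    simp only [Pi.add_apply, Pi.mul_apply, Pi.smul_apply, smul_eq_mul, h2]
    ring

/-- A bounded second derivative is available only for the background `φ`, which is where this is
applied. -/
theorem hasWeakDeriv_cubicDeriv₂ {c : BCF} (hp : p =ᵐ[volume] b) (hr : r =ᵐ[volume] c)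
    (h : HasWeakDeriv a p) (h' : HasWeakDeriv b r) (h'' : HasWeakDeriv c s) :
    HasWeakDeriv (cubicDeriv₂ a b p r) (cubicDeriv₃ a b p r s) := by
  have e := ((((h.mul h.star).mul h'').const_smul 2).add ((h.mul h).mul h''.star)).add
    ((((h.star.mul h').const_smul 2).add ((h.mul h'.star).const_smul 4)).mul h')
  refine e.congr ?_ ?_
  · filter_upwards [coeFn_cubicDeriv₂ (a := a) (r := r) hp, hr] with x h1 h2
    rw [h1]
    simp only [Pi.add_apply, Pi.mul_apply, Pi.smul_apply, smul_eq_mul, h2]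
    ring
  · filter_upwards [coeFn_cubicDeriv₃ (a := a) (s := s) hp hr, hp, hr] with x h1 h2 h3
    rw [h1]
    simp only [Pi.add_apply, Pi.mul_apply, Pi.smul_apply, smul_eq_mul, h2, h3]
    ring

/-- The nonlinearity `a² ∂ā`. -/
noncomputable def derivTerm (a : BCF) (p : L2) : L2 := bmul (a * a) (conjL2 p)

/-- The weak derivative of `a² ∂ā`. -/
noncomputable def derivTermDeriv (a b : BCF) (p r : L2) : L2 :=
  bmul ((2 : ℂ) • (a * b)) (conjL2 p) + bmul (a * a) (conjL2 r)

/-- `2 ā b² - 2 i a³ ā b̄ - i a² ā² b`, where `b = a'`. -/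
noncomputable def remainder (a b : BCF) (p : L2) : L2 :=
  bmul ((2 : ℂ) • (star a * b) - Complex.I • (a * a * (star a * star a))) p -
    bmul ((2 * Complex.I) • (a * a * a * star a)) (conjL2 p)

/-- The weak derivative of `2 ā b² - 2 i a³ ā b̄ - i a² ā² b`, where `b = a'`. -/
noncomputable def remainderDeriv (a b : BCF) (p r : L2) : L2 :=
  bmul ((2 : ℂ) • (b * star b) - (2 * Complex.I) • (a * b * (star a * star a)) -
      (2 * Complex.I) • (a * a * star a * star b)) p +
    bmul ((4 : ℂ) • (star a * b) - Complex.I • (a * a * (star a * star a))) r -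
    bmul ((6 * Complex.I) • (a * a * b * star a) + (2 * Complex.I) • (a * a * a * star b))
      (conjL2 p) -
    bmul ((2 * Complex.I) • (a * a * a * star a)) (conjL2 r)

theorem hasWeakDeriv_derivTerm (hp : p =ᵐ[volume] b) (h : HasWeakDeriv a p)
    (h' : HasWeakDeriv b r) : HasWeakDeriv (derivTerm a p) (derivTermDeriv a b p r) := by
  refine ((h.mul h).mul h'.star).congr ?_ ?_
  · filter_upwards [ae_bmul (a * a) (ae_conj hp)] with x h1
    rw [derivTerm, h1]; simp
  · filter_upwards [ae_add (ae_bmul ((2 : ℂ) • (a * b)) (ae_conj hp)) (ae_bmul (a * a)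
      (ae_conj (EventuallyEq.refl _ (r : ℝ → ℂ)))), hp] with x h1 h2
    rw [derivTermDeriv, h1]
    simp [h2, -mul_eq_mul_right_iff]
    ring

theorem hasWeakDeriv_remainder (hp : p =ᵐ[volume] b) (h : HasWeakDeriv a p)
    (h' : HasWeakDeriv b r) : HasWeakDeriv (remainder a b p) (remainderDeriv a b p r) := by
  have hs := h.star
  have e := ((((hs.mul h').mul h').const_smul 2).sub
    ((((((h.mul h).mul (hs.mul hs)).mul h').const_smul Complex.I)))).sub
    (((((h.mul h).mul h).mul hs).mul h'.star).const_smul (2 * Complex.I))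
  refine e.congr ?_ ?_
  · filter_upwards [ae_sub (ae_bmul ((2 : ℂ) • (star a * b) -
      Complex.I • (a * a * (star a * star a))) hp)
      (ae_bmul ((2 * Complex.I) • (a * a * a * star a)) (ae_conj hp))] with x h1
    rw [remainder, h1]
    simp
    ring
  · filter_upwards [ae_sub (ae_sub (ae_add
      (ae_bmul ((2 : ℂ) • (b * star b) - (2 * Complex.I) • (a * b * (star a * star a)) -
        (2 * Complex.I) • (a * a * star a * star b)) hp)
      (ae_bmul ((4 : ℂ) • (star a * b) - Complex.I • (a * a * (star a * star a)))
        (EventuallyEq.refl _ (r : ℝ → ℂ))))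
      (ae_bmul ((6 * Complex.I) • (a * a * b * star a) + (2 * Complex.I) • (a * a * a * star b))
        (ae_conj hp)))
      (ae_bmul ((2 * Complex.I) • (a * a * a * star a))
        (ae_conj (EventuallyEq.refl _ (r : ℝ → ℂ)))), hp] with x h1 h2
    rw [remainderDeriv, h1]
    simp [h2, -mul_eq_mul_right_iff]
    ring

/-- The linearization of `u ↦ |u|² u` at `a`. -/
noncomputable def cubicLin (a : BCF) : L2 →L[ℝ] L2 :=
  (bmul ((2 : ℂ) • (a * star a))).restrictScalars ℝ +
    ((bmul (a * a)).restrictScalars ℝ).comp conjL2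

/-- The right-hand side of the equation `∂ₜu = i ∂²u - u² ∂ū`. -/
noncomputable def vectorField (a : BCF) (p r : L2) : L2 := Complex.I • r - derivTerm a p

/-- The cancellation behind the normal form. -/
theorem cubicLin_vectorField (hp : p =ᵐ[volume] b) :
    Complex.I • cubicLin a (vectorField a p r) + cubicDeriv₂ a b p r =
      (2 : ℂ) • derivTermDeriv a b p r + remainder a b p := by
  apply Lp.ext
  have hr := EventuallyEq.refl (ae volume) (r : ℝ → ℂ)
  have hv := ae_sub (ae_smul Complex.I hr) (ae_bmul (a * a) (ae_conj hp))
  filter_upwards [ae_add (ae_smul Complex.I (ae_add (ae_bmul ((2 : ℂ) • (a * star a)) hv)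
      (ae_bmul (a * a) (ae_conj hv)))) (coeFn_cubicDeriv₂ (a := a) (r := r) hp),
    ae_add (ae_smul 2 (ae_add (ae_bmul ((2 : ℂ) • (a * b)) (ae_conj hp))
      (ae_bmul (a * a) (ae_conj hr)))) (ae_sub (ae_bmul ((2 : ℂ) • (star a * b) -
      Complex.I • (a * a * (star a * star a))) hp)
      (ae_bmul ((2 * Complex.I) • (a * a * a * star a)) (ae_conj hp)))] with x h1 h2
  refine h1.trans (Eq.trans ?_ h2.symm)
  simp only [BoundedContinuousFunction.coe_mul, BoundedContinuousFunction.coe_smul,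
    BoundedContinuousFunction.coe_sub, Pi.mul_apply, Pi.sub_apply, smul_eq_mul,
    BoundedContinuousFunction.star_apply, RCLike.star_def, map_sub, map_mul, Complex.conj_I,
    Complex.conj_conj]
  -- The relation `I² = -1` makes the terms in `|a|² r` cancel and those in `a² r̄` double.
  linear_combination (2 * a x * conj (a x) * r x - a x * a x * conj (r x)) * Complex.I_sq

end Leibniz

/-! ### The equation around a fixed background and its normal form. -/

/-- A bounded continuous function whose weak derivative belongs to `H³`. -/
structure Background where
  /-- the function -/
  val : BCF
  /-- its weak derivative -/
  grad : Sobolev 3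
  hasWeakDeriv : HasWeakDeriv val (Sobolev.der 0 grad)

theorem MemZhidkov.exists_background {φ : ℝ → ℂ} (h : MemZhidkov 4 φ) :
    ∃ B : Background, φ =ᵐ[volume] B.val := by
  obtain ⟨h1, g, hg⟩ := h
  obtain ⟨a, ha⟩ := exists_bcf_of_memLp_top hg h1
  exact ⟨⟨a, g, hg.congr ha EventuallyEq.rfl⟩, ha⟩

namespace Background

open Sobolev

variable (B : Background) (w : Sobolev 2)

/-- The function `φ + w`. -/
noncomputable def u : BCF := B.val + rep 0 w

/-- The bounded continuous representative of `∂(φ + w)`. -/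
noncomputable def ux : BCF := rep 0 B.grad + rep 1 w

/-- The derivative `∂(φ + w)` in `L²`. -/
noncomputable def d : L2 := der 0 B.grad + der 1 w

/-- The second derivative `∂²(φ + w)`. -/
noncomputable def d₂ : L2 := der 1 B.grad + der 2 w

theorem coeFn_d : (B.d w : L2) =ᵐ[volume] B.ux w :=
  ae_add (coeFn_rep 0 B.grad) (coeFn_rep 1 w)

theorem hasWeakDeriv_u : HasWeakDeriv (B.u w) (B.d w) := by
  refine (B.hasWeakDeriv.add (Sobolev.hasWeakDeriv w 0)).congr ?_ (Lp.coeFn_add _ _).symm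
  filter_upwards [coeFn_rep 0 w] with x hx
  exact congrArg (B.val x + ·) hx

theorem hasWeakDeriv_d : HasWeakDeriv (B.d w) (B.d₂ w) :=
  (Sobolev.hasWeakDeriv B.grad 0).add_L2 (Sobolev.hasWeakDeriv w 1)

theorem hasWeakDeriv_ux : HasWeakDeriv (B.ux w) (B.d₂ w) :=
  (B.hasWeakDeriv_d w).congr (B.coeFn_d w) EventuallyEq.rfl

theorem d₂_zero : B.d₂ 0 = der 1 B.grad := by rw [d₂, map_zero, add_zero]

/-- The divided difference of `u ↦ |u|² u` between `φ + v` and `φ + w`, acting on `L²`. -/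
noncomputable def cubicSlope (v : Sobolev 2) : L2 →L[ℝ] L2 :=
  (bmul ((B.u w + B.u v) * star (B.u w))).restrictScalars ℝ +
    ((bmul (B.u v * B.u v)).restrictScalars ℝ).comp conjL2

theorem cubicSlope_self : B.cubicSlope w w = cubicLin (B.u w) := by
  rw [cubicSlope, cubicLin]
  congr 3
  rw [← two_smul ℂ, smul_mul_assoc]

/-- Telescoping: `(a² - b²)ā + b²(ā - b̄) = a²ā - b²b̄`. The conjugate makes the slope linear over
`ℝ` only. -/
theorem coeFn_cubicSlope_sub (v : Sobolev 2) :
    (B.cubicSlope w v (der 0 w - der 0 v) : L2) =ᵐ[volume] fun x =>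
      B.u w x * B.u w x * conj (B.u w x) - B.u v x * B.u v x * conj (B.u v x) := by
  have h := ae_sub (coeFn_rep 0 w) (coeFn_rep 0 v)
  refine (ae_add (ae_bmul ((B.u w + B.u v) * star (B.u w)) h)
    (ae_bmul (B.u v * B.u v) (ae_conj h))).trans (Eventually.of_forall fun x => ?_)
  simp only [u, BoundedContinuousFunction.coe_mul, BoundedContinuousFunction.coe_add,
    Pi.mul_apply, Pi.add_apply, BoundedContinuousFunction.star_apply, RCLike.star_def, map_sub,
    map_add]
  ring

/-- The map `w ↦ |φ + w|² (φ + w) - |φ|² φ` on `H²`. -/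
noncomputable def cubic : Sobolev 2 :=
  mk₂ (B.cubicSlope w 0 (der 0 w - der 0 0)) (cubicDeriv (B.u w) (B.d w) - cubicDeriv (B.u 0) (B.d 0))
    (cubicDeriv₂ (B.u w) (B.ux w) (B.d w) (B.d₂ w) -
      cubicDeriv₂ (B.u 0) (B.ux 0) (B.d 0) (B.d₂ 0))
    (((hasWeakDeriv_cubic (B.coeFn_d w) (B.hasWeakDeriv_u w)).sub
      (hasWeakDeriv_cubic (B.coeFn_d 0) (B.hasWeakDeriv_u 0))).congr
      (B.coeFn_cubicSlope_sub w 0).symm (Lp.coeFn_sub _ _).symm)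
    ((hasWeakDeriv_cubicDeriv (B.coeFn_d w) (B.hasWeakDeriv_u w) (B.hasWeakDeriv_ux w)).sub_L2
      (hasWeakDeriv_cubicDeriv (B.coeFn_d 0) (B.hasWeakDeriv_u 0) (B.hasWeakDeriv_ux 0)))

theorem der_zero_cubic_sub (v : Sobolev 2) :
    der 0 (B.cubic w) - der 0 (B.cubic v) = B.cubicSlope w v (der 0 w - der 0 v) := by
  apply Lp.ext
  filter_upwards [ae_sub (B.coeFn_cubicSlope_sub w 0) (B.coeFn_cubicSlope_sub v 0),
    B.coeFn_cubicSlope_sub w v] with x h1 h2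
  rw [h2]
  refine h1.trans ?_
  ring

/-- The vector field of the equation in terms of the perturbation `w`. -/
noncomputable def field : L2 := vectorField (B.u w) (B.d w) (B.d₂ w)

/-- The function to which the smoothing operator is applied in the normal form. -/
noncomputable def rem : L2 :=
  remainder (B.u w) (B.ux w) (B.d w) - cubicDeriv₂ (B.u 0) (B.ux 0) (B.d 0) (B.d₂ 0)

/-- The weak derivative of `Background.rem`. -/
noncomputable def remDeriv : L2 :=
  remainderDeriv (B.u w) (B.ux w) (B.d w) (B.d₂ w) -
    cubicDeriv₃ (B.u 0) (B.ux 0) (B.d 0) (B.d₂ 0) (der 2 B.grad)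

/-- The remainder contains no second derivative of `u`, so it has one derivative to spare. The
background part uses the third derivative of `φ`. -/
theorem hasWeakDeriv_rem : HasWeakDeriv (B.rem w) (B.remDeriv w) := by
  have h2 : (B.d₂ 0 : L2) =ᵐ[volume] rep 1 B.grad := by rw [d₂_zero]; exact coeFn_rep 1 B.grad
  refine (hasWeakDeriv_remainder (B.coeFn_d w) (B.hasWeakDeriv_u w) (B.hasWeakDeriv_ux w)).sub_L2
    (hasWeakDeriv_cubicDeriv₂ (B.coeFn_d 0) h2 (B.hasWeakDeriv_u 0) (B.hasWeakDeriv_ux 0)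
      ((Sobolev.hasWeakDeriv B.grad 1).congr (coeFn_rep 1 B.grad) EventuallyEq.rfl))

/-- The right-hand side of the Schrödinger equation in normal form. -/
noncomputable def normalRHS {ν : ℝ} (hν : 0 < ν) : Sobolev 2 :=
  let κ : ℂ := ((1 + ν ^ 2 : ℝ) : ℂ)
  let q := derivTerm (B.u w) (B.d w)
  -- Two derivatives of the first entry put one derivative on `rem` and none on `q`; the background
  -- contributes up to `∂⁴φ`.
  mk₂ ((Complex.I / 2) • smoothing hν (B.rem w) - (Complex.I * κ) • resolvent ν q - der 1 B.grad)
    ((Complex.I / 2) • (B.rem w - κ • resolvent ν (B.rem w)) +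
      (Complex.I * κ) • smoothing hν q - der 2 B.grad)
    ((Complex.I / 2) • (B.remDeriv w + κ • smoothing hν (B.rem w)) +
      (Complex.I * κ) • (q - κ • resolvent ν q) - der 3 B.grad)
    (by
      have h := (((hasWeakDeriv_smoothing hν (B.rem w)).smul_L2 (Complex.I / 2)).sub_L2
        ((hasWeakDeriv_resolvent hν q).smul_L2 (Complex.I * κ))).sub_L2
        (Sobolev.hasWeakDeriv B.grad 1)
      rwa [smul_neg, sub_neg_eq_add] at h)
    (by
      have h := ((((B.hasWeakDeriv_rem w).sub_L2
        ((hasWeakDeriv_resolvent hν (B.rem w)).smul_L2 κ)).smul_L2 (Complex.I / 2)).add_L2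
        ((hasWeakDeriv_smoothing hν q).smul_L2 (Complex.I * κ))).sub_L2
        (Sobolev.hasWeakDeriv B.grad 2)
      rwa [smul_neg, sub_neg_eq_add] at h)

/-- The equation satisfied by the normal form `w + (i/2) T (|u|²u - |φ|²φ)`. -/
theorem normalRHS_identity {ν : ℝ} (hν : 0 < ν) :
    Complex.I • (B.field w + (Complex.I / 2) • smoothing hν (cubicLin (B.u w) (B.field w))) +
      (der 2 w + (Complex.I / 2) • smoothing hν (der 2 (B.cubic w))) =
      der 0 (B.normalRHS w hν) := by
  have h1 := cubicLin_vectorField (a := B.u w) (r := B.d₂ w) (B.coeFn_d w)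
  have h2 := smoothing_of_hasWeakDeriv hν
    (hasWeakDeriv_derivTerm (B.coeFn_d w) (B.hasWeakDeriv_u w) (B.hasWeakDeriv_ux w))
  -- After this substitution the `cubicLin` terms cancel, and `h2` turns `(I/2) T(2∂q)` into `I q -
  -- I κ R q`, whose first term cancels the `-I q` coming from `field`.
  have e1 : der 2 (B.cubic w) = (2 : ℂ) • derivTermDeriv (B.u w) (B.ux w) (B.d w) (B.d₂ w) +
      B.rem w - Complex.I • cubicLin (B.u w) (B.field w) := by
    rw [rem, ← add_sub_assoc, ← h1]
    change cubicDeriv₂ (B.u w) (B.ux w) (B.d w) (B.d₂ w) - _ = _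
    rw [field]
    abel
  rw [e1, map_sub, map_add, map_smul, map_smul, h2]
  change _ = (Complex.I / 2) • smoothing hν (B.rem w) - _ - der 1 B.grad
  have e3 : B.d₂ w = der 1 B.grad + der 2 w := rfl
  have e4 : B.field w = Complex.I • B.d₂ w - derivTerm (B.u w) (B.d w) := rfl
  generalize smoothing hν (cubicLin (B.u w) (B.field w)) = z
  rw [e4, e3]
  generalize resolvent ν (derivTerm (B.u w) (B.d w)) = z₂
  have hI := Complex.I_sq
  simp only [smul_add, smul_sub, smul_smul]
  rw [show Complex.I * Complex.I = -1 by rw [← sq, hI]]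
  module

section LipBdd

theorem lipBdd_u : LipBdd B.u := (LipBdd.const B.val).add (LipBdd.id.clm (rep 0))

theorem lipBdd_ux : LipBdd B.ux := (LipBdd.const _).add (LipBdd.id.clm (rep 1))

theorem lipBdd_d : LipBdd B.d := (LipBdd.const _).add (LipBdd.id.clm (der 1))

theorem lipBdd_d₂ : LipBdd B.d₂ := (LipBdd.const _).add (LipBdd.id.clm (der 2))

theorem lipBdd_derivTerm : LipBdd fun w => derivTerm (B.u w) (B.d w) :=
  (B.lipBdd_u.mul B.lipBdd_u).bmul (B.lipBdd_d.clm conjL2)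

theorem continuous_field : Continuous B.field :=
  ((B.lipBdd_d₂.const_smul Complex.I).sub B.lipBdd_derivTerm).continuous

/-- Each Leibniz formula is a polynomial in the bounded functions `u`, `ux` and their conjugates
acting on one `L²` factor, all affine in `w` or conjugates of such. -/
theorem lipBdd_cubic : LipBdd B.cubic := by
  have hu := B.lipBdd_u
  have hux := B.lipBdd_ux
  have hd := B.lipBdd_d
  have hd₂ := B.lipBdd_d₂
  have h0 : LipBdd fun w : Sobolev 2 => der 0 w - der 0 (0 : Sobolev 2) :=
    (LipBdd.id.clm (der 0)).sub (LipBdd.const _)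
  refine LipBdd.sobolev fun j => ?_
  fin_cases j
  · exact (((hu.add (LipBdd.const (B.u 0))).mul hu.star).bmul h0).add
      ((LipBdd.const (B.u 0 * B.u 0)).bmul (h0.clm conjL2))
  · exact ((((hu.mul hu.star).const_smul (2 : ℂ)).bmul hd).add
      ((hu.mul hu).bmul (hd.clm conjL2))).sub (LipBdd.const _)
  · exact (((((hu.mul hu.star).const_smul (2 : ℂ)).bmul hd₂).add
      ((hu.mul hu).bmul (hd₂.clm conjL2))).add
      ((((hu.star.mul hux).const_smul (2 : ℂ)).add
        ((hu.mul hux.star).const_smul (4 : ℂ))).bmul hd)).sub (LipBdd.const _)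

theorem lipBdd_rem : LipBdd B.rem := by
  have hu := B.lipBdd_u
  have hux := B.lipBdd_ux
  have hd := B.lipBdd_d
  exact (((((hu.star.mul hux).const_smul (2 : ℂ)).sub
    (((hu.mul hu).mul (hu.star.mul hu.star)).const_smul Complex.I)).bmul hd).sub
    (((((hu.mul hu).mul hu).mul hu.star).const_smul (2 * Complex.I)).bmul
      (hd.clm conjL2))).sub (LipBdd.const _)

theorem lipBdd_remDeriv : LipBdd B.remDeriv := by
  have hu := B.lipBdd_u
  have hux := B.lipBdd_ux
  have hd := B.lipBdd_d
  have hd₂ := B.lipBdd_d₂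
  have hs := hu.star.mul hu.star
  exact (((((((hux.mul hux.star).const_smul (2 : ℂ)).sub
    (((hu.mul hux).mul hs).const_smul (2 * Complex.I))).sub
    ((((hu.mul hu).mul hu.star).mul hux.star).const_smul (2 * Complex.I))).bmul hd).add
    ((((hu.star.mul hux).const_smul (4 : ℂ)).sub
      (((hu.mul hu).mul hs).const_smul Complex.I)).bmul hd₂)).sub
    ((((((hu.mul hu).mul hux).mul hu.star).const_smul (6 * Complex.I)).add
      ((((hu.mul hu).mul hu).mul hux.star).const_smul (2 * Complex.I))).bmul
      (hd.clm conjL2))).sub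
    (((((hu.mul hu).mul hu).mul hu.star).const_smul (2 * Complex.I)).bmul
      (hd₂.clm conjL2)) |>.sub (LipBdd.const _)

theorem lipBdd_normalRHS {ν : ℝ} (hν : 0 < ν) : LipBdd fun w => B.normalRHS w hν := by
  have hq := B.lipBdd_derivTerm
  have hr := B.lipBdd_rem
  have hr' := B.lipBdd_remDeriv
  refine LipBdd.sobolev fun j => ?_
  fin_cases j
  · exact (((hr.clm (smoothing hν)).const_smul (Complex.I / 2)).sub
      ((hq.clm (resolvent ν)).const_smul (Complex.I * ((1 + ν ^ 2 : ℝ) : ℂ)))).sub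
      (LipBdd.const _)
  · exact (((hr.sub ((hr.clm (resolvent ν)).const_smul ((1 + ν ^ 2 : ℝ) : ℂ))).const_smul
      (Complex.I / 2)).add
      ((hq.clm (smoothing hν)).const_smul (Complex.I * ((1 + ν ^ 2 : ℝ) : ℂ)))).sub
      (LipBdd.const _)
  · exact (((hr'.add ((hr.clm (smoothing hν)).const_smul ((1 + ν ^ 2 : ℝ) : ℂ))).const_smul
      (Complex.I / 2)).add
      ((hq.sub ((hq.clm (resolvent ν)).const_smul ((1 + ν ^ 2 : ℝ) : ℂ))).const_smul
        (Complex.I * ((1 + ν ^ 2 : ℝ) : ℂ)))).sub (LipBdd.const _)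

end LipBdd

end Background

end DNLS

namespace DNLS

/-! ### Abstract equations with a normal form: existence and stability. -/

section NormalForm

variable {X Y : Type*} [NormedAddCommGroup X] [NormedSpace ℝ X] [NormedAddCommGroup Y]
  [NormedSpace ℝ Y]

/-- A strongly continuous group of contractions on `X`, restricting to such a group on `Y`, whose
generator restricts to `A` on `Y`. -/
structure ContractionGroup (J A : Y →L[ℝ] X) where
  /-- the group on `X` -/
  SX : ℝ → X →L[ℝ] X
  /-- the group on `Y` -/
  SY : ℝ → Y →L[ℝ] Y
  zero_X : ∀ x, SX 0 x = x
  zero_Y : ∀ y, SY 0 y = y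
  add_X : ∀ s t x, SX (s + t) x = SX s (SX t x)
  add_Y : ∀ s t y, SY (s + t) y = SY s (SY t y)
  norm_X_le : ∀ t x, ‖SX t x‖ ≤ ‖x‖
  norm_Y_le : ∀ t y, ‖SY t y‖ ≤ ‖y‖
  continuous_X : ∀ x, Continuous fun t => SX t x
  continuous_Y : ∀ y, Continuous fun t => SY t y
  map_J : ∀ t y, J (SY t y) = SX t (J y)
  map_A : ∀ t y, A (SY t y) = SX t (A y)
  hasDerivAt : ∀ y t, HasDerivAt (fun t => SX t (J y)) (SX t (A y)) t

/-- The group run backwards in time. -/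
def ContractionGroup.reverse {J A : Y →L[ℝ] X} (S : ContractionGroup J A) :
    ContractionGroup J (-A) where
  SX t := S.SX (-t)
  SY t := S.SY (-t)
  zero_X x := by rw [neg_zero, S.zero_X]
  zero_Y x := by rw [neg_zero, S.zero_Y]
  add_X s t x := by rw [neg_add, S.add_X]
  add_Y s t x := by rw [neg_add, S.add_Y]
  norm_X_le t := S.norm_X_le _
  norm_Y_le t := S.norm_Y_le _
  continuous_X x := (S.continuous_X x).comp continuous_neg
  continuous_Y x := (S.continuous_Y x).comp continuous_neg
  map_J t := S.map_J _
  map_A t y := by simp [S.map_A]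
  hasDerivAt y t := by
    have := (S.hasDerivAt y (-t)).scomp t (hasDerivAt_neg t)
    simpa [Function.comp_def] using this

/-- A change of unknown `y ↦ y + P y`, close to the identity on a ball of `Y`, which turns the
equation `J y' = G y` into the semilinear equation `z' = A z + f`. -/
structure NormalForm (J A : Y →L[ℝ] X) (G : Y → X) (R : ℝ) where
  /-- the perturbation of the identity -/
  P : Y → Y
  /-- the semilinear term -/
  f : Y → Y
  /-- the divided difference of `P` on `X` -/
  Γ : Y → Y → X →L[ℝ] X
  map_zero : P 0 = 0
  norm_P_sub_le : ∀ x y, ‖x‖ ≤ R → ‖y‖ ≤ R → ‖P x - P y‖ ≤ 1 / 4 * ‖x - y‖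
  lipBdd : LipBdd f
  slope_eq : ∀ x y, J (P x) - J (P y) = Γ x y (J x - J y)
  continuous_slope : Continuous fun p : Y × Y => Γ p.1 p.2
  norm_slope_le : ∀ x, ‖x‖ ≤ R → ‖Γ x x‖ ≤ 1 / 2
  continuous_P : Continuous P
  identity : ∀ y, G y + Γ y y (G y) = A (y + P y) + J (f y)

/-- The normal form of the equation run backwards in time. -/
def NormalForm.reverse {J A : Y →L[ℝ] X} {G : Y → X} {R : ℝ} (N : NormalForm J A G R) :
    NormalForm J (-A) (fun y => -G y) R where
  P := N.P
  f y := -N.f y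
  Γ := N.Γ
  map_zero := N.map_zero
  norm_P_sub_le := N.norm_P_sub_le
  lipBdd := N.lipBdd.neg
  slope_eq := N.slope_eq
  continuous_slope := N.continuous_slope
  norm_slope_le := N.norm_slope_le
  continuous_P := N.continuous_P
  identity y := by
    have := congrArg Neg.neg (N.identity y)
    simp only [neg_add] at this
    simpa using this

/-- `w` is a continuous solution of `J w' = G w` on `I`. -/
def SolOn (J : Y →L[ℝ] X) (G : Y → X) (w : ℝ → Y) (I : Set ℝ) : Prop :=
  ContinuousOn w I ∧ ∀ t ∈ I, HasDerivAt (fun s => J (w s)) (G (w t)) t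

theorem SolOn.mono {J : Y →L[ℝ] X} {G : Y → X} {w : ℝ → Y} {I I' : Set ℝ} (h : SolOn J G w I)
    (hI : I' ⊆ I) : SolOn J G w I' :=
  ⟨h.1.mono hI, fun t ht => h.2 t (hI ht)⟩

theorem SolOn.reverse {J : Y →L[ℝ] X} {G : Y → X} {w : ℝ → Y} {I : Set ℝ} (h : SolOn J G w I) :
    SolOn J (fun y => -G y) (fun t => w (-t)) (Neg.neg ⁻¹' I) := by
  refine ⟨h.1.comp continuous_neg.continuousOn fun t ht => ht, fun t ht => ?_⟩
  have := (h.2 (-t) ht).scomp t (hasDerivAt_neg t)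
  simpa [Function.comp_def] using this

/-- Uniform boundedness upgrades strong continuity to joint continuity in time and argument. -/
theorem tendsto_apply_of_contraction {ι : Type*} {l : Filter ι} {S : ℝ → X →L[ℝ] X}
    (hS : ∀ t x, ‖S t x‖ ≤ ‖x‖) (hc : ∀ x, Continuous fun t => S t x) {s : ι → ℝ} {t : ℝ}
    (hs : Tendsto s l (𝓝 t)) {z : ι → X} {z₀ : X} (hz : Tendsto z l (𝓝 z₀)) :
    Tendsto (fun i => S (s i) (z i)) l (𝓝 (S t z₀)) := by
  have h1 : Tendsto (fun i => S (s i) (z i - z₀)) l (𝓝 0) := by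
    refine squeeze_zero_norm (fun i => hS _ _) ?_
    simpa using (hz.sub_const z₀).norm
  have h2 := h1.add (((hc z₀).tendsto t).comp hs)
  rw [zero_add] at h2
  refine h2.congr fun i => ?_
  simp

theorem tendsto_clm_apply {ι : Type*} {l : Filter ι} {L : ι → X →L[ℝ] X} {L₀ : X →L[ℝ] X}
    {z : ι → X} {z₀ : X} (hL : Tendsto L l (𝓝 L₀)) (hz : Tendsto z l (𝓝 z₀)) :
    Tendsto (fun i => L i (z i)) l (𝓝 (L₀ z₀)) :=
  (isBoundedBilinearMap_apply.continuous.tendsto (L₀, z₀)).comp (hL.prodMk_nhds hz)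

theorem continuousOn_apply_of_contraction {S : ℝ → X →L[ℝ] X}
    (hS : ∀ t x, ‖S t x‖ ≤ ‖x‖) (hc : ∀ x, Continuous fun t => S t x) {s : ℝ → ℝ}
    (hs : Continuous s) {z : ℝ → X} {I : Set ℝ} (hz : ContinuousOn z I) :
    ContinuousOn (fun t => S (s t) (z t)) I := fun t ht =>
  tendsto_apply_of_contraction hS hc ((hs.tendsto t).mono_left inf_le_left) (hz t ht)

variable {J A : Y →L[ℝ] X} {G : Y → X} {R : ℝ}

/-- Product rule for a strongly continuous group: the slope splits as `S(s)` applied to the slope of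
`z` plus the slope of the orbit of `z t`. Only `z t` has to lie in the domain. -/
theorem ContractionGroup.hasDerivAt_apply (S : ContractionGroup J A) {z : ℝ → X} {z' : X} {t : ℝ}
    {y : Y} (hz : HasDerivAt z z' t) (hy : z t = J y) :
    HasDerivAt (fun s => S.SX s (z s)) (S.SX t z' + S.SX t (A y)) t := by
  rw [hasDerivAt_iff_tendsto_slope] at hz ⊢
  have h1 := tendsto_apply_of_contraction S.norm_X_le S.continuous_X
    (tendsto_id.mono_left (nhdsWithin_le_nhds (s := {t}ᶜ))) hz
  have h2 := h1.add (hasDerivAt_iff_tendsto_slope.mp (S.hasDerivAt y t))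
  refine h2.congr fun s => ?_
  simp only [slope, vsub_eq_sub, id, map_smul, map_sub, hy]
  rw [← smul_add]
  congr 1
  abel

namespace NormalForm

/-- The slope of `J (P w)` is `Γ` applied to the slope of `J w`, and `Γ` is continuous along `w`; no
differentiability of `P` on `Y` is needed. -/
theorem hasDerivAt_add_P (N : NormalForm J A G R) {w : ℝ → Y} {t : ℝ} (hc : ContinuousAt w t)
    (h : HasDerivAt (fun s => J (w s)) (G (w t)) t) :
    HasDerivAt (fun s => J (w s + N.P (w s))) (A (w t + N.P (w t)) + J (N.f (w t))) t := by
  rw [← N.identity]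
  rw [hasDerivAt_iff_tendsto_slope] at h ⊢
  have hΓ : Tendsto (fun s => N.Γ (w s) (w t)) (𝓝[≠] t) (𝓝 (N.Γ (w t) (w t))) :=
    ((N.continuous_slope.tendsto (w t, w t)).comp
      (hc.tendsto.prodMk_nhds tendsto_const_nhds)).mono_left nhdsWithin_le_nhds
  refine (h.add (tendsto_clm_apply hΓ h)).congr fun s => ?_
  simp only [slope, vsub_eq_sub, map_smul, map_add]
  rw [← N.slope_eq, ← smul_add]
  congr 1
  abel

/-- The slope of `J w` is recovered by inverting `1 + Γ`. At time `t` this is a Neumann series;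
nearby it follows as units are open and inversion is continuous. -/
theorem hasDerivAt_of_add_P [CompleteSpace X] (N : NormalForm J A G R) {w : ℝ → Y} {t : ℝ}
    (hc : ContinuousAt w t) (hR : ‖w t‖ ≤ R)
    (h : HasDerivAt (fun s => J (w s + N.P (w s))) (A (w t + N.P (w t)) + J (N.f (w t))) t) :
    HasDerivAt (fun s => J (w s)) (G (w t)) t := by
  rw [← N.identity] at h
  rw [hasDerivAt_iff_tendsto_slope] at h ⊢
  have hΓ : Tendsto (fun s => 1 + N.Γ (w s) (w t)) (𝓝[≠] t) (𝓝 (1 + N.Γ (w t) (w t))) :=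
    (((N.continuous_slope.tendsto (w t, w t)).comp
      (hc.tendsto.prodMk_nhds tendsto_const_nhds)).mono_left nhdsWithin_le_nhds).const_add 1
  have hlt : ‖-N.Γ (w t) (w t)‖ < 1 := by
    rw [norm_neg]; exact (N.norm_slope_le _ hR).trans_lt (by norm_num)
  let U : (X →L[ℝ] X)ˣ := Units.oneSub (-N.Γ (w t) (w t)) hlt
  have hU : (U : X →L[ℝ] X) = 1 + N.Γ (w t) (w t) := by
    simp [U]
  have hinv := (NormedRing.inverse_continuousAt U).tendsto
  rw [hU] at hinv
  have hev : ∀ᶠ s in 𝓝[≠] t, IsUnit (1 + N.Γ (w s) (w t)) := by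
    have : {x : X →L[ℝ] X | IsUnit x} ∈ 𝓝 (1 + N.Γ (w t) (w t)) := by
      rw [← hU]; exact U.nhds
    exact hΓ this
  have hlim := tendsto_clm_apply (hinv.comp hΓ) h
  have e0 : Ring.inverse (1 + N.Γ (w t) (w t)) (G (w t) + N.Γ (w t) (w t) (G (w t))) =
      G (w t) := by
    have : (Ring.inverse (1 + N.Γ (w t) (w t)) * (1 + N.Γ (w t) (w t))) (G (w t)) = G (w t) := by
      rw [Ring.inverse_mul_cancel _ (hU ▸ U.isUnit)]; rfl
    simpa using this
  rw [e0] at hlim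
  refine hlim.congr' ?_
  filter_upwards [hev] with s hs
  have e1 : slope (fun s => J (w s + N.P (w s))) t s =
      (1 + N.Γ (w s) (w t)) (slope (fun s => J (w s)) t s) := by
    simp only [slope, vsub_eq_sub, map_add, add_apply,
      one_apply_eq_self, map_smul]
    rw [← N.slope_eq]
    congr 1
    abel
  rw [e1, Function.comp_apply]
  change (Ring.inverse (1 + N.Γ (w s) (w t)) * (1 + N.Γ (w s) (w t))) _ = _
  rw [Ring.inverse_mul_cancel _ hs]
  rfl

theorem continuousOn_integrand (N : NormalForm J A G R) (S : ContractionGroup J A) {w : ℝ → Y}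
    {I : Set ℝ} (hw : ContinuousOn w I) : ContinuousOn (fun s => S.SY (-s) (N.f (w s))) I :=
  continuousOn_apply_of_contraction S.norm_Y_le S.continuous_Y continuous_neg
    (N.lipBdd.continuous.comp_continuousOn hw)

variable [CompleteSpace X] [CompleteSpace Y]

/-- Duhamel's formula for the normal form of a solution. -/
theorem duhamel (N : NormalForm J A G R) (S : ContractionGroup J A)
    (hJ : Function.Injective J) {w : ℝ → Y} {a b : ℝ} (hab : a ≤ b) (h : SolOn J G w (Icc a b)) :
    ∫ s in a..b, S.SY (-s) (N.f (w s)) =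
      S.SY (-b) (w b + N.P (w b)) - S.SY (-a) (w a + N.P (w a)) := by
  -- The integrand lives in `Y`, but the derivative exists only in `X`; injectivity of `J` brings
  -- the identity back.
  apply hJ
  have hci : ContinuousOn (fun s => S.SY (-s) (N.f (w s))) (Icc a b) :=
    N.continuousOn_integrand S h.1
  have hii : IntervalIntegrable (fun s => S.SY (-s) (N.f (w s))) volume a b := by
    apply ContinuousOn.intervalIntegrable
    rwa [uIcc_of_le hab]
  rw [← J.intervalIntegral_comp_comm hii, map_sub, S.map_J, S.map_J]
  refine intervalIntegral.integral_eq_sub_of_hasDerivAt_of_le hab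
    (f := fun s => S.SX (-s) (J (w s + N.P (w s)))) ?_ (fun t ht => ?_) ?_
  · exact continuousOn_apply_of_contraction S.norm_X_le S.continuous_X continuous_neg
      (J.continuous.comp_continuousOn (h.1.add (N.continuous_P.comp_continuousOn h.1)))
  · have hc : ContinuousAt w t := h.1.continuousAt (Icc_mem_nhds ht.1 ht.2)
    have hd := N.hasDerivAt_add_P hc (h.2 t (Ioo_subset_Icc_self ht))
    have := S.reverse.hasDerivAt_apply hd rfl
    rw [← ContinuousLinearMap.map_add] at this
    simp only [neg_apply] at this
    -- The unbounded term `A (w + P w)` cancels against the generator `-A` of the reversed group.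
    rw [add_neg_cancel_comm] at this
    rw [S.map_J]
    exact this
  · apply ContinuousOn.intervalIntegrable
    rw [uIcc_of_le hab]
    exact J.continuous.comp_continuousOn hci

theorem hasDerivAt_of_duhamel (N : NormalForm J A G R) (S : ContractionGroup J A) {w : ℝ → Y}
    (hw : Continuous w) {c : Y} {I : Set ℝ} (hI : IsOpen I)
    (h : ∀ t ∈ I, w t + N.P (w t) = S.SY t (c + ∫ s in (0 : ℝ)..t, S.SY (-s) (N.f (w s))))
    (hR : ∀ t ∈ I, ‖w t‖ ≤ R) : SolOn J G w I := by
  refine ⟨hw.continuousOn, fun t ht => N.hasDerivAt_of_add_P hw.continuousAt (hR t ht) ?_⟩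
  have hc : Continuous fun s => S.SY (-s) (N.f (w s)) := by
    rw [← continuousOn_univ]
    exact N.continuousOn_integrand S hw.continuousOn
  have hd : HasDerivAt (fun t => c + ∫ s in (0 : ℝ)..t, S.SY (-s) (N.f (w s)))
      (S.SY (-t) (N.f (w t))) t :=
    (intervalIntegral.integral_hasDerivAt_right (hc.intervalIntegrable _ _)
      (hc.stronglyMeasurableAtFilter _ _) hc.continuousAt).const_add c
  have hJd := J.hasFDerivAt.comp_hasDerivAt t hd
  have hS := S.hasDerivAt_apply hJd rfl
  have e1 : S.SX t (J (S.SY (-t) (N.f (w t)))) = J (N.f (w t)) := by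
    rw [← S.map_J, ← S.add_Y, add_neg_cancel, S.zero_Y]
  rw [e1, ← S.map_A, ← h t ht, add_comm] at hS
  refine hS.congr_of_eventuallyEq ?_
  filter_upwards [hI.mem_nhds ht] with s hs
  rw [h s hs, S.map_J]
  rfl

/-- Forward stability estimate. -/
theorem norm_sub_le_exp (N : NormalForm J A G R) (S : ContractionGroup J A)
    (hJ : Function.Injective J) {K : ℝ} (hK : 0 < K)
    (hlip : ∀ x y, ‖x‖ ≤ R → ‖y‖ ≤ R → ‖N.f x - N.f y‖ ≤ K * ‖x - y‖) {w v : ℝ → Y} {a b : ℝ}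
    (hab : a ≤ b) (hw : SolOn J G w (Icc a b)) (hv : SolOn J G v (Icc a b))
    (bw : ∀ t ∈ Icc a b, ‖w t‖ ≤ R) (bv : ∀ t ∈ Icc a b, ‖v t‖ ≤ R) :
    ‖w b - v b‖ ≤ 2 * ‖w a - v a‖ * Real.exp (2 * K * (b - a)) := by
  have hD : ContinuousOn (fun t => ‖w t - v t‖) (Icc a b) := (hw.1.sub hv.1).norm
  have hDi : ∀ t ∈ Icc a b, IntervalIntegrable (fun t => ‖w t - v t‖) volume a t := fun t ht => by
    apply ContinuousOn.intervalIntegrable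
    rw [uIcc_of_le ht.1]
    exact hD.mono (Icc_subset_Icc_right ht.2)
  -- `1 + P` expands distances by at most `5/4` and contracts them by at most `3/4`; the resulting
  -- factors `5/3` and `4/3` are rounded up to `2`.
  have key : ∀ t ∈ Icc a b,
      ‖w t - v t‖ ≤ 2 * ‖w a - v a‖ + 2 * K * ∫ s in a..t, ‖w s - v s‖ := by
    intro t ht
    have hsub : Icc a t ⊆ Icc a b := Icc_subset_Icc_right ht.2
    have e1 := N.duhamel S hJ ht.1 (hw.mono hsub)
    have e2 := N.duhamel S hJ ht.1 (hv.mono hsub)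
    have i1 : IntervalIntegrable (fun s => S.SY (-s) (N.f (w s))) volume a t := by
      apply ContinuousOn.intervalIntegrable
      rw [uIcc_of_le ht.1]
      exact N.continuousOn_integrand S (hw.1.mono hsub)
    have i2 : IntervalIntegrable (fun s => S.SY (-s) (N.f (v s))) volume a t := by
      apply ContinuousOn.intervalIntegrable
      rw [uIcc_of_le ht.1]
      exact N.continuousOn_integrand S (hv.1.mono hsub)
    have hint : ‖∫ s in a..t, (S.SY (-s) (N.f (w s)) - S.SY (-s) (N.f (v s)))‖ ≤
        K * ∫ s in a..t, ‖w s - v s‖ := by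
      rw [← intervalIntegral.integral_const_mul]
      refine intervalIntegral.norm_integral_le_of_norm_le ht.1 (Eventually.of_forall fun s hs => ?_)
        ((hDi t ht).const_mul K)
      have hs' : s ∈ Icc a b := hsub (Ioc_subset_Icc_self hs)
      rw [← map_sub]
      exact (S.norm_Y_le _ _).trans (hlip _ _ (bw s hs') (bv s hs'))
    rw [intervalIntegral.integral_sub i1 i2, e1, e2] at hint
    have e3 : (w t + N.P (w t)) - (v t + N.P (v t)) =
        S.SY t ((S.SY (-t) (w t + N.P (w t)) - S.SY (-a) (w a + N.P (w a)) -
          (S.SY (-t) (v t + N.P (v t)) - S.SY (-a) (v a + N.P (v a)))) +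
          S.SY (-a) ((w a + N.P (w a)) - (v a + N.P (v a)))) := by
      have e4 : S.SY (-t) (w t + N.P (w t)) - S.SY (-a) (w a + N.P (w a)) -
          (S.SY (-t) (v t + N.P (v t)) - S.SY (-a) (v a + N.P (v a))) +
          S.SY (-a) ((w a + N.P (w a)) - (v a + N.P (v a))) =
          S.SY (-t) ((w t + N.P (w t)) - (v t + N.P (v t))) := by
        simp only [map_sub]; abel
      rw [e4, ← S.add_Y, add_neg_cancel, S.zero_Y]
    have b1 : ‖(w t + N.P (w t)) - (v t + N.P (v t))‖ ≤
        (K * ∫ s in a..t, ‖w s - v s‖) + ‖(w a + N.P (w a)) - (v a + N.P (v a))‖ := by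
      rw [e3]
      exact (S.norm_Y_le _ _).trans ((norm_add_le _ _).trans (add_le_add hint (S.norm_Y_le _ _)))
    have ha : a ∈ Icc a b := left_mem_Icc.mpr hab
    have b2 : ‖(w a + N.P (w a)) - (v a + N.P (v a))‖ ≤ 5 / 4 * ‖w a - v a‖ := by
      rw [add_sub_add_comm]
      refine (norm_add_le _ _).trans ?_
      linarith [N.norm_P_sub_le _ _ (bw a ha) (bv a ha)]
    have b3 : ‖w t - v t‖ ≤ ‖(w t + N.P (w t)) - (v t + N.P (v t))‖ + 1 / 4 * ‖w t - v t‖ := by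
      have e5 : w t - v t = ((w t + N.P (w t)) - (v t + N.P (v t))) - (N.P (w t) - N.P (v t)) := by
        abel
      calc ‖w t - v t‖ = ‖((w t + N.P (w t)) - (v t + N.P (v t))) - (N.P (w t) - N.P (v t))‖ :=
            congrArg _ e5
        _ ≤ _ := (norm_sub_le _ _).trans
            (add_le_add_right (N.norm_P_sub_le _ _ (bw t ht) (bv t ht)) _)
    have hpos : 0 ≤ K * ∫ s in a..t, ‖w s - v s‖ :=
      mul_nonneg hK.le (intervalIntegral.integral_nonneg ht.1 fun _ _ => norm_nonneg _)
    linarith [norm_nonneg (w a - v a)]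
  let D : ℝ → ℝ := IccExtend hab fun t => ‖w t - v t‖
  have hDc : Continuous D := (continuousOn_iff_continuous_domRestrict.mp hD).Icc_extend'
  have hDe : ∀ t ∈ Icc a b, D t = ‖w t - v t‖ := fun t ht => IccExtend_of_mem hab _ ht
  have hDint : ∀ t ∈ Icc a b, ∫ s in a..t, ‖w s - v s‖ = ∫ s in a..t, D s := fun t ht =>
    intervalIntegral.integral_congr fun s hs => by
      rw [uIcc_of_le ht.1] at hs
      exact (hDe s (Icc_subset_Icc_right ht.2 hs)).symm
  have hD0 : ∀ t, 0 ≤ D t := fun t => norm_nonneg _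
  have hd : ∀ t, HasDerivAt (fun t => ∫ s in a..t, D s) (D t) t := fun t =>
    intervalIntegral.integral_hasDerivAt_right (hDc.intervalIntegrable _ _)
      (hDc.stronglyMeasurableAtFilter _ _) hDc.continuousAt
  -- Gronwall is applied to the integral of the distance, whose derivative is the distance itself,
  -- so the distance need not be differentiable.
  have hg := norm_le_gronwallBound_of_norm_deriv_right_le
    (f := fun t => ∫ s in a..t, D s) (f' := D) (δ := 0) (K := 2 * K)
    (ε := 2 * ‖w a - v a‖) (a := a) (b := b)
    (fun t _ => (hd t).continuousAt.continuousWithinAt) (fun t _ => (hd t).hasDerivWithinAt)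
    (by simp)
    (fun t ht => by
      have ht' : t ∈ Icc a b := Ico_subset_Icc_self ht
      rw [Real.norm_of_nonneg (hD0 t), Real.norm_of_nonneg
        (intervalIntegral.integral_nonneg ht.1 fun _ _ => hD0 _), add_comm, hDe t ht',
        ← hDint t ht']
      exact key t ht')
    b (right_mem_Icc.mpr hab)
  rw [gronwallBound_of_K_ne_0 (by positivity),
    Real.norm_of_nonneg (intervalIntegral.integral_nonneg hab fun _ _ => hD0 _),
    ← hDint b (right_mem_Icc.mpr hab)] at hg
  have := key b (right_mem_Icc.mpr hab)
  have hg' := mul_le_mul_of_nonneg_left hg (show 0 ≤ 2 * K by positivity)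
  have e : 2 * K * (0 * Real.exp (2 * K * (b - a)) +
      2 * ‖w a - v a‖ / (2 * K) * (Real.exp (2 * K * (b - a)) - 1)) =
      2 * ‖w a - v a‖ * Real.exp (2 * K * (b - a)) - 2 * ‖w a - v a‖ := by
    field_simp
    ring
  rw [e] at hg'
  linarith

/-- The Duhamel map, whose fixed points are the local solutions. -/
noncomputable def duhamelMap (N : NormalForm J A G R) (S : ContractionGroup J A) (y : Y) {τ : ℝ}
    (hτ : -τ ≤ τ) (x : C(Icc (-τ) τ, Y)) : C(Icc (-τ) τ, Y) where
  toFun t := S.SY t (y + N.P y + ∫ s in (0 : ℝ)..t, S.SY (-s) (N.f (x (projIcc _ _ hτ s)))) -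
    N.P (x t)
  continuous_toFun := by
    have hx : Continuous fun s : ℝ => x (projIcc _ _ hτ s) := x.continuous.comp continuous_projIcc
    have hc : Continuous fun s : ℝ => S.SY (-s) (N.f (x (projIcc _ _ hτ s))) := by
      rw [← continuousOn_univ]
      exact N.continuousOn_integrand S hx.continuousOn
    have h1 : Continuous fun t : ℝ =>
        S.SY t (y + N.P y + ∫ s in (0 : ℝ)..t, S.SY (-s) (N.f (x (projIcc _ _ hτ s)))) := by
      rw [← continuousOn_univ]
      exact continuousOn_apply_of_contraction S.norm_Y_le S.continuous_Y continuous_id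
        (continuous_const.add (intervalIntegral.continuous_primitive
          (fun _ _ => hc.intervalIntegrable _ _) 0)).continuousOn
    exact (h1.comp continuous_subtype_val).sub (N.continuous_P.comp x.continuous)

/-- Banach's fixed point theorem for `duhamelMap` on the ball of radius `2R + 2`. The map is a
contraction with constant `1/2`, one quarter each from `P` and from the integral. -/
theorem exists_solOn (S : ContractionGroup J A) {R : ℝ} (hR : 0 ≤ R)
    (N : NormalForm J A G (2 * R + 2)) :
    ∃ τ > 0, ∀ y, ‖y‖ ≤ R → ∃ w : ℝ → Y, w 0 = y ∧ SolOn J G w (Ioo (-τ) τ) ∧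
      ∀ t, ‖w t‖ ≤ 2 * R + 2 := by
  obtain ⟨K, hK, hlip⟩ := N.lipBdd (2 * R + 2)
  obtain ⟨M, hM, hbd⟩ := N.lipBdd.bounded (2 * R + 2)
  -- With `M τ ≤ 1` the image has norm at most `(5/4) R + 1 + (2R + 2)/4 ≤ 2R + 2`. The choice of
  -- `τ` does not involve `y`.
  obtain ⟨τ, hτ0, hτM, hτK⟩ : ∃ τ > 0, M * τ ≤ 1 ∧ K * τ ≤ 1 / 4 := by
    refine ⟨1 / (4 * (K + M + 1)), by positivity, ?_, ?_⟩
    · rw [mul_one_div, div_le_one (by positivity)]; linarith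
    · rw [mul_one_div, div_le_div_iff₀ (by positivity) (by norm_num)]; linarith
  have hτ : -τ ≤ τ := by linarith
  refine ⟨τ, hτ0, fun y hy => ?_⟩
  have hP0 : ∀ x, ‖x‖ ≤ 2 * R + 2 → ‖N.P x‖ ≤ 1 / 4 * ‖x‖ := fun x hx => by
    simpa [N.map_zero] using N.norm_P_sub_le x 0 hx (by simpa using by positivity)
  let Φ := N.duhamelMap S y hτ
  let B : Set C(Icc (-τ) τ, Y) := Metric.closedBall 0 (2 * R + 2)
  have hB : ∀ x ∈ B, ∀ t, ‖x t‖ ≤ 2 * R + 2 := fun x hx t =>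
    (x.norm_coe_le_norm t).trans (by simpa [B] using hx)
  have habs : ∀ t : Icc (-τ) τ, |(t : ℝ) - 0| ≤ τ := fun t => by
    rw [sub_zero]; exact abs_le.mpr t.2
  have hmaps : MapsTo Φ B B := by
    intro x hx
    rw [mem_closedBall_zero_iff, ContinuousMap.norm_le _ (by positivity)]
    intro t
    have h1 : ‖∫ s in (0 : ℝ)..t, S.SY (-s) (N.f (x (projIcc _ _ hτ s)))‖ ≤ 1 :=
      (intervalIntegral.norm_integral_le_of_norm_le_const fun s _ =>
        (S.norm_Y_le _ _).trans (hbd _ (hB x hx _))).trans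
        ((mul_le_mul_of_nonneg_left (habs t) hM).trans hτM)
    have h2 := hP0 y (by linarith)
    have h3 := hP0 _ (hB x hx t)
    have h4 := hB x hx t
    calc ‖Φ x t‖ ≤ ‖y + N.P y + ∫ s in (0 : ℝ)..t, S.SY (-s) (N.f (x (projIcc _ _ hτ s)))‖ +
          ‖N.P (x t)‖ := (norm_sub_le _ _).trans (add_le_add_left (S.norm_Y_le _ _) _)
      _ ≤ (‖y‖ + ‖N.P y‖ + 1) + ‖N.P (x t)‖ := by
          gcongr
          exact (norm_add_le _ _).trans (add_le_add (norm_add_le _ _) h1)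
      _ ≤ 2 * R + 2 := by linarith
  have hdist : ∀ x ∈ B, ∀ x' ∈ B, dist (Φ x) (Φ x') ≤ 1 / 2 * dist x x' := by
    intro x hx x' hx'
    rw [ContinuousMap.dist_le (by positivity)]
    intro t
    have hc : ∀ x : C(Icc (-τ) τ, Y),
        Continuous fun s : ℝ => S.SY (-s) (N.f (x (projIcc _ _ hτ s))) := fun x => by
      rw [← continuousOn_univ]
      exact N.continuousOn_integrand S (x.continuous.comp continuous_projIcc).continuousOn
    have hxx : ∀ s, ‖x s - x' s‖ ≤ dist x x' := fun s => by
      rw [← dist_eq_norm]; exact ContinuousMap.dist_apply_le_dist s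
    have h1 : ‖(∫ s in (0 : ℝ)..t, S.SY (-s) (N.f (x (projIcc _ _ hτ s)))) -
        ∫ s in (0 : ℝ)..t, S.SY (-s) (N.f (x' (projIcc _ _ hτ s)))‖ ≤ 1 / 4 * dist x x' := by
      rw [← intervalIntegral.integral_sub ((hc x).intervalIntegrable _ _)
        ((hc x').intervalIntegrable _ _)]
      refine (intervalIntegral.norm_integral_le_of_norm_le_const
        (C := K * dist x x') fun s _ => ?_).trans ?_
      · rw [← map_sub]
        refine (S.norm_Y_le _ _).trans ((hlip _ _ (hB x hx _) (hB x' hx' _)).trans ?_)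
        exact mul_le_mul_of_nonneg_left (hxx _) hK
      · calc K * dist x x' * |(t : ℝ) - 0| ≤ K * dist x x' * τ := by gcongr; exact habs t
          _ = (K * τ) * dist x x' := by ring
          _ ≤ _ := by gcongr
    have h2 := N.norm_P_sub_le _ _ (hB x hx t) (hB x' hx' t)
    have e : Φ x t - Φ x' t = S.SY t ((∫ s in (0 : ℝ)..t, S.SY (-s) (N.f (x (projIcc _ _ hτ s)))) -
        ∫ s in (0 : ℝ)..t, S.SY (-s) (N.f (x' (projIcc _ _ hτ s)))) - (N.P (x t) - N.P (x' t)) := by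
      change (S.SY t _ - _) - (S.SY t _ - _) = _
      simp only [map_add, map_sub]
      abel
    rw [dist_eq_norm, e]
    refine (norm_sub_le _ _).trans ?_
    have h3 := (S.norm_Y_le t _).trans h1
    linarith [hxx t]
  have hcontr : ContractingWith (1 / 2) (hmaps.restrict Φ B B) := by
    refine ⟨NNReal.half_lt_self one_ne_zero, LipschitzWith.of_dist_le_mul ?_⟩
    rintro ⟨x, hx⟩ ⟨x', hx'⟩
    refine (hdist x hx x' hx').trans_eq ?_
    rw [NNReal.coe_div, NNReal.coe_one, NNReal.coe_two]
    rfl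
  obtain ⟨x, hx, hfix, -⟩ := ContractingWith.exists_fixedPoint' Metric.isClosed_closedBall.isComplete
    hmaps hcontr (x := 0) (Metric.mem_closedBall_self (by positivity)) (edist_ne_top _ _)
  have hxt : ∀ t ∈ Icc (-τ) τ, x (projIcc _ _ hτ t) = S.SY t (y + N.P y +
      ∫ s in (0 : ℝ)..t, S.SY (-s) (N.f (x (projIcc _ _ hτ s)))) -
        N.P (x (projIcc _ _ hτ t)) := fun t ht => by
    have := DFunLike.congr_fun hfix (projIcc _ _ hτ t)
    rw [projIcc_of_mem hτ ht] at this ⊢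
    exact this.symm
  refine ⟨fun t => x (projIcc _ _ hτ t), ?_, ?_, fun t => hB x hx _⟩
  -- At time `0` the fixed point equation reads `x + P x = y + P y`, and `1 + P` is injective on the
  -- ball.
  · have h0 := hxt 0 ⟨by linarith, hτ0.le⟩
    rw [intervalIntegral.integral_same, add_zero, S.zero_Y] at h0
    have hb := N.norm_P_sub_le y (x (projIcc _ _ hτ 0)) (by linarith) (hB x hx _)
    have e : x (projIcc _ _ hτ 0) - y = N.P y - N.P (x (projIcc _ _ hτ 0)) := by
      nth_rewrite 1 [h0]; abel
    rw [← e, norm_sub_rev] at hb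
    have : ‖y - x (projIcc _ _ hτ 0)‖ = 0 := by linarith [norm_nonneg (y - x (projIcc _ _ hτ 0))]
    exact (sub_eq_zero.mp (norm_eq_zero.mp this)).symm
  · refine N.hasDerivAt_of_duhamel S (x.continuous.comp continuous_projIcc) (c := y + N.P y)
      isOpen_Ioo (fun t ht => ?_) fun t _ => hB x hx _
    have := hxt t (Ioo_subset_Icc_self ht)
    exact eq_sub_iff_add_eq.mp this

/-- The forward estimate applied also to the time-reversed problem allows `s` and `t` in either
order. -/
theorem exists_norm_sub_le (S : ContractionGroup J A) (hJ : Function.Injective J)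
    (N : NormalForm J A G R) (L : ℝ) : ∃ C : ℝ, 0 ≤ C ∧ ∀ (w v : ℝ → Y) (a b : ℝ), b - a ≤ L →
      SolOn J G w (Icc a b) → SolOn J G v (Icc a b) → (∀ t ∈ Icc a b, ‖w t‖ ≤ R) →
      (∀ t ∈ Icc a b, ‖v t‖ ≤ R) → ∀ s ∈ Icc a b, ∀ t ∈ Icc a b,
        ‖w t - v t‖ ≤ C * ‖w s - v s‖ := by
  obtain ⟨K, hK, hlip⟩ := N.lipBdd R
  have hlip' : ∀ x y, ‖x‖ ≤ R → ‖y‖ ≤ R → ‖N.f x - N.f y‖ ≤ (K + 1) * ‖x - y‖ :=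
    fun x y hx hy => (hlip x y hx hy).trans (by gcongr; linarith)
  have hrlip : ∀ x y, ‖x‖ ≤ R → ‖y‖ ≤ R →
      ‖N.reverse.f x - N.reverse.f y‖ ≤ (K + 1) * ‖x - y‖ := fun x y hx hy => by
    change ‖-N.f x - -N.f y‖ ≤ _
    rw [neg_sub_neg, norm_sub_rev]
    exact hlip' x y hx hy
  refine ⟨2 * Real.exp (2 * (K + 1) * L), by positivity,
    fun w v a b hL hw hv bw bv s hs t ht => ?_⟩
  rcases le_total s t with hst | hst
  · have hsub : Icc s t ⊆ Icc a b := Icc_subset_Icc hs.1 ht.2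
    refine (N.norm_sub_le_exp S hJ (by positivity) hlip' hst (hw.mono hsub) (hv.mono hsub)
      (fun r hr => bw r (hsub hr)) fun r hr => bv r (hsub hr)).trans ?_
    rw [mul_right_comm]
    gcongr
    linarith [hs.1, ht.2]
  · have hsub : Icc t s ⊆ Icc a b := Icc_subset_Icc ht.1 hs.2
    have hneg : ∀ r ∈ Icc (-s) (-t), -r ∈ Icc t s := fun r hr => ⟨by linarith [hr.2], by linarith [hr.1]⟩
    have h := N.reverse.norm_sub_le_exp S.reverse hJ (K := K + 1) (by positivity) hrlip
      (neg_le_neg hst) ((hw.mono hsub).reverse.mono hneg) ((hv.mono hsub).reverse.mono hneg)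
      (fun r hr => bw _ (hsub (hneg r hr))) fun r hr => bv _ (hsub (hneg r hr))
    rw [neg_neg, neg_neg] at h
    refine h.trans ?_
    rw [mul_right_comm]
    gcongr
    linarith [hs.2, ht.1]

end NormalForm

end NormalForm

end DNLS

namespace DNLS

/-! ### The maximal flow of a locally well-posed equation. -/

section MaximalFlow

variable {X Y : Type*} [NormedAddCommGroup X] [NormedSpace ℝ X] [NormedAddCommGroup Y]
  [NormedSpace ℝ Y]

/-- Local well-posedness of `J w' = G w`, uniformly on bounded sets of data. -/
structure LocallyWellPosed (J : Y →L[ℝ] X) (G : Y → X) : Prop where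
  exists_sol : ∀ R : ℝ, ∃ τ > 0, ∃ ρ : ℝ, ∀ y : Y, ‖y‖ ≤ R → ∃ w : ℝ → Y, w 0 = y ∧
    SolOn J G w (Ioo (-τ) τ) ∧ ∀ t, ‖w t‖ ≤ ρ
  stable : ∀ R L : ℝ, ∃ C : ℝ, 0 ≤ C ∧ ∀ (w v : ℝ → Y) (a b : ℝ), b - a ≤ L →
    SolOn J G w (Icc a b) → SolOn J G v (Icc a b) → (∀ t ∈ Icc a b, ‖w t‖ ≤ R) →
    (∀ t ∈ Icc a b, ‖v t‖ ≤ R) → ∀ s ∈ Icc a b, ∀ t ∈ Icc a b, ‖w t - v t‖ ≤ C * ‖w s - v s‖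

namespace SolOn

variable {J : Y →L[ℝ] X} {G : Y → X} {w : ℝ → Y} {I : Set ℝ}

theorem translate (h : SolOn J G w I) (a : ℝ) :
    SolOn J G (fun t => w (t - a)) ((fun t => t - a) ⁻¹' I) :=
  ⟨h.1.comp (continuous_sub_right a).continuousOn fun _ ht => ht,
    fun t ht => (h.2 (t - a) ht).comp_sub_const t a⟩

theorem of_local (h : ∀ t ∈ I, ∃ U ∈ 𝓝 t, ∃ v, SolOn J G v U ∧ EqOn w v U) : SolOn J G w I := by
  refine ⟨fun t ht => ?_, fun t ht => ?_⟩
  · obtain ⟨U, hU, v, hv, e⟩ := h t ht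
    exact ((hv.1.congr e).continuousAt hU).continuousWithinAt
  · obtain ⟨U, hU, v, hv, e⟩ := h t ht
    rw [e (mem_of_mem_nhds hU)]
    refine (hv.2 t (mem_of_mem_nhds hU)).congr_of_eventuallyEq ?_
    filter_upwards [hU] with s hs
    rw [e hs]

end SolOn

variable {J : Y →L[ℝ] X} {G : Y → X}

/-- Continuous solutions are bounded on the compact segment from `s` to `t`, so the stability
estimate for that bound applies with zero initial difference. -/
theorem LocallyWellPosed.eqOn (H : LocallyWellPosed J G) {w v : ℝ → Y} {I : Set ℝ}
    (hI : I.OrdConnected) (hw : SolOn J G w I) (hv : SolOn J G v I) {s : ℝ} (hs : s ∈ I)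
    (h : w s = v s) : EqOn w v I := by
  intro t ht
  have hsub : uIcc s t ⊆ I := hI.uIcc_subset hs ht
  obtain ⟨A, hA⟩ := isCompact_uIcc.exists_bound_of_continuousOn (hw.1.mono hsub)
  obtain ⟨B, hB⟩ := isCompact_uIcc.exists_bound_of_continuousOn (hv.1.mono hsub)
  obtain ⟨C, -, hC⟩ := H.stable (max A B) (max s t - min s t)
  have := hC w v (min s t) (max s t) le_rfl (hw.mono hsub) (hv.mono hsub)
    (fun r hr => (hA r hr).trans (le_max_left _ _)) (fun r hr => (hB r hr).trans (le_max_right _ _))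
    s left_mem_uIcc t right_mem_uIcc
  rw [h, sub_self, norm_zero, mul_zero] at this
  exact sub_eq_zero.mp (norm_le_zero_iff.mp this)

variable (J G) in
/-- The maximal interval of existence of the solution with initial value `y`. -/
def lifespan (y : Y) : Set ℝ :=
  {t | ∃ (I : Set ℝ) (w : ℝ → Y), IsOpen I ∧ I.OrdConnected ∧ 0 ∈ I ∧ t ∈ I ∧ w 0 = y ∧
    SolOn J G w I}

open Classical in
variable (J G) in
/-- The maximal solution with initial value `y`. -/
noncomputable def flow (y : Y) (t : ℝ) : Y :=
  if h : t ∈ lifespan J G y then h.choose_spec.choose t else 0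

theorem subset_lifespan {y : Y} {I : Set ℝ} {w : ℝ → Y} (hI : IsOpen I) (hc : I.OrdConnected)
    (h0 : 0 ∈ I) (hy : w 0 = y) (hw : SolOn J G w I) : I ⊆ lifespan J G y :=
  fun _ ht => ⟨I, w, hI, hc, h0, ht, hy, hw⟩

theorem isOpen_lifespan (y : Y) : IsOpen (lifespan J G y) := by
  rw [isOpen_iff_mem_nhds]
  rintro t ⟨I, w, hI, hc, h0, ht, hy, hw⟩
  exact mem_of_superset (hI.mem_nhds ht) (subset_lifespan hI hc h0 hy hw)

theorem ordConnected_lifespan (y : Y) : (lifespan J G y).OrdConnected := by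
  refine ⟨?_⟩
  rintro a ⟨I, w, hI, hc, h0, ha, hy, hw⟩ b ⟨I', w', hI', hc', h0', hb, hy', hw'⟩ t ht
  rcases le_total t 0 with h | h
  · exact subset_lifespan hI hc h0 hy hw (hc.out ha h0 ⟨ht.1, h⟩)
  · exact subset_lifespan hI' hc' h0' hy' hw' (hc'.out h0' hb ⟨h, ht.2⟩)

namespace LocallyWellPosed

variable (H : LocallyWellPosed J G)

include H

theorem eqOn_flow {y : Y} {I : Set ℝ} {w : ℝ → Y} (hI : IsOpen I) (hc : I.OrdConnected)
    (h0 : 0 ∈ I) (hy : w 0 = y) (hw : SolOn J G w I) : EqOn w (flow J G y) I := by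
  intro t ht
  have hl : t ∈ lifespan J G y := subset_lifespan hI hc h0 hy hw ht
  rw [flow, dif_pos hl]
  obtain ⟨-, hc', h0', ht', hy', hw'⟩ := hl.choose_spec.choose_spec
  exact H.eqOn (hc.inter hc') (hw.mono inter_subset_left) (hw'.mono inter_subset_right)
    ⟨h0, h0'⟩ (hy.trans hy'.symm) ⟨ht, ht'⟩

theorem exists_isOpen (y : Y) : ∃ (I : Set ℝ) (w : ℝ → Y), IsOpen I ∧ I.OrdConnected ∧ 0 ∈ I ∧
    w 0 = y ∧ SolOn J G w I := by
  obtain ⟨τ, hτ, ρ, h⟩ := H.exists_sol ‖y‖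
  obtain ⟨w, hy, hw, -⟩ := h y le_rfl
  exact ⟨Ioo (-τ) τ, w, isOpen_Ioo, ordConnected_Ioo, ⟨by linarith, hτ⟩, hy, hw⟩

theorem zero_mem_lifespan (y : Y) : 0 ∈ lifespan J G y := by
  obtain ⟨I, w, hI, hc, h0, hy, hw⟩ := H.exists_isOpen y
  exact subset_lifespan hI hc h0 hy hw h0

theorem flow_zero (y : Y) : flow J G y 0 = y := by
  obtain ⟨I, w, hI, hc, h0, hy, hw⟩ := H.exists_isOpen y
  rw [← H.eqOn_flow hI hc h0 hy hw h0, hy]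

theorem solOn_flow (y : Y) : SolOn J G (flow J G y) (lifespan J G y) := by
  refine SolOn.of_local ?_
  rintro t ⟨I, w, hI, hc, h0, ht, hy, hw⟩
  exact ⟨I, hI.mem_nhds ht, w, hw, (H.eqOn_flow hI hc h0 hy hw).symm⟩

/-- A local solution started at time `t` is glued to the flow. Since `τ` and `ρ` depend only on `R`,
this drives both the blow-up alternative and continuous dependence. -/
theorem exists_extension (R : ℝ) : ∃ τ > 0, ∃ ρ : ℝ, ∀ (y : Y), ∀ t ∈ lifespan J G y,
    ‖flow J G y t‖ ≤ R → ∀ s, |s - t| < τ → s ∈ lifespan J G y ∧ ‖flow J G y s‖ ≤ ρ := by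
  classical
  obtain ⟨τ, hτ, ρ, h⟩ := H.exists_sol R
  refine ⟨τ, hτ, ρ, fun y t ht hR => ?_⟩
  obtain ⟨v, hv0, hv, hvb⟩ := h _ hR
  let U : Set ℝ := (fun s => s - t) ⁻¹' Ioo (-τ) τ
  have hU : IsOpen U := isOpen_Ioo.preimage (continuous_sub_right t)
  have hUc : U.OrdConnected := ordConnected_Ioo.preimage_mono fun a b hab => sub_le_sub_right hab t
  have htU : t ∈ U := by simp [U, hτ]
  have hv' : SolOn J G (fun s => v (s - t)) U := hv.translate t
  let E := lifespan J G y
  have hE : IsOpen E := isOpen_lifespan y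
  have hEc : E.OrdConnected := ordConnected_lifespan y
  have hsol := H.solOn_flow y
  have hagree : EqOn (flow J G y) (fun s => v (s - t)) (E ∩ U) :=
    H.eqOn (hEc.inter hUc) (hsol.mono inter_subset_left) (hv'.mono inter_subset_right)
      (s := t) ⟨ht, htU⟩ (by simp [hv0])
  let z : ℝ → Y := fun s => if s ∈ E then flow J G y s else v (s - t)
  have z1 : EqOn z (flow J G y) E := fun s hs => if_pos hs
  have z2 : EqOn z (fun s => v (s - t)) U := fun s hs => by
    by_cases hsE : s ∈ E
    · exact (if_pos hsE).trans (hagree ⟨hsE, hs⟩)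
    · exact if_neg hsE
  have hz : SolOn J G z (E ∪ U) := by
    refine SolOn.of_local ?_
    rintro s (hs | hs)
    · exact ⟨E, hE.mem_nhds hs, _, hsol, z1⟩
    · exact ⟨U, hU.mem_nhds hs, _, hv', z2⟩
  have hc : (E ∪ U).OrdConnected := by
    rw [← isPreconnected_iff_ordConnected] at hEc hUc ⊢
    exact IsPreconnected.union t ht htU hEc hUc
  have h0 : (0 : ℝ) ∈ E := H.zero_mem_lifespan y
  have hz0 : z 0 = y := (z1 h0).trans (H.flow_zero y)
  intro s hs
  have hsU : s ∈ U := abs_lt.mp hs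
  have hflow := H.eqOn_flow (hE.union hU) hc (Or.inl h0) hz0 hz (Or.inr hsU)
  refine ⟨subset_lifespan (hE.union hU) hc (Or.inl h0) hz0 hz (Or.inr hsU), ?_⟩
  rw [← hflow, z2 hsU]
  exact hvb _

/-- Blow-up alternative. -/
theorem tendsto_norm_flow {y : Y} {T : ℝ} (hT : T ∉ lifespan J G y) {l : Filter ℝ}
    (hl : l ≤ 𝓝 T) (hmem : ∀ᶠ t in l, t ∈ lifespan J G y) :
    Tendsto (fun t => ‖flow J G y t‖) l atTop := by
  rw [tendsto_atTop]
  intro R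
  obtain ⟨τ, hτ, ρ, h⟩ := H.exists_extension R
  have hnear : ∀ᶠ t in l, |T - t| < τ := by
    filter_upwards [hl (Metric.ball_mem_nhds T hτ)] with t ht
    rwa [abs_sub_comm]
  filter_upwards [hmem, hnear] with t h1 h2
  -- If the norm were below `R` at a time within `τ` of `T`, the solution would extend past `T`.
  by_contra hlt
  exact hT (h y t h1 (not_le.mp hlt).le T h2).1

/-- Lipschitz dependence on the initial value on compact time intervals. -/
theorem exists_flow_sub_le (y : Y) {a b : ℝ} (ha : a ≤ 0) (hb : 0 ≤ b)
    (hab : Icc a b ⊆ lifespan J G y) : ∃ δ > 0, ∃ C : ℝ, ∀ y', ‖y' - y‖ ≤ δ →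
      Icc a b ⊆ lifespan J G y' ∧
        ∀ t ∈ Icc a b, ‖flow J G y' t - flow J G y t‖ ≤ C * ‖y' - y‖ := by
  have hsol := (H.solOn_flow y).mono hab
  obtain ⟨R₀, hR₀⟩ := isCompact_Icc.exists_bound_of_continuousOn hsol.1
  obtain ⟨τ, hτ, ρ, hext⟩ := H.exists_extension (R₀ + 1)
  obtain ⟨C, hC, hstab⟩ := H.stable (max ρ (R₀ + 1)) (b - a)
  -- Then `C ‖y' - y‖ ≤ 1`, so the stability estimate keeps the perturbed solution within `R₀ + 1`.
  refine ⟨1 / (C + 1), by positivity, C, fun y' hy' => ?_⟩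
  have hδ1 : ‖y' - y‖ ≤ 1 := hy'.trans (by
    rw [div_le_one (by positivity)]; linarith)
  have hCδ : C * ‖y' - y‖ ≤ 1 := by
    calc C * ‖y' - y‖ ≤ C * (1 / (C + 1)) := by gcongr
      _ ≤ 1 := by rw [mul_one_div, div_le_one (by positivity)]; linarith
  have hsub : ∀ t ∈ Icc a b, uIcc 0 t ⊆ Icc a b := fun t ht =>
    ordConnected_Icc.uIcc_subset ⟨ha, hb⟩ ht
  have hest : ∀ t ∈ Icc a b, (∀ s ∈ uIcc 0 t, s ∈ lifespan J G y' ∧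
      ‖flow J G y' s‖ ≤ max ρ (R₀ + 1)) → ‖flow J G y' t - flow J G y t‖ ≤ C * ‖y' - y‖ := by
    intro t ht h
    have := hstab (flow J G y') (flow J G y) (min 0 t) (max 0 t)
      (sub_le_sub (max_le hb ht.2) (le_min ha ht.1))
      ((H.solOn_flow y').mono fun s hs => (h s hs).1) (hsol.mono (hsub t ht))
      (fun s hs => (h s hs).2)
      (fun s hs => (hR₀ s (hsub t ht hs)).trans (le_trans (by linarith) (le_max_right _ _)))
      0 left_mem_uIcc t right_mem_uIcc
    rwa [H.flow_zero, H.flow_zero] at this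
  have hsmall : ∀ t ∈ Icc a b, ‖flow J G y' t - flow J G y t‖ ≤ C * ‖y' - y‖ →
      ‖flow J G y' t‖ ≤ R₀ + 1 := fun t ht h => by
    have := norm_sub_norm_le (flow J G y' t) (flow J G y t)
    linarith [hR₀ t ht]
  -- Bootstrap in steps of `τ / 2`: extension gives existence with the crude bound `ρ`, and
  -- stability from time `0` restores the bound `R₀ + 1`, so the step length never shrinks.
  have key : ∀ n : ℕ, ∀ t ∈ Icc a b, |t| ≤ n * (τ / 2) →
      t ∈ lifespan J G y' ∧ ‖flow J G y' t‖ ≤ R₀ + 1 := by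
    intro n
    induction n with
    | zero =>
      intro t _ ht0
      have : t = 0 := by simpa using ht0
      subst this
      refine ⟨H.zero_mem_lifespan y', ?_⟩
      rw [H.flow_zero]
      have h1 := hR₀ 0 ⟨ha, hb⟩
      rw [H.flow_zero] at h1
      linarith [norm_sub_norm_le y' y]
    | succ n ih =>
      have hstep : ∀ t ∈ Icc a b, |t| ≤ ((n + 1 : ℕ) : ℝ) * (τ / 2) →
          t ∈ lifespan J G y' ∧ ‖flow J G y' t‖ ≤ max ρ (R₀ + 1) := by
        intro t ht htn
        have hn : (0 : ℝ) ≤ n * (τ / 2) := by positivity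
        push_cast at htn
        rw [abs_le] at htn
        obtain ⟨s, hs, hsn, hst⟩ : ∃ s ∈ Icc a b, |s| ≤ n * (τ / 2) ∧ |t - s| < τ := by
          -- The time `t` clamped to the interval already treated.
          refine ⟨max (-(n * (τ / 2))) (min t (n * (τ / 2))), ⟨?_, ?_⟩, ?_, ?_⟩
          · exact le_max_of_le_right (le_min ht.1 (ha.trans hn))
          · exact max_le (by linarith) ((min_le_left _ _).trans ht.2)
          · exact abs_le.mpr ⟨le_max_left _ _, max_le (by linarith) (min_le_right _ _)⟩
          · rw [abs_lt]
            rcases le_total t (n * (τ / 2)) with h1 | h1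
            · rw [min_eq_left h1]
              rcases le_total (-(n * (τ / 2))) t with h2 | h2
              · rw [max_eq_right h2]; constructor <;> linarith
              · rw [max_eq_left h2]; constructor <;> linarith
            · rw [min_eq_right h1, max_eq_right (by linarith)]; constructor <;> linarith
        obtain ⟨h1, h2⟩ := ih s hs hsn
        obtain ⟨h3, h4⟩ := hext y' s h1 h2 t hst
        exact ⟨h3, h4.trans (le_max_left _ _)⟩
      intro t ht htn
      refine ⟨(hstep t ht htn).1, hsmall t ht (hest t ht fun s hs => ?_)⟩
      refine hstep s (hsub t ht hs) (le_trans ?_ htn)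
      have := abs_sub_left_of_mem_uIcc hs
      simpa using this
  obtain ⟨n, hn⟩ := exists_nat_ge (max b (-a) / (τ / 2))
  rw [div_le_iff₀ (by positivity)] at hn
  have hall : ∀ t ∈ Icc a b, t ∈ lifespan J G y' ∧ ‖flow J G y' t‖ ≤ R₀ + 1 := fun t ht =>
    key n t ht (le_trans (abs_le.mpr ⟨by linarith [le_max_right b (-a), ht.1],
      ht.2.trans (le_max_left _ _)⟩) hn)
  refine ⟨fun t ht => (hall t ht).1, fun t ht => hest t ht fun s hs => ?_⟩
  obtain ⟨h1, h2⟩ := hall s (hsub t ht hs)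
  exact ⟨h1, h2.trans (le_max_right _ _)⟩

end LocallyWellPosed

end MaximalFlow

/-! ### Open intervals with extended real endpoints. -/

section TimeInterval

theorem isOpen_timeInterval (Tmin Tmax : EReal) : IsOpen (timeInterval Tmin Tmax) :=
  isOpen_Ioo.preimage continuous_coe_real_ereal

theorem ordConnected_timeInterval (Tmin Tmax : EReal) : (timeInterval Tmin Tmax).OrdConnected :=
  ordConnected_Ioo.preimage_mono fun _ _ h => EReal.coe_le_coe_iff.mpr h

theorem zero_mem_timeInterval {Tmin Tmax : EReal} (h1 : 0 < Tmin) (h2 : 0 < Tmax) :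
    (0 : ℝ) ∈ timeInterval Tmin Tmax :=
  ⟨by rw [EReal.coe_zero]; exact EReal.neg_lt_comm.mp (by rwa [neg_zero]), by rwa [EReal.coe_zero]⟩

theorem neg_coe_lt_iff {T : EReal} {t : ℝ} : -T < (t : EReal) ↔ ((-t : ℝ) : EReal) < T := by
  rw [EReal.neg_lt_comm, EReal.coe_neg]

theorem le_of_timeInterval_subset {Smin Smax Tmin Tmax : EReal} (hS : 0 < Smin) (hS' : 0 < Smax)
    (hT : 0 < Tmin) (hT' : 0 < Tmax) (h : timeInterval Smin Smax ⊆ timeInterval Tmin Tmax) :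
    Smin ≤ Tmin ∧ Smax ≤ Tmax := by
  constructor
  · by_contra! hlt
    obtain ⟨r, hr1, hr2⟩ := EReal.lt_iff_exists_real_btwn.mp hlt
    have hr0 : 0 < r := EReal.coe_pos.mp (hT.trans hr1)
    have hm : -r ∈ timeInterval Smin Smax := by
      refine ⟨by rwa [neg_coe_lt_iff, neg_neg], lt_of_le_of_lt ?_ hS'⟩
      exact_mod_cast (neg_nonpos.mpr hr0.le)
    have := (h hm).1
    rw [neg_coe_lt_iff, neg_neg] at this
    exact lt_asymm this hr1
  · by_contra! hlt
    obtain ⟨r, hr1, hr2⟩ := EReal.lt_iff_exists_real_btwn.mp hlt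
    have hr0 : 0 < r := EReal.coe_pos.mp (hT'.trans hr1)
    have hm : r ∈ timeInterval Smin Smax := by
      refine ⟨?_, hr2⟩
      rw [neg_coe_lt_iff]
      refine lt_of_le_of_lt ?_ hS
      exact_mod_cast (neg_nonpos.mpr hr0.le)
    exact lt_asymm (h hm).2 hr1

/-- Every open interval containing `0` is of the form `(-Tmin, Tmax)`. -/
theorem exists_timeInterval {E : Set ℝ} (hE : IsOpen E) (hc : E.OrdConnected) (h0 : (0 : ℝ) ∈ E) :
    ∃ Tmin Tmax : EReal, 0 < Tmin ∧ 0 < Tmax ∧ timeInterval Tmin Tmax = E := by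
  -- Openness makes the supremum strict, so the endpoints are not attained.
  have hr : ∀ t ∈ E, ((t : ℝ) : EReal) < sSup ((fun t : ℝ => (t : EReal)) '' E) := fun t ht => by
    obtain ⟨ε, hε, h⟩ := Metric.isOpen_iff.mp hE t ht
    have hs : t + ε / 2 ∈ E := h (by
      rw [Metric.mem_ball, Real.dist_eq, add_sub_cancel_left, abs_of_pos (by linarith)]; linarith)
    exact (EReal.coe_lt_coe_iff.mpr (by linarith)).trans_le (le_sSup ⟨_, hs, rfl⟩)
  have hl : ∀ t ∈ E, ((-t : ℝ) : EReal) < sSup ((fun t : ℝ => ((-t : ℝ) : EReal)) '' E) := by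
    intro t ht
    obtain ⟨ε, hε, h⟩ := Metric.isOpen_iff.mp hE t ht
    have hs : t - ε / 2 ∈ E := h (by
      rw [Metric.mem_ball, Real.dist_eq, sub_sub_cancel_left, abs_neg, abs_of_pos (by linarith)]
      linarith)
    exact (EReal.coe_lt_coe_iff.mpr (by linarith)).trans_le (le_sSup ⟨_, hs, rfl⟩)
  refine ⟨_, _, by simpa using hl 0 h0, by simpa using hr 0 h0, Subset.antisymm ?_ ?_⟩
  · rintro t ⟨h1, h2⟩
    rw [neg_coe_lt_iff] at h1
    obtain ⟨_, ⟨a, ha, rfl⟩, ha'⟩ := lt_sSup_iff.mp h1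
    obtain ⟨_, ⟨b, hb, rfl⟩, hb'⟩ := lt_sSup_iff.mp h2
    exact hc.out ha hb ⟨by have := EReal.coe_lt_coe_iff.mp ha'; linarith,
      (EReal.coe_lt_coe_iff.mp hb').le⟩
  · exact fun t ht => ⟨neg_coe_lt_iff.mpr (hl t ht), hr t ht⟩

end TimeInterval

end DNLS

namespace DNLS

/-! ### The Schrödinger equation as an instance of the abstract setting. -/

section SchrodingerGroup

open Sobolev

/-- The inclusion of `H²` in `L²`, over `ℝ`. -/
noncomputable def incl : Sobolev 2 →L[ℝ] L2 := (der 0).restrictScalars ℝ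

/-- The operator `i ∂²` from `H²` to `L²`, over `ℝ`. -/
noncomputable def generator : Sobolev 2 →L[ℝ] L2 := (Complex.I • der 2).restrictScalars ℝ

theorem incl_injective : Function.Injective incl := fun _ _ h => ext_der h

theorem norm_schrodingerSymbol_le (t : ℝ) : ‖schrodingerSymbol t‖ ≤ 1 :=
  BoundedContinuousFunction.norm_ofNormedAddCommGroup_le _ zero_le_one _

/-- The Schrödinger group on `L²` and on `H²`. -/
noncomputable def schrodingerGroup : ContractionGroup incl generator where
  SX t := (schrodinger t).restrictScalars ℝ
  SY t := (Sobolev.mult (schrodingerSymbol t)).restrictScalars ℝ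
  zero_X := schrodinger_zero
  zero_Y w := ext_der (schrodinger_zero _)
  add_X := schrodinger_add
  add_Y s t w := ext_der (schrodinger_add s t _)
  norm_X_le := norm_schrodinger_le
  norm_Y_le t w := (Sobolev.norm_mult_le _ w).trans
    (mul_le_of_le_one_left (norm_nonneg _) (norm_schrodingerSymbol_le t))
  continuous_X := continuous_schrodinger
  continuous_Y w := by
    refine continuous_induced_rng.mpr ((PiLp.continuous_toLp 2 _).comp (continuous_pi fun j => ?_))
    exact continuous_schrodinger (der j w)
  map_J t w := rfl
  map_A t w := ((schrodinger t).map_smul Complex.I (der 2 w)).symm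
  hasDerivAt w t := hasDerivAt_schrodinger (Sobolev.hasWeakDeriv w 0) (Sobolev.hasWeakDeriv w 1) t

end SchrodingerGroup

namespace Background

open Sobolev

variable (B : Background)

theorem cubic_zero : B.cubic 0 = 0 := by
  apply ext_der
  change B.cubicSlope 0 0 (der 0 0 - der 0 0) = der 0 0
  rw [sub_self, map_zero, map_zero]

theorem exists_norm_cubicSlope_le (R : ℝ) :
    ∃ M : ℝ, 0 ≤ M ∧ ∀ w, ‖w‖ ≤ R → ‖B.cubicSlope w w‖ ≤ M := by
  have hu := B.lipBdd_u
  obtain ⟨M₁, h₁, b₁⟩ := ((hu.add hu).mul hu.star).bounded R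
  obtain ⟨M₂, h₂, b₂⟩ := (hu.mul hu).bounded R
  refine ⟨M₁ + M₂, add_nonneg h₁ h₂, fun w hw => ?_⟩
  refine ContinuousLinearMap.opNorm_le_bound _ (add_nonneg h₁ h₂) fun f => ?_
  refine (norm_add_le _ _).trans ?_
  refine (add_le_add ?_ ?_).trans_eq (add_mul M₁ M₂ ‖f‖).symm
  · refine (norm_bmul_le _ _).trans ?_
    exact mul_le_mul_of_nonneg_right (b₁ w hw) (norm_nonneg _)
  · refine (norm_bmul_le _ (conjL2 f)).trans ?_
    rw [norm_conjL2]
    exact mul_le_mul_of_nonneg_right (b₂ w hw) (norm_nonneg _)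

theorem continuous_cubicSlope :
    Continuous fun p : Sobolev 2 × Sobolev 2 => B.cubicSlope p.1 p.2 := by
  have hu := B.lipBdd_u.continuous
  have h1 : Continuous fun p : Sobolev 2 × Sobolev 2 => B.u p.1 := hu.comp continuous_fst
  have h2 : Continuous fun p : Sobolev 2 × Sobolev 2 => B.u p.2 := hu.comp continuous_snd
  have hr : Continuous fun L : L2 →L[ℂ] L2 => L.restrictScalars ℝ :=
    (ContinuousLinearMap.restrictScalarsL ℂ L2 L2 ℝ ℝ).continuous
  have hb : Continuous fun a : BCF => (bmul a).restrictScalars ℝ := hr.comp bmul.continuous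
  exact (hb.comp ((h1.add h2).mul h1.star)).add
    ((hb.comp (h2.mul h2)).clm_comp continuous_const)

theorem norm_smoothingSymbol_le {ν : ℝ} (hν : 0 < ν) : ‖smoothingSymbol hν‖ ≤ 1 / (2 * ν) :=
  BoundedContinuousFunction.norm_ofNormedAddCommGroup_le _ (by positivity) _

/-- The smoothing operator, weighted as in the normal form. -/
noncomputable def halfSmoothing {ν : ℝ} (hν : 0 < ν) : L2 →L[ℝ] L2 :=
  ((Complex.I / 2) • smoothing hν).restrictScalars ℝ

theorem norm_halfSmoothing_le {ν : ℝ} (hν : 0 < ν) : ‖halfSmoothing hν‖ ≤ 1 / (4 * ν) := by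
  refine ContinuousLinearMap.opNorm_le_bound _ (by positivity) fun f => ?_
  change ‖(Complex.I / 2) • smoothing hν f‖ ≤ _
  rw [norm_smul, norm_div, Complex.norm_I, RCLike.norm_ofNat]
  calc 1 / 2 * ‖smoothing hν f‖ ≤ 1 / 2 * (1 / (2 * ν) * ‖f‖) := by
        gcongr; exact norm_smoothing_le hν f
    _ = 1 / (4 * ν) * ‖f‖ := by field_simp; ring

/-- The normal form of the equation on the ball of radius `R` of `H²`. -/
theorem exists_normalForm (R : ℝ) : Nonempty (NormalForm incl generator B.field R) := by
  obtain ⟨K, hK, hlip⟩ := B.lipBdd_cubic R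
  obtain ⟨M, hM, hbd⟩ := B.exists_norm_cubicSlope_le R
  -- The operator `(I/2) T` has norm at most `1/(4ν)`, so `ν ≥ K` gives Lipschitz constant `1/4` on
  -- `H²`, and `ν ≥ M` bounds the slope on `L²`.
  obtain ⟨ν, hν, hKν, hMν⟩ : ∃ ν > 0, K ≤ ν ∧ M ≤ ν :=
    ⟨K + M + 1, by positivity, by linarith, by linarith⟩
  exact ⟨{
    P := fun w => (Complex.I / 2) • Sobolev.mult (smoothingSymbol hν) (B.cubic w)
    f := fun w => -(Complex.I • B.normalRHS w hν)
    Γ := fun w v => (halfSmoothing hν).comp (B.cubicSlope w v)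
    map_zero := by rw [cubic_zero, map_zero, smul_zero]
    norm_P_sub_le := fun w v hw hv => by
      rw [← smul_sub, ← map_sub, norm_smul, norm_div, Complex.norm_I, RCLike.norm_ofNat]
      calc 1 / 2 * ‖Sobolev.mult (smoothingSymbol hν) (B.cubic w - B.cubic v)‖
          ≤ 1 / 2 * (1 / (2 * ν) * (ν * ‖w - v‖)) := by
            gcongr
            refine (Sobolev.norm_mult_le _ _).trans ?_
            gcongr
            · exact norm_smoothingSymbol_le hν
            · exact (hlip w v hw hv).trans (by gcongr)
        _ = 1 / 4 * ‖w - v‖ := by field_simp; ring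
    lipBdd := ((B.lipBdd_normalRHS hν).const_smul Complex.I).neg
    slope_eq := fun w v => by
      change (Complex.I / 2) • smoothing hν (der 0 (B.cubic w)) -
        (Complex.I / 2) • smoothing hν (der 0 (B.cubic v)) =
          (Complex.I / 2) • smoothing hν (B.cubicSlope w v (der 0 w - der 0 v))
      rw [← smul_sub, ← map_sub, der_zero_cubic_sub]
    continuous_slope := continuous_const.clm_comp B.continuous_cubicSlope
    norm_slope_le := fun w hw => by
      refine (ContinuousLinearMap.opNorm_comp_le _ _).trans ?_
      calc ‖halfSmoothing hν‖ * ‖B.cubicSlope w w‖ ≤ 1 / (4 * ν) * ν := by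
            gcongr
            · exact norm_halfSmoothing_le hν
            · exact (hbd w hw).trans hMν
        _ ≤ 1 / 2 := by rw [one_div, mul_inv, mul_assoc, inv_mul_cancel₀ hν.ne']; norm_num
    continuous_P := ((Sobolev.mult (smoothingSymbol hν)).continuous.comp
      B.lipBdd_cubic.continuous).const_smul (Complex.I / 2)
    identity := fun w => by
      rw [cubicSlope_self]
      change B.field w + (Complex.I / 2) • smoothing hν (cubicLin (B.u w) (B.field w)) =
        Complex.I • (der 2 w + (Complex.I / 2) • smoothing hν (der 2 (B.cubic w))) +
          -(Complex.I • der 0 (B.normalRHS w hν))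
      rw [← B.normalRHS_identity w hν, smul_add Complex.I (Complex.I • _), smul_smul,
        Complex.I_mul_I]
      module }⟩

/-- The normal form changes with the radius through `ν`, but the equation for `w` does not, so a
separate one may be chosen for each bound. -/
theorem locallyWellPosed : LocallyWellPosed incl B.field where
  exists_sol R := by
    obtain ⟨N⟩ := B.exists_normalForm (2 * max R 0 + 2)
    obtain ⟨τ, hτ, h⟩ := N.exists_solOn schrodingerGroup (le_max_right R 0)
    exact ⟨τ, hτ, _, fun y hy => h y (hy.trans (le_max_left R 0))⟩
  stable R L := by
    obtain ⟨N⟩ := B.exists_normalForm R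
    exact N.exists_norm_sub_le schrodingerGroup incl_injective L

end Background

end DNLS

namespace DNLS

/-! ### Translation to the original notion of solution. -/

namespace Background

open Sobolev

variable {φ : ℝ → ℂ} {B : Background}

theorem shift_ae_eq (h : φ =ᵐ[volume] B.val) (w : Sobolev 2) : shift φ w =ᵐ[volume] B.u w := by
  filter_upwards [h, coeFn_rep 0 w] with x h1 h2
  rw [shift, h1]
  exact congrArg (B.val x + ·) h2

theorem coeFn_field (w : Sobolev 2) : (B.field w : L2) =ᵐ[volume] fun x =>
    Complex.I * (B.d₂ w : L2) x - B.u w x * B.u w x * conj ((B.d w : L2) x) :=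
  ae_sub (ae_smul Complex.I EventuallyEq.rfl) (ae_bmul (B.u w * B.u w) (ae_conj EventuallyEq.rfl))

/-- Uniqueness of weak derivatives identifies the spatial derivatives, so the equation determines
the time derivative. Its continuity in `L²` is then automatic from `continuous_field`. -/
theorem solvesAt_iff (h : φ =ᵐ[volume] B.val) (w : Sobolev 2) (f : L2) :
    SolvesAt (shift φ w) f ↔ f = B.field w := by
  have hu := shift_ae_eq h w
  have hd := (B.hasWeakDeriv_u w).congr hu.symm EventuallyEq.rfl
  have key : ∀ a p r f : ℂ,
      Complex.I * f + r = -Complex.I * a ^ 2 * p ↔ f = Complex.I * r - a * a * p := by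
    intro a p r f
    constructor
    · intro e
      linear_combination (-Complex.I) * e + (f + a ^ 2 * p) * Complex.I_sq
    · rintro rfl
      linear_combination r * Complex.I_sq
  constructor
  · rintro ⟨ux, uxx, h1, h2, he⟩
    have e1 := h1.unique hd
    have e2 := (h2.congr e1 EventuallyEq.rfl).unique (B.hasWeakDeriv_d w)
    apply Lp.ext
    filter_upwards [he, e1, e2, hu, B.coeFn_field w] with x hx h3 h4 h5 h6
    rw [h6, ← key, ← h3, ← h4, ← h5]
    exact hx
  · rintro rfl
    refine ⟨_, _, hd, B.hasWeakDeriv_d w, ?_⟩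
    filter_upwards [hu, B.coeFn_field w] with x h5 h6
    rw [h5, h6, key]

theorem isSolution_iff (h : φ =ᵐ[volume] B.val) {w₀ : Sobolev 2} {Tmin Tmax : EReal}
    {w : ℝ → Sobolev 2} : IsSolution φ w₀ Tmin Tmax w ↔
      0 < Tmin ∧ 0 < Tmax ∧ w 0 = w₀ ∧ SolOn incl B.field w (timeInterval Tmin Tmax) := by
  constructor
  · rintro ⟨h1, h2, h3, hc, ut, -, he⟩
    refine ⟨h1, h2, h3, hc, fun t ht => ?_⟩
    rw [← (solvesAt_iff h _ _).mp (he t ht).2]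
    exact (he t ht).1
  · rintro ⟨h1, h2, h3, hc, he⟩
    exact ⟨h1, h2, h3, hc, fun t => B.field (w t), B.continuous_field.comp_continuousOn hc,
      fun t ht => ⟨he t ht, (solvesAt_iff h _ _).mpr rfl⟩⟩

theorem eqOn_flow_of_isSolution (h : φ =ᵐ[volume] B.val) {w₀ : Sobolev 2} {Tmin Tmax : EReal}
    {w : ℝ → Sobolev 2} (hw : IsSolution φ w₀ Tmin Tmax w) :
    timeInterval Tmin Tmax ⊆ lifespan incl B.field w₀ ∧
      EqOn w (flow incl B.field w₀) (timeInterval Tmin Tmax) := by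
  obtain ⟨h1, h2, h3, hs⟩ := (isSolution_iff h).mp hw
  have ho := isOpen_timeInterval Tmin Tmax
  have hc := ordConnected_timeInterval Tmin Tmax
  have h0 := zero_mem_timeInterval h1 h2
  exact ⟨subset_lifespan ho hc h0 h3 hs, B.locallyWellPosed.eqOn_flow ho hc h0 h3 hs⟩

theorem isSolution_flow (h : φ =ᵐ[volume] B.val) {w₀ : Sobolev 2} {Tmin Tmax : EReal}
    (h1 : 0 < Tmin) (h2 : 0 < Tmax) (hT : timeInterval Tmin Tmax = lifespan incl B.field w₀) :
    IsSolution φ w₀ Tmin Tmax (flow incl B.field w₀) :=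
  (isSolution_iff h).mpr
    ⟨h1, h2, B.locallyWellPosed.flow_zero _, hT ▸ B.locallyWellPosed.solOn_flow _⟩

theorem exists_lifespan_eq (B : Background) (w₀ : Sobolev 2) : ∃ Tmin Tmax : EReal,
    0 < Tmin ∧ 0 < Tmax ∧ timeInterval Tmin Tmax = lifespan incl B.field w₀ :=
  exists_timeInterval (isOpen_lifespan w₀) (ordConnected_lifespan w₀)
    (B.locallyWellPosed.zero_mem_lifespan w₀)

theorem isMaximalSolution_flow (h : φ =ᵐ[volume] B.val) {w₀ : Sobolev 2} {Tmin Tmax : EReal}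
    (h1 : 0 < Tmin) (h2 : 0 < Tmax) (hT : timeInterval Tmin Tmax = lifespan incl B.field w₀) :
    IsMaximalSolution φ w₀ Tmin Tmax (flow incl B.field w₀) := by
  refine ⟨isSolution_flow h h1 h2 hT, fun Smin Smax v hv hl hr _ => ?_⟩
  have hs := le_of_timeInterval_subset hv.Tmin_pos hv.Tmax_pos h1 h2
    (hT ▸ (eqOn_flow_of_isSolution h hv).1)
  exact ⟨le_antisymm hs.1 hl, le_antisymm hs.2 hr⟩

/-- The flow extends every solution, so maximality is tested against the flow itself. -/
theorem eq_of_isMaximalSolution (h : φ =ᵐ[volume] B.val) {w₀ : Sobolev 2} {Tmin Tmax : EReal}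
    (h1 : 0 < Tmin) (h2 : 0 < Tmax) (hT : timeInterval Tmin Tmax = lifespan incl B.field w₀)
    {Smin Smax : EReal} {v : ℝ → Sobolev 2} (hv : IsMaximalSolution φ w₀ Smin Smax v) :
    Smin = Tmin ∧ Smax = Tmax := by
  obtain ⟨hsub, he⟩ := eqOn_flow_of_isSolution h hv.isSolution
  obtain ⟨hl, hr⟩ := le_of_timeInterval_subset hv.isSolution.Tmin_pos hv.isSolution.Tmax_pos h1 h2
    (hT ▸ hsub)
  have := hv.maximal _ _ _ (isSolution_flow h h1 h2 hT) hl hr he.symm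
  exact ⟨this.1.symm, this.2.symm⟩

theorem eqOn_flow_of_isMaximalSolution (h : φ =ᵐ[volume] B.val) {w₀ : Sobolev 2}
    {Smin Smax : EReal} {v : ℝ → Sobolev 2} (hv : IsMaximalSolution φ w₀ Smin Smax v) :
    timeInterval Smin Smax = lifespan incl B.field w₀ ∧
      EqOn v (flow incl B.field w₀) (lifespan incl B.field w₀) := by
  obtain ⟨Tmin, Tmax, h1, h2, hT⟩ := B.exists_lifespan_eq w₀
  obtain ⟨rfl, rfl⟩ := eq_of_isMaximalSolution h h1 h2 hT hv
  exact ⟨hT, hT ▸ (eqOn_flow_of_isSolution h hv.isSolution).2⟩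

end Background

section TimeInterval

variable {Tmin Tmax : EReal}

theorem eventually_mem_timeInterval_left (h1 : 0 < Tmin) (h2 : 0 < Tmax) (h : Tmax < ⊤) :
    Tmax.toReal ∉ timeInterval Tmin Tmax ∧
      ∀ᶠ t in 𝓝[<] Tmax.toReal, t ∈ timeInterval Tmin Tmax := by
  lift Tmax to ℝ using ⟨h.ne, (EReal.bot_lt_zero.trans h2).ne'⟩
  rw [EReal.toReal_coe]
  refine ⟨fun hm => lt_irrefl _ hm.2, ?_⟩
  filter_upwards [Ioo_mem_nhdsLT (EReal.coe_pos.mp h2)] with t ht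
  exact ⟨(zero_mem_timeInterval h1 h2).1.trans (EReal.coe_lt_coe_iff.mpr ht.1),
    EReal.coe_lt_coe_iff.mpr ht.2⟩

theorem eventually_mem_timeInterval_right (h1 : 0 < Tmin) (h2 : 0 < Tmax) (h : Tmin < ⊤) :
    -Tmin.toReal ∉ timeInterval Tmin Tmax ∧
      ∀ᶠ t in 𝓝[>] (-Tmin.toReal), t ∈ timeInterval Tmin Tmax := by
  lift Tmin to ℝ using ⟨h.ne, (EReal.bot_lt_zero.trans h1).ne'⟩
  rw [EReal.toReal_coe]
  refine ⟨fun hm => lt_irrefl _ hm.1, ?_⟩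
  filter_upwards [Ioo_mem_nhdsGT (neg_lt_zero.mpr (EReal.coe_pos.mp h1))] with t ht
  exact ⟨EReal.coe_lt_coe_iff.mpr ht.1,
    (EReal.coe_lt_coe_iff.mpr ht.2).trans (zero_mem_timeInterval h1 h2).2⟩

end TimeInterval

/-- Continuity of the flow with respect to the data, uniformly on compact time intervals. -/
theorem LocallyWellPosed.tendstoUniformlyOn_flow {X Y : Type*} [NormedAddCommGroup X]
    [NormedSpace ℝ X] [NormedAddCommGroup Y] [NormedSpace ℝ Y] {J : Y →L[ℝ] X} {G : Y → X}
    (H : LocallyWellPosed J G) {y : Y} {z : ℕ → Y} (hz : Tendsto z atTop (𝓝 y)) {T₁ T₂ : ℝ}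
    (hT : Icc T₁ T₂ ⊆ lifespan J G y) :
    (∀ᶠ n in atTop, Icc T₁ T₂ ⊆ lifespan J G (z n)) ∧
      TendstoUniformlyOn (fun n => flow J G (z n)) (flow J G y) atTop (Icc T₁ T₂) := by
  rcases lt_or_ge T₂ T₁ with hlt | hle
  · rw [Icc_eq_empty hlt.not_ge]
    exact ⟨Eventually.of_forall fun _ => empty_subset _, tendstoUniformlyOn_empty⟩
  have h0 := H.zero_mem_lifespan y
  -- The interval is enlarged to contain the initial time `0`, where the data are compared.
  have hsub : Icc (min T₁ 0) (max T₂ 0) ⊆ lifespan J G y := by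
    refine (ordConnected_lifespan y).out ?_ ?_
    · rcases min_choice T₁ 0 with e | e <;> rw [e]
      exacts [hT (left_mem_Icc.mpr hle), h0]
    · rcases max_choice T₂ 0 with e | e <;> rw [e]
      exacts [hT (right_mem_Icc.mpr hle), h0]
  have hI : Icc T₁ T₂ ⊆ Icc (min T₁ 0) (max T₂ 0) :=
    Icc_subset_Icc (min_le_left _ _) (le_max_left _ _)
  obtain ⟨δ, hδ, C, hC⟩ := H.exists_flow_sub_le y (min_le_right _ _) (le_max_right _ _) hsub
  have hz0 : Tendsto (fun n => ‖z n - y‖) atTop (𝓝 0) := tendsto_iff_norm_sub_tendsto_zero.mp hz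
  have hev : ∀ᶠ n in atTop, ‖z n - y‖ ≤ δ := hz0.eventually_le_const hδ
  refine ⟨hev.mono fun n hn => hI.trans (hC _ hn).1, ?_⟩
  rw [Metric.tendstoUniformlyOn_iff]
  intro ε hε
  have hlim : Tendsto (fun n => C * ‖z n - y‖) atTop (𝓝 0) := by simpa using hz0.const_mul C
  filter_upwards [hev, hlim.eventually_lt_const hε] with n hn hn' t ht
  rw [dist_comm, dist_eq_norm]
  exact ((hC _ hn).2 t (hI ht)).trans_lt hn'

end DNLS

/-! ### The main theorem. -/

theorem theorem2 (φ : ℝ → ℂ) (hφ : DNLS.MemZhidkov 4 φ) (w₀ : DNLS.Sobolev 2) :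
    ∃ (Tmin Tmax : EReal) (w : ℝ → DNLS.Sobolev 2),
      -- existence of a maximal solution `u = φ + w` with `u(0) = φ + w₀`
      DNLS.IsMaximalSolution φ w₀ Tmin Tmax w ∧
      -- it is the only maximal solution
      (∀ (Smin Smax : EReal) (v : ℝ → DNLS.Sobolev 2),
        DNLS.IsMaximalSolution φ w₀ Smin Smax v →
          Smin = Tmin ∧ Smax = Tmax ∧ EqOn v w (DNLS.timeInterval Tmin Tmax)) ∧
      -- and every solution is a restriction of it
      (∀ (Smin Smax : EReal) (v : ℝ → DNLS.Sobolev 2),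
        DNLS.IsSolution φ w₀ Smin Smax v →
          Smin ≤ Tmin ∧ Smax ≤ Tmax ∧ EqOn v w (DNLS.timeInterval Smin Smax)) ∧
      -- blow-up alternative
      (Tmax < ⊤ → Tendsto (fun t => ‖w t‖) (𝓝[<] Tmax.toReal) atTop) ∧
      (Tmin < ⊤ → Tendsto (fun t => ‖w t‖) (𝓝[>] (-Tmin.toReal)) atTop) ∧
      -- continuous dependence on the initial data
      (∀ (w₀' : ℕ → DNLS.Sobolev 2) (Smin Smax : ℕ → EReal) (v : ℕ → ℝ → DNLS.Sobolev 2),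
        Tendsto w₀' atTop (𝓝 w₀) →
        (∀ n, DNLS.IsMaximalSolution φ (w₀' n) (Smin n) (Smax n) (v n)) →
        ∀ T₁ T₂ : ℝ, Icc T₁ T₂ ⊆ DNLS.timeInterval Tmin Tmax →
          (∀ᶠ n in atTop, Icc T₁ T₂ ⊆ DNLS.timeInterval (Smin n) (Smax n)) ∧
          TendstoUniformlyOn v w atTop (Icc T₁ T₂)) := by
  obtain ⟨B, hB⟩ := hφ.exists_background
  have H := B.locallyWellPosed
  obtain ⟨Tmin, Tmax, h1, h2, hT⟩ := B.exists_lifespan_eq w₀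
  refine ⟨Tmin, Tmax, DNLS.flow DNLS.incl B.field w₀,
    DNLS.Background.isMaximalSolution_flow hB h1 h2 hT, fun Smin Smax v hv => ?_,
    fun Smin Smax v hv => ?_, fun h => ?_, fun h => ?_, fun z Smin Smax v hz hv T₁ T₂ hI => ?_⟩
  · obtain ⟨e1, e2⟩ := DNLS.Background.eq_of_isMaximalSolution hB h1 h2 hT hv
    exact ⟨e1, e2, hT ▸ (DNLS.Background.eqOn_flow_of_isMaximalSolution hB hv).2⟩
  · obtain ⟨hsub, he⟩ := DNLS.Background.eqOn_flow_of_isSolution hB hv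
    have hle := DNLS.le_of_timeInterval_subset hv.Tmin_pos hv.Tmax_pos h1 h2 (hT ▸ hsub)
    exact ⟨hle.1, hle.2, he⟩
  · have hm := DNLS.eventually_mem_timeInterval_left h1 h2 h
    rw [hT] at hm
    exact H.tendsto_norm_flow hm.1 nhdsWithin_le_nhds hm.2
  · have hm := DNLS.eventually_mem_timeInterval_right h1 h2 h
    rw [hT] at hm
    exact H.tendsto_norm_flow hm.1 nhdsWithin_le_nhds hm.2
  · obtain ⟨hev, hu⟩ := H.tendstoUniformlyOn_flow hz (hI.trans hT.subset)
    have hmax := fun n => DNLS.Background.eqOn_flow_of_isMaximalSolution hB (hv n)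
    refine ⟨hev.mono fun n hn => (hmax n).1 ▸ hn, hu.congr ?_⟩
    filter_upwards [hev] with n hn
    exact ((hmax n).2.mono hn).symm
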